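/- **Setting.** Let $\bar s=(s_1,\dots,s_r)$, $\bar d=(d_1,\dots,d_r)$, $\bar\mu=(\mu_1,\dots,\mu_r)$ be vectors of positive integers. For a sequence $\eta(m)$, $m\in\mathbb Z$, put $\chi_{\bar\mu}(\eta(m))=\prod_{i=1}^r(1-B^{\mu_is_i})^{d_i}\eta(m)$, where $B\eta(m)=\eta(m-1)$; the same formula is used for vectors of negative steps. Put $$\chi_{\bar\mu}(z)=\prod_{i=1}^r(1-z^{\mu_is_i})^{d_i},\qquad \beta(i\lambda)=\prod_{j=1}^r\ \prod_{k=-[s_j/2]}^{[s_j/2]}\Big(i\lambda-\frac{2\pi ik}{s_j}\Big)^{d_j},\qquad n=\sum_{i=1}^r\mu_is_id_i,$$ $$\prod_{i=1}^r(1-x^{\mu_is_i})^{d_i}=\sum_k e(k)x^k,\qquad \prod_{i=1}^r\Big(\sum_{j\ge0}x^{\mu_is_ij}\Big)^{d_i}=\sum_k d(k)x^k .$$ Let $\vec\xi(m)=(\xi_1(m),\dots,\xi_T(m))^\top$, $m\in\mathbb Z$, be complex random vectors whose GM increments $\chi_{\bar\mu}(\vec\xi(m))$ are, for all steps $\bar\mu$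 with all components positive or all negative, square integrable, of mean $0$ and jointly wide sense stationary, with spectral density matrix $f$ with respect to $d\lambda/2\pi$: $f$ is integrable on $[-\pi,\pi)$, positive semidefinite, and for all steps $\bar\mu_1,\bar\mu_2$ and all $m,m_0$ $$\mathsf E\,\chi_{\bar\mu_1}(\xi_p(m_0+m))\overline{\chi_{\bar\mu_2}(\xi_q(m_0))}=\frac1{2\pi}\int_{-\pi}^{\pi}e^{i\lambda m}\chi_{\bar\mu_1}(e^{-i\lambda})\chi_{\bar\mu_2}(e^{i\lambda})\frac{f_{pq}(\lambda)}{|\beta(i\lambda)|^2}\,d\lambda .$$ Fix $\bar\mu$ with positive components and let $w(\lambda)=|\beta(i\lambda)|^2/|\chi_{\bar\mu}(e^{-i\lambda})|^2$. Assume the minimality condition: $f(\lambda)$ is invertible for almost every $\lambda$ and $\int_{-\pi}^{\pi}\operatorname{Tr}[w(\lambda)f^{-1}(\lambda)]\,d\lambda<\infty$. Let $\vec a(k)\in\mathbb C^T$, $k\ge0$, be such that the series $\vec b(k)=(D^\mu\mathbf a)_k=\sum_{m\ge k}d(m-k)\vec a(m)$ converge and $\sum_k\|\vec a(k)\|$,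 $\sum_k(k+1)\|\vec a(k)\|^2$, $\sum_k\|\vec b(k)\|$, $\sum_k(k+1)\|\vec b(k)\|^2$ are finite. Put $$\vec v(k)=\sum_{l=0}^{k+n}e(l-k)\vec b(l)\ \ (-n\le k\le-1),\qquad V\vec\xi=\sum_{k=-n}^{-1}\vec v(k)^\top\vec\xi(k),\qquad \vec B(e^{i\lambda})=\sum_{k\ge0}\vec b(k)e^{i\lambda k}.$$ The functional $A\vec\xi=\sum_{k\ge0}\vec a(k)^\top\vec\xi(k)$ is understood as a mean square limit of functionals with finitely many coefficients $\vec a_N(k)$ such that $\vec a_N(k)\to\vec a(k)$ and $(D^\mu\mathbf a_N)_k\to\vec b(k)$ for every $k$. Let $H^{0-}$ be the closed subspace of $L_2(\Omega)$ generated by the observed increments $\chi_{\bar\mu}(\xi_p(k))$, $k\le-1$, $1\le p\le T$. The linear estimates of $A\vec\xi$ from the observations at $m\le-1$ are the variables $Y-V\vec\xi$ with $Y\in H^{0-}$; an optimal one minimizes the mean square error. Let $L_2(f)$ have the inner product $\frac1{2\pi}\int_{-\pi}^{\pi}g_1^\top f\,\overline{g_2}\,d\lambda$, and let $L_2^{0-}(f)$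 be its closed subspace generated by $e^{i\lambda k}\chi_{\bar\mu}(e^{-i\lambda})\beta(i\lambda)^{-1}\boldsymbol\delta_l$, $k\le-1$, $1\le l\le T$, where $\boldsymbol\delta_l$ is the $l$-th unit vector. Let $\mathbf F_\mu$ be the linear operator determined by the $T\times T$ blocks $$F^\mu(k,j)=\frac1{2\pi}\int_{-\pi}^{\pi}e^{i\lambda(j-k)}w(\lambda)\,(f^{-1}(\lambda))^\top\,d\lambda ,\qquad k,j\ge0,\qquad (\mathbf F_\mu\mathbf c)_j=\sum_kF^\mu(j,k)\vec c(k),$$ extended by continuity from finitely supported sequences in the norm $\langle\mathbf F_\mu\mathbf c,\mathbf c\rangle^{1/2}$; that is, $\mathbf F_\mu\mathbf c=\mathbf b$ means that there are finitely supported $\mathbf c_N$, Cauchy in this norm, with $\mathbf c_N\to\mathbf c$ and $\mathbf F_\mu\mathbf c_N\to\mathbf b$ coordinatewise. **Theorem.** 1. There is a process $\vec Z$ on $[-\pi,\pi)$ with uncorrelated increments, where $\mathsf E(Z_p(\lambda_2)-Z_p(\lambda_1))\overline{(Z_q(\lambda_2)-Z_q(\lambda_1))}=\frac1{2\pi}\int_{\lambda_1}^{\lambda_2}f_{pq}\,d\lambda$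 for $\lambda_1\le\lambda_2$, such that $\chi_{\bar\nu}(\xi_p(m))=\int_{-\pi}^{\pi}e^{i\lambda m}\chi_{\bar\nu}(e^{-i\lambda})\beta(i\lambda)^{-1}dZ_p(\lambda)$ for all $m$, $p$ and all steps $\bar\nu$ with all components positive or all negative. The functional $A\vec\xi$ exists and is unique almost surely; it is the mean square sum of the series $\sum_k\vec a(k)^\top\vec\xi(k)$ whenever that sum exists. 2. There is exactly one $\mathbf c=\mathbf F_\mu^{-1}D^\mu\mathbf a$ with $\mathbf F_\mu\mathbf c=D^\mu\mathbf a$. If $\mathbf F_\mu$ is bounded on $\ell_2$, any $\mathbf c'\in\ell_2$ with $\vec b(j)=\sum_kF^\mu(j,k)\vec c\,'(k)$ for all $j$ is equal to $\mathbf c$. There is an integrable function $\vec C(\lambda)$ with Fourier series $\sum_{k\ge0}\vec c(k)e^{i\lambda k}$. 3. The function $\vec h$ given by $$\vec h(\lambda)^\top=\vec B(e^{i\lambda})^\top\frac{\chi_{\bar\mu}(e^{-i\lambda})}{\beta(i\lambda)}-\frac{\overline{\beta(i\lambda)}}{\chi_{\bar\mu}(e^{i\lambda})}\Big(\sum_{k\ge0}(\mathbf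 F_\mu^{-1}D^\mu\mathbf a)_ke^{i\lambda k}\Big)^{\!\top}f^{-1}(\lambda)$$ (the series standing for $\vec C$) is the orthogonal projection of $\vec B(e^{i\lambda})\chi_{\bar\mu}(e^{-i\lambda})/\beta(i\lambda)$ on $L_2^{0-}(f)$. For every process $\vec Z$ as in 1, $$\widehat A\vec\xi=\int_{-\pi}^{\pi}\vec h(\lambda)^\top d\vec Z(\lambda)-\sum_{k=-n}^{-1}\vec v(k)^\top\vec\xi(k)$$ is the (almost surely unique) optimal linear estimate of $A\vec\xi$, and $$\mathsf E|A\vec\xi-\widehat A\vec\xi|^2=\frac1{2\pi}\int_{-\pi}^{\pi}w(\lambda)\,\vec C(\lambda)^\top f^{-1}(\lambda)\overline{\vec C(\lambda)}\,d\lambda=\langle D^\mu\mathbf a,\mathbf F_\mu^{-1}D^\mu\mathbf a\rangle .$$ 4. Suppose that the increments have a canonical moving average representation $\chi_{\bar\mu}(\vec\xi(m))=\sum_{k\ge0}\varphi_\mu(k)\vec\varepsilon(m-k)$, where the $\varphi_\mu(k)$ are square summable $T\times q$ matrices and the $\varepsilon_j(u)$, $j\le q$, $u\in\mathbb Z$,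 are orthonormal and, for every $m$, those with $u\le m$ generate the same closed subspace as the increments at times $\le m$; and that $\frac{|\chi_{\bar\mu}(e^{-i\lambda})|^2}{|\beta(i\lambda)|^2}f(\lambda)=\Phi_\mu(e^{-i\lambda})\Phi_\mu^*(e^{-i\lambda})$ with $\Phi_\mu(e^{-i\lambda})=\sum_{k\ge0}\varphi_\mu(k)e^{-i\lambda k}$. Then a matrix function $\Psi_\mu$ with $\Psi_\mu(e^{-i\lambda})\Phi_\mu(e^{-i\lambda})=E_q$ almost everywhere exists, and for every such $\Psi_\mu$ the projection and the spectral characteristic of the optimal estimate in 3 are also given by $$\vec h(\lambda)=\frac{\chi_{\bar\mu}(e^{-i\lambda})}{\beta(i\lambda)}\Big(\vec B(e^{i\lambda})-\Psi_\mu(e^{-i\lambda})^\top\vec r(e^{i\lambda})\Big),\qquad \vec r(e^{i\lambda})=\sum_{k\ge0}(D^\mu\mathbf A\varphi_\mu)_ke^{i\lambda k},$$ $$(D^\mu\mathbf A\varphi_\mu)_k=\sum_{m\ge0}\varphi_\mu(m)^\top\sum_{l\ge m}d(l-m)\vec a(l+k),$$ where the last series over $m$ converge absolutely, and $$\mathsf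 E|A\vec\xi-\widehat A\vec\xi|^2=\frac1{2\pi}\int_{-\pi}^{\pi}\|\vec r(e^{i\lambda})\|^2d\lambda=\sum_{k\ge0}\|(D^\mu\mathbf A\varphi_\mu)_k\|^2=\|D^\mu\mathbf A\varphi_\mu\|^2 .$$ -/

import Mathlib

open MeasureTheory Filter Topology
open scoped ENNReal Matrix ComplexConjugate ComplexOrder

namespace GM

noncomputable section

/-! Generalized multiple (GM) increments, with `r` seasonal factors: `s i` is the season, `d i` the
order and `μ i` the step of the `i`-th factor. -/

/-- Admissible integer steps: all positive or all negative. -/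
def AdmissibleStep {r : ℕ} (μ : Fin r → ℤ) : Prop :=
  (∀ i, 0 < μ i) ∨ (∀ i, μ i < 0)

/-- The GM increment `∏ i, (1 - B ^ (μ i * s i)) ^ (d i)` applied to the sequence `η`, at time `m`. -/
def gmInc {r : ℕ} {Ω : Type*} (μ : Fin r → ℤ) (s d : Fin r → ℕ) (η : ℤ → Ω → ℂ) (m : ℤ) : Ω → ℂ :=
  fun ω => ∑ l ∈ Fintype.piFinset (fun i => Finset.range (d i + 1)),
    (∏ i, (-1 : ℂ) ^ (l i) * ((d i).choose (l i) : ℂ)) *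
      η (m - ∑ i, μ i * (s i : ℤ) * (l i : ℤ)) ω

/-- The GM increment of a vector sequence, componentwise. -/
def vecInc {r T : ℕ} {Ω : Type*} (μ : Fin r → ℤ) (s d : Fin r → ℕ) (ξ : ℤ → Fin T → Ω → ℂ)
    (m : ℤ) (p : Fin T) : Ω → ℂ :=
  gmInc μ s d (fun k => ξ k p) m

/-- `χ_μ(z) = ∏ i, (1 - z ^ (μ i * s i)) ^ (d i)`. -/
def chi {r : ℕ} (μ : Fin r → ℤ) (s d : Fin r → ℕ) (z : ℂ) : ℂ :=
  ∏ i, (1 - z ^ (μ i * (s i : ℤ))) ^ (d i)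

/-- `e^{i x}`. -/
def ex (x : ℝ) : ℂ := Complex.exp (Complex.I * (x : ℂ))

/-- `β(iλ) = ∏ j, ∏_{|k| ≤ [s j / 2]} (iλ - 2πik / s j) ^ (d j)`. -/
def beta {r : ℕ} (s d : Fin r → ℕ) (t : ℝ) : ℂ :=
  ∏ j, ∏ k ∈ Finset.Icc (-((s j / 2 : ℕ) : ℤ)) ((s j / 2 : ℕ) : ℤ),
    (Complex.I * (t : ℂ) - 2 * (Real.pi : ℂ) * Complex.I * (k : ℂ) / (s j : ℂ)) ^ (d j)

/-- The normalized Lebesgue measure `dλ / 2π` on `[-π, π)`. -/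
def circ : Measure ℝ :=
  (ENNReal.ofReal (2 * Real.pi))⁻¹ • volume.restrict (Set.Ico (-Real.pi) Real.pi)

/-- The Euclidean norm of a complex vector. -/
def eucl {T : ℕ} (x : Fin T → ℂ) : ℝ := ‖WithLp.toLp 2 x‖

section Prob

variable {Ω : Type*} [MeasurableSpace Ω]

/-- The random vectors `ξ k` have wide sense stationary GM increments (seasons `s`, orders `d`). -/
structure StationaryGM {r T : ℕ} (P : Measure Ω) (s d : Fin r → ℕ)
    (ξ : ℤ → Fin T → Ω → ℂ) : Prop where
  measurable : ∀ k p, Measurable (ξ k p)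
  memLp : ∀ μ : Fin r → ℤ, AdmissibleStep μ → ∀ m p, MemLp (vecInc μ s d ξ m p) 2 P
  mean : ∀ μ : Fin r → ℤ, AdmissibleStep μ →
    ∃ c : Fin T → ℂ, ∀ m p, ∫ ω, vecInc μ s d ξ m p ω ∂P = c p
  structural : ∀ μ₁ μ₂ : Fin r → ℤ, AdmissibleStep μ₁ → AdmissibleStep μ₂ → ∀ (m : ℤ) (p q : Fin T),
    ∃ D : ℂ, ∀ m₀ : ℤ,
      ∫ ω, vecInc μ₁ s d ξ (m₀ + m) p ω * conj (vecInc μ₂ s d ξ m₀ q ω) ∂P = D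

/-- `f` is the spectral density matrix, with respect to `dλ / 2π`, of the stationary GM increments. -/
structure SpectralDensity {r T : ℕ} (P : Measure Ω) (s d : Fin r → ℕ)
    (ξ : ℤ → Fin T → Ω → ℂ) (f : ℝ → Matrix (Fin T) (Fin T) ℂ) : Prop where
  integrable : ∀ p q, Integrable (fun t => f t p q) circ
  posSemidef : ∀ᵐ t ∂circ, (f t).PosSemidef
  structural : ∀ μ₁ μ₂ : Fin r → ℤ, AdmissibleStep μ₁ → AdmissibleStep μ₂ →
    ∀ (m m₀ : ℤ) (p q : Fin T),
      ∫ ω, vecInc μ₁ s d ξ (m₀ + m) p ω * conj (vecInc μ₂ s d ξ m₀ q ω) ∂P =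
        ∫ t, ex (t * m) * chi μ₁ s d (ex (-t)) * chi μ₂ s d (ex t) / (‖beta s d t‖ ^ 2 : ℝ) *
          f t p q ∂circ

/-- The closed subspace of `L²(P)` generated by the variables `X m p` with `m ≤ q`. -/
def pastSpace {ι : Type*} (P : Measure Ω) (X : ℤ → ι → Ω → ℂ) (q : ℤ) : Submodule ℂ (Lp ℂ 2 P) :=
  (Submodule.span ℂ {x : Lp ℂ 2 P | ∃ m ≤ q, ∃ p, x =ᵐ[P] X m p}).topologicalClosure

end Prob

/-! The Hilbert space `L²(f)`. -/

/-- `(1 / 2π) ∫ g₁ᵀ f conj(g₂) dλ`. -/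
def specInner {T : ℕ} (f : ℝ → Matrix (Fin T) (Fin T) ℂ) (g₁ g₂ : ℝ → Fin T → ℂ) : ℂ :=
  ∫ t, g₁ t ⬝ᵥ (f t *ᵥ star (g₂ t)) ∂circ

/-- The squared norm of `L²(f)`, as an extended nonnegative number. -/
def specNormSq {T : ℕ} (f : ℝ → Matrix (Fin T) (Fin T) ℂ) (g : ℝ → Fin T → ℂ) : ℝ≥0∞ :=
  ∫⁻ t, ENNReal.ofReal (g t ⬝ᵥ (f t *ᵥ star (g t))).re ∂circ

/-- Membership in `L²(f)`. -/
def MemL2 {T : ℕ} (f : ℝ → Matrix (Fin T) (Fin T) ℂ) (g : ℝ → Fin T → ℂ) : Prop :=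
  AEStronglyMeasurable g circ ∧ specNormSq f g < ⊤

/-- The function `e^{iλk} χ_μ(e^{-iλ}) β(iλ)⁻¹ δ_l`. -/
def gen {r T : ℕ} (μ : Fin r → ℤ) (s d : Fin r → ℕ) (k : ℤ) (l : Fin T) : ℝ → Fin T → ℂ :=
  fun t => (ex (t * k) * chi μ s d (ex (-t)) / beta s d t) • Pi.single l 1

/-- Membership in the closed subspace of `L²(f)` generated by `gen μ s d k l`, `k ≤ -1`. -/
def MemL2Past {r T : ℕ} (μ : Fin r → ℤ) (s d : Fin r → ℕ) (f : ℝ → Matrix (Fin T) (Fin T) ℂ)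
    (h : ℝ → Fin T → ℂ) : Prop :=
  MemL2 f h ∧ ∀ ε : ℝ≥0∞, 0 < ε →
    ∃ g ∈ Submodule.span ℂ {g | ∃ k : ℤ, k ≤ -1 ∧ ∃ l : Fin T, g = gen μ s d k l},
      specNormSq f (h - g) < ε

/-- `h` is the orthogonal projection of `u` on that subspace. -/
def IsPastProjection {r T : ℕ} (μ : Fin r → ℤ) (s d : Fin r → ℕ)
    (f : ℝ → Matrix (Fin T) (Fin T) ℂ) (u h : ℝ → Fin T → ℂ) : Prop :=
  MemL2 f u ∧ MemL2Past μ s d f h ∧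
    ∀ (k : ℤ) (l : Fin T), k ≤ -1 → specInner f (u - h) (gen μ s d k l) = 0

/-! Stochastic integrals with respect to a process with uncorrelated increments. -/

/-- A vector step function: a finite sum of the functions `1_{[lo i, hi i)} coef i`. -/
structure StepFn (T : ℕ) where
  n : ℕ
  lo : Fin n → ℝ
  hi : Fin n → ℝ
  coef : Fin n → Fin T → ℂ
  mem : ∀ i, lo i ∈ Set.Ico (-Real.pi) Real.pi ∧ hi i ∈ Set.Ico (-Real.pi) Real.pi ∧ lo i ≤ hi i

/-- The values of a step function. -/
def StepFn.toFun {T : ℕ} (S : StepFn T) : ℝ → Fin T → ℂ :=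
  fun t => ∑ i, (Set.Ico (S.lo i) (S.hi i)).indicator (fun _ => S.coef i) t

/-- `∫ Sᵀ dZ` for a step function `S`. -/
def StepFn.integral {T : ℕ} {Ω : Type*} (S : StepFn T) (Z : ℝ → Fin T → Ω → ℂ) : Ω → ℂ :=
  fun ω => ∑ i, ∑ p, S.coef i p * (Z (S.hi i) p ω - Z (S.lo i) p ω)

section Prob

variable {Ω : Type*} [MeasurableSpace Ω]

/-- `X = ∫ hᵀ dZ`: `X` is the mean square limit of the integrals of step functions that tend to `h`
in `L²(f)`. -/
def IsSpectralIntegral {T : ℕ} (P : Measure Ω) (f : ℝ → Matrix (Fin T) (Fin T) ℂ)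
    (Z : ℝ → Fin T → Ω → ℂ) (h : ℝ → Fin T → ℂ) (X : Ω → ℂ) : Prop :=
  MemL2 f h ∧ MemLp X 2 P ∧ ∃ S : ℕ → StepFn T,
    Tendsto (fun n => specNormSq f (h - (S n).toFun)) atTop (𝓝 0) ∧
    Tendsto (fun n => eLpNorm ((S n).integral Z - X) 2 P) atTop (𝓝 0)

/-- `Z` is the process with uncorrelated increments on `[-π, π)`, with spectral density `f` (with
respect to `dλ / 2π`), which gives the spectral representation of the GM increments of `ξ`. -/
structure SpectralRep {r T : ℕ} (P : Measure Ω) (s d : Fin r → ℕ)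
    (ξ : ℤ → Fin T → Ω → ℂ) (f : ℝ → Matrix (Fin T) (Fin T) ℂ) (Z : ℝ → Fin T → Ω → ℂ) : Prop where
  memLp : ∀ x ∈ Set.Ico (-Real.pi) Real.pi, ∀ y ∈ Set.Ico (-Real.pi) Real.pi, ∀ p,
    MemLp (Z y p - Z x p) 2 P
  variance : ∀ x ∈ Set.Ico (-Real.pi) Real.pi, ∀ y ∈ Set.Ico (-Real.pi) Real.pi, x ≤ y → ∀ p q,
    ∫ ω, (Z y p ω - Z x p ω) * conj (Z y q ω - Z x q ω) ∂P = ∫ t in Set.Ico x y, f t p q ∂circ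
  uncorrelated : ∀ x ∈ Set.Ico (-Real.pi) Real.pi, ∀ y ∈ Set.Ico (-Real.pi) Real.pi,
    ∀ x' ∈ Set.Ico (-Real.pi) Real.pi, ∀ y' ∈ Set.Ico (-Real.pi) Real.pi,
    x ≤ y → y ≤ x' → x' ≤ y' → ∀ p q,
    ∫ ω, (Z y p ω - Z x p ω) * conj (Z y' q ω - Z x' q ω) ∂P = 0
  representation : ∀ μ : Fin r → ℤ, AdmissibleStep μ → ∀ (m : ℤ) (p : Fin T),
    IsSpectralIntegral P f Z (gen μ s d m p) (vecInc μ s d ξ m p)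

end Prob

/-! From here on the step `μ` is positive and is given by natural numbers. -/

/-- A natural step as an integer step. -/
def zstep {r : ℕ} (μ : Fin r → ℕ) : Fin r → ℤ := fun i => (μ i : ℤ)

/-- The coefficients of `∏ i, (∑ j, x ^ (μ i * s i * j)) ^ (d i)`. -/
def dCoef {r : ℕ} (μ s d : Fin r → ℕ) (k : ℕ) : ℂ :=
  PowerSeries.coeff k
    (∏ i, (PowerSeries.mk fun n => if μ i * s i ∣ n then (1 : ℂ) else 0) ^ (d i))

/-- The coefficients of `∏ i, (1 - x ^ (μ i * s i)) ^ (d i)`. -/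
def eCoef {r : ℕ} (μ s d : Fin r → ℕ) (k : ℕ) : ℂ :=
  (∏ i, (1 - (Polynomial.X : Polynomial ℂ) ^ (μ i * s i)) ^ (d i)).coeff k

/-- `n(γ) = ∑ i, μ i * s i * d i`. -/
def nGamma {r : ℕ} (μ s d : Fin r → ℕ) : ℕ := ∑ i, μ i * s i * d i

/-- Partial sums of the series `(D a)_k = ∑_{m ≥ k} d(m - k) a(m)`. -/
def dPartial {r T : ℕ} (μ s d : Fin r → ℕ) (a : ℕ → Fin T → ℂ) (k N : ℕ) : Fin T → ℂ :=
  ∑ j ∈ Finset.range N, dCoef μ s d j • a (k + j)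

/-- All the series `(D a)_k` converge. -/
def DConverges {r T : ℕ} (μ s d : Fin r → ℕ) (a : ℕ → Fin T → ℂ) : Prop :=
  ∀ k, ∃ L, Tendsto (dPartial μ s d a k) atTop (𝓝 L)

/-- `(D a)_k = ∑_{m ≥ k} d(m - k) a(m)`. -/
def Dop {r T : ℕ} (μ s d : Fin r → ℕ) (a : ℕ → Fin T → ℂ) (k : ℕ) : Fin T → ℂ :=
  limUnder atTop (dPartial μ s d a k)

/-- `∑ ‖x(k)‖ < ∞` and `∑ (k + 1) ‖x(k)‖² < ∞`. -/
def CoefCondition {T : ℕ} (x : ℕ → Fin T → ℂ) : Prop :=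
  (Summable fun k => eucl (x k)) ∧ Summable fun k : ℕ => ((k : ℝ) + 1) * eucl (x k) ^ 2

/-- `v(-j) = ∑_{l=0}^{n(γ) - j} e(l + j) (D a)_l`, for `1 ≤ j ≤ n(γ)`. -/
def vCoef {r T : ℕ} (μ s d : Fin r → ℕ) (a : ℕ → Fin T → ℂ) (j : ℕ) : Fin T → ℂ :=
  ∑ l ∈ Finset.range (nGamma μ s d - j + 1), eCoef μ s d (l + j) • Dop μ s d a l

/-- The functional of the initial values `Vξ = ∑_{k=-n(γ)}^{-1} v(k)ᵀ ξ(k)`. -/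
def initial {r T : ℕ} {Ω : Type*} (μ s d : Fin r → ℕ) (a : ℕ → Fin T → ℂ)
    (ξ : ℤ → Fin T → Ω → ℂ) : Ω → ℂ :=
  fun ω => ∑ j ∈ Finset.Icc 1 (nGamma μ s d), ∑ p, vCoef μ s d a j p * ξ (-(j : ℤ)) p ω

/-- `∑ k, x(k)ᵀ ξ(k)` for finitely many nonzero coefficients `x(k)`. -/
def finFunctional {T : ℕ} {Ω : Type*} (x : ℕ →₀ (Fin T → ℂ)) (ξ : ℤ → Fin T → Ω → ℂ) : Ω → ℂ :=
  fun ω => x.sum fun k y => ∑ p, y p * ξ (k : ℤ) p ω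

section Prob

variable {Ω : Type*} [MeasurableSpace Ω]

/-- `A = ∑_{k ≥ 0} a(k)ᵀ ξ(k)`, in the ordinary sense: the partial sums tend to `A` in mean square. -/
def IsSeriesSum {T : ℕ} (P : Measure Ω) (a : ℕ → Fin T → ℂ) (ξ : ℤ → Fin T → Ω → ℂ)
    (A : Ω → ℂ) : Prop :=
  AEStronglyMeasurable A P ∧
    Tendsto (fun N => eLpNorm ((fun ω => ∑ k ∈ Finset.range N, ∑ p, a k p * ξ (k : ℤ) p ω) - A) 2 P)
      atTop (𝓝 0)

/-- `A = ∑_{k ≥ 0} a(k)ᵀ ξ(k)`, in the wide sense: `A` is the mean square limit of functionals with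
finitely many coefficients `x n k`, where `x n k → a k` and `(D (x n))_k → (D a)_k` for each `k`. The
truncations of `a` are one such choice, so sums in the ordinary sense are included. -/
def IsFunctional {r T : ℕ} (P : Measure Ω) (μ s d : Fin r → ℕ) (a : ℕ → Fin T → ℂ)
    (ξ : ℤ → Fin T → Ω → ℂ) (A : Ω → ℂ) : Prop :=
  AEStronglyMeasurable A P ∧ ∃ x : ℕ → ℕ →₀ (Fin T → ℂ),
    (∀ k, Tendsto (fun n => x n k) atTop (𝓝 (a k))) ∧
    (∀ k, Tendsto (fun n => Dop μ s d (fun j => x n j) k) atTop (𝓝 (Dop μ s d a k))) ∧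
    Tendsto (fun n => eLpNorm (finFunctional (x n) ξ - A) 2 P) atTop (𝓝 0)

/-- Linear estimates: an element of the closed subspace generated by the observed increments, minus
the observed initial values `Vξ`. -/
def IsLinearEstimate {r T : ℕ} (P : Measure Ω) (μ s d : Fin r → ℕ) (a : ℕ → Fin T → ℂ)
    (ξ : ℤ → Fin T → Ω → ℂ) (X : Ω → ℂ) : Prop :=
  ∃ Y ∈ pastSpace P (vecInc (zstep μ) s d ξ) (-1),
    X =ᵐ[P] fun ω => (Y : Ω → ℂ) ω - initial μ s d a ξ ω

/-- A linear estimate of `A` with the least mean square error. -/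
def IsOptimalEstimate {r T : ℕ} (P : Measure Ω) (μ s d : Fin r → ℕ) (a : ℕ → Fin T → ℂ)
    (ξ : ℤ → Fin T → Ω → ℂ) (A X : Ω → ℂ) : Prop :=
  IsLinearEstimate P μ s d a ξ X ∧ ∀ X', IsLinearEstimate P μ s d a ξ X' →
    ∫⁻ ω, ‖A ω - X ω‖ₑ ^ 2 ∂P ≤ ∫⁻ ω, ‖A ω - X' ω‖ₑ ^ 2 ∂P

end Prob

/-- The weight `|β(iλ)|² / |χ_μ(e^{-iλ})|²`. -/
def weight {r : ℕ} (μ s d : Fin r → ℕ) (t : ℝ) : ℝ :=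
  ‖beta s d t‖ ^ 2 / ‖chi (zstep μ) s d (ex (-t))‖ ^ 2

/-- The minimality condition; the existence of `f⁻¹` almost everywhere is a part of it. -/
def Minimality {r T : ℕ} (μ s d : Fin r → ℕ) (f : ℝ → Matrix (Fin T) (Fin T) ℂ) : Prop :=
  (∀ᵐ t ∂circ, IsUnit (f t).det) ∧
    Integrable (fun t => (((weight μ s d t : ℝ) : ℂ) • (f t)⁻¹).trace) circ

/-- The Fourier coefficients
`F(k,j) = (1 / 2π) ∫ e^{iλ(j-k)} |β(iλ)|² / |χ_μ(e^{-iλ})|² (f(λ)⁻¹)ᵀ dλ`. -/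
def Fcoef {r T : ℕ} (μ s d : Fin r → ℕ) (f : ℝ → Matrix (Fin T) (Fin T) ℂ) (k j : ℕ) :
    Matrix (Fin T) (Fin T) ℂ :=
  Matrix.of fun p q =>
    ∫ t, ex (t * ((j : ℝ) - (k : ℝ))) * ((weight μ s d t : ℝ) : ℂ) * ((f t)⁻¹)ᵀ p q ∂circ

/-- `(F x)_j = ∑ k, F(j,k) x(k)` for a finitely supported `x`. -/
def Fapply {r T : ℕ} (μ s d : Fin r → ℕ) (f : ℝ → Matrix (Fin T) (Fin T) ℂ)
    (x : ℕ →₀ (Fin T → ℂ)) (j : ℕ) : Fin T → ℂ :=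
  x.sum fun k y => Fcoef μ s d f j k *ᵥ y

/-- The quadratic form `⟨F x, x⟩` for a finitely supported `x`. -/
def Fform {r T : ℕ} (μ s d : Fin r → ℕ) (f : ℝ → Matrix (Fin T) (Fin T) ℂ)
    (x : ℕ →₀ (Fin T → ℂ)) : ℝ :=
  (x.sum fun j y => Fapply μ s d f x j ⬝ᵥ star y).re

/-- `F c = b`, where `F` is the linear operator determined by the matrix `F(j,k)`, extended by
continuity from finitely supported sequences in the norm `⟨F x, x⟩ ^ (1/2)` of its quadratic form. (It
need not be bounded on `ℓ²`, and its inverse need not take values in `ℓ²`.) -/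
def FRel {r T : ℕ} (μ s d : Fin r → ℕ) (f : ℝ → Matrix (Fin T) (Fin T) ℂ)
    (c b : ℕ → Fin T → ℂ) : Prop :=
  ∃ x : ℕ → ℕ →₀ (Fin T → ℂ),
    (∀ ε : ℝ, 0 < ε → ∃ n₀, ∀ m ≥ n₀, ∀ n ≥ n₀, Fform μ s d f (x m - x n) < ε) ∧
    (∀ k, Tendsto (fun n => x n k) atTop (𝓝 (c k))) ∧
    (∀ j, Tendsto (fun n => Fapply μ s d f (x n) j) atTop (𝓝 (b j)))

/-- `C(λ) = ∑_{k ≥ 0} c(k) e^{iλk}`: `C` is the integrable function with this Fourier series. -/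
def IsFourierSum {E : Type*} [NormedAddCommGroup E] [NormedSpace ℂ E] (C : ℝ → E) (c : ℕ → E) :
    Prop :=
  Integrable C circ ∧ (∀ k : ℕ, ∫ t, ex (-(t * k)) • C t ∂circ = c k) ∧
    ∀ k : ℕ, ∫ t, ex (t * ((k : ℝ) + 1)) • C t ∂circ = 0

/-- `B_μ(e^{iλ}) = ∑_{k ≥ 0} (D a)_k e^{iλk}`. -/
def Bfun {r T : ℕ} (μ s d : Fin r → ℕ) (a : ℕ → Fin T → ℂ) (t : ℝ) : Fin T → ℂ :=
  ∑' k : ℕ, ex (t * k) • Dop μ s d a k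

/-- `B_μ(e^{iλ}) χ_μ(e^{-iλ}) / β(iλ)`. -/
def Bchi {r T : ℕ} (μ s d : Fin r → ℕ) (a : ℕ → Fin T → ℂ) (t : ℝ) : Fin T → ℂ :=
  (chi (zstep μ) s d (ex (-t)) / beta s d t) • Bfun μ s d a t

/-- The spectral characteristic `h`, where
`hᵀ = Bᵀ χ_μ(e^{-iλ}) / β(iλ) - (conj(β(iλ)) / χ_μ(e^{iλ})) Cᵀ f⁻¹`. -/
def hChar {r T : ℕ} (μ s d : Fin r → ℕ) (f : ℝ → Matrix (Fin T) (Fin T) ℂ) (a : ℕ → Fin T → ℂ)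
    (C : ℝ → Fin T → ℂ) (t : ℝ) : Fin T → ℂ :=
  Bchi μ s d a t - (conj (beta s d t) / chi (zstep μ) s d (ex t)) • (C t ᵥ* (f t)⁻¹)

/-- `(D A φ)_k = ∑_{m ≥ 0} φ(m)ᵀ ∑_{l ≥ m} D(m,l) a(l + k)`. -/
def DAphi {r T q : ℕ} (μ s d : Fin r → ℕ) (a : ℕ → Fin T → ℂ)
    (φ : ℕ → Matrix (Fin T) (Fin q) ℂ) (k : ℕ) : Fin q → ℂ :=
  ∑' m : ℕ, (φ m)ᵀ *ᵥ Dop μ s d (fun l => a (l + k)) m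

/-- `h = (χ_μ(e^{-iλ}) / β(iλ)) (B - Ψᵀ ρ)`. -/
def hSimple {r T q : ℕ} (μ s d : Fin r → ℕ) (a : ℕ → Fin T → ℂ)
    (Ψ : ℝ → Matrix (Fin q) (Fin T) ℂ) (ρ : ℝ → Fin q → ℂ) (t : ℝ) : Fin T → ℂ :=
  (chi (zstep μ) s d (ex (-t)) / beta s d t) • (Bfun μ s d a t - (Ψ t)ᵀ *ᵥ ρ t)

/-- The canonical moving average representation `∑_{k ≥ 0} φ(k) ε(m - k)` of the GM increments with
innovations `ε`, and the canonical factorization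
`|χ_μ(e^{-iλ})|² / |β(iλ)|² f(λ) = Φ_μ(e^{-iλ}) Φ_μ(e^{-iλ})*`, `Φ_μ(e^{-iλ}) = ∑_{k ≥ 0} φ(k) e^{-iλk}`.
Here `Φ t` is `Φ_μ(e^{-it})`. -/
structure CanonicalFactorization {r T q : ℕ} {Ω : Type*} [MeasurableSpace Ω] (P : Measure Ω)
    (μ s d : Fin r → ℕ) (ξ : ℤ → Fin T → Ω → ℂ) (f : ℝ → Matrix (Fin T) (Fin T) ℂ)
    (φ : ℕ → Matrix (Fin T) (Fin q) ℂ) (Φ : ℝ → Matrix (Fin T) (Fin q) ℂ)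
    (ε : ℤ → Fin q → Ω → ℂ) : Prop where
  memLp : ∀ u k, MemLp (ε u k) 2 P
  orthonormal : ∀ u v k j,
    ∫ ω, ε u k ω * conj (ε v j ω) ∂P = if u = v ∧ k = j then 1 else 0
  innovation : ∀ m : ℤ, pastSpace P (vecInc (zstep μ) s d ξ) m = pastSpace P ε m
  summable : ∀ i j, Summable fun k => ‖φ k i j‖ ^ 2
  movingAverage : ∀ (m : ℤ) (p : Fin T),
    Tendsto (fun N => eLpNorm (vecInc (zstep μ) s d ξ m p -
      fun ω => ∑ k ∈ Finset.range N, ∑ j, φ k p j * ε (m - (k : ℤ)) j ω) 2 P) atTop (𝓝 0)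
  fourier : ∀ i j, IsFourierSum (fun t => Φ (-t) i j) (fun k => φ k i j)
  factorization : ∀ᵐ t ∂circ,
    ((‖chi (zstep μ) s d (ex (-t))‖ ^ 2 / ‖beta s d t‖ ^ 2 : ℝ) : ℂ) • f t = Φ t * (Φ t)ᴴ

end

end GM

/-!
Forecasting of vector processes with stationary generalized multiple increments.

Choose a measurable factor `f = R Rᴴ` of the spectral density. Multiplication by `Rᵀ` turns `L²(f)`
into the space `VecL2 T` of square integrable vector functions on the circle
(`GM.SpecFactor.toH`). There the generators `e^{iλk} χ_μ(e^{-iλ}) β(iλ)⁻¹ δ_p` become a family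
`J k p`, the columns of an almost everywhere invertible matrix function times exponentials. The
inverse adjoint matrix gives a family `K k p`, biorthogonal to `J`. The minimality condition says that
`K` consists of elements of `VecL2 T`, and the blocks of the operator `F` are the Gram matrix of the
`K k p`, `k ≥ 0`.

The heart of the matter is that the past of `J` and the future of `K` are orthogonal complements of
each other. They are orthogonal by biorthogonality. If `z` is orthogonal to both, then `‖z‖²` is a sum
of products `h_p k_p` of functions of the Hardy space `H¹`, with the `h_p` of mean zero; so `z = 0` as
soon as such a sum has mean zero whenever it is integrable (`GM.integral_sum_mul_eq_zero`,
`GM.eq_zero_of_inner_past_future`). For factors in `H²` this is Parseval's identity. The general case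
is reduced to it by multiplication with outer functions close to one, which are obtained without the
theory of outer functions, from Szegő's extremal problem (`GM.exists_szego`).

Hence `F c = b`, in the extended sense, means that some `y` in the future of `K` has coordinates
`c k p = ⟪J k p, y⟫` and inner products `b j p = ⟪K j p, y⟫` (`GM.FRel_iff`). For `b = D a` this `y`
is the orthogonal projection of the image of `B χ_μ / β` on the future of `K`
(`GM.Setting.resid`), so `B χ_μ / β` minus the function that corresponds to `y` is the projection on
the past; written out, it is `h` (`GM.Setting.toH_hChar`). The function with Fourier series
`∑ c(k) e^{iλk}` is `Mᴴ y`, where `M` is the matrix function that defines `J`.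

On the side of probability, the structural function gives an isometry of `VecL2 T` into `L²(P)` which
takes the images of the generators to the increments (`GM.exists_spectral_isometry`). The images of
the indicators of `[-π, x)` are the process `Z` (`GM.Setting.exists_spectralRep`), and every other
process with the representation has the same stochastic integrals
(`GM.Setting.isSpectralIntegral_iff_of_spectralRep`). Summation by parts writes a functional with
finitely many coefficients as a sum of increments minus initial values. In a mean square limit the
initial values converge as well, because they depend linearly on finitely many coefficients
(`GM.tendsto_eLpNorm_of_finiteDimensional`), so the functional plus its initial values is the image of
`B χ_μ / β` (`GM.Setting.isFunctional_add_initial`). The estimates are then the elements of the past,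
and optimality is Pythagoras' theorem (`GM.Setting.isOptimalEstimate_iff`).

For a canonical factorization `Φ`, the number of innovations is `T`
(`GM.CanonicalFactorization.card_eq`), and multiplication by the unitary matrix function `GM.innMat`
takes the exponentials to the images of the innovations, so it preserves past and future. It takes
`Φᵀ B` to the image of `B χ_μ / β`. So the residual is the image of the analytic part of `Φᵀ B`
(`GM.anaPart`), whose Fourier coefficients are those of `D A φ`
(`GM.CanonicalFactorization.toH_hSimple`).
-/

namespace GM

noncomputable section

/-! ### Fourier series on the circle -/

lemma continuous_ex : Continuous ex := by unfold ex; fun_prop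

lemma ex_add (x y : ℝ) : ex (x + y) = ex x * ex y := by
  simp only [ex, Complex.ofReal_add, mul_add, Complex.exp_add]

@[simp] lemma ex_zero : ex 0 = 1 := by simp [ex]

lemma conj_ex (x : ℝ) : conj (ex x) = ex (-x) := by
  simp [ex, ← Complex.exp_conj]

@[simp] lemma norm_ex (x : ℝ) : ‖ex x‖ = 1 := by
  rw [ex, mul_comm, Complex.norm_exp_ofReal_mul_I]

lemma circ_eq : circ = (ENNReal.ofReal (2 * Real.pi))⁻¹ •
    volume.restrict (Set.Ico (-Real.pi) Real.pi) := rfl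

instance isProbabilityMeasure_circ : IsProbabilityMeasure circ := by
  constructor
  rw [circ_eq, Measure.smul_apply, Measure.restrict_apply MeasurableSet.univ, Set.univ_inter,
    Real.volume_Ico, smul_eq_mul, show Real.pi - -Real.pi = 2 * Real.pi by ring]
  exact ENNReal.inv_mul_cancel (by simp [Real.pi_pos]) ENNReal.ofReal_ne_top

/-- A property holds `circ`-almost everywhere if it fails only on a countable set. -/
lemma ae_circ_of_countable {p : ℝ → Prop}
    (h : Set.Countable {t | t ∈ Set.Ico (-Real.pi) Real.pi ∧ ¬ p t}) : ∀ᵐ t ∂circ, p t := by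
  rw [circ_eq]
  refine Measure.ae_smul_measure ?_ _
  rw [ae_restrict_iff' measurableSet_Ico]
  have := h.measure_zero volume
  refine measure_mono_null ?_ this
  intro t ht
  simpa [and_assoc] using ht

lemma integral_circ_eq {E : Type*} [NormedAddCommGroup E] [NormedSpace ℝ E] (F : ℝ → E) :
    ∫ t, F t ∂circ = (2 * Real.pi)⁻¹ • ∫ t in (-Real.pi)..Real.pi, F t := by
  rw [circ_eq, integral_smul_measure, intervalIntegral.integral_of_le (by linarith [Real.pi_pos]),
    integral_Ico_eq_integral_Ioo, integral_Ioc_eq_integral_Ioo, ENNReal.toReal_inv,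
    ENNReal.toReal_ofReal (by positivity)]

lemma integral_ex (k : ℤ) : ∫ t, ex (t * k) ∂circ = if k = 0 then 1 else 0 := by
  split_ifs with hk
  · simp [hk]
  rw [integral_circ_eq]
  have hc : (Complex.I * k : ℂ) ≠ 0 := mul_ne_zero Complex.I_ne_zero (by exact_mod_cast hk)
  have h1 : ∀ t : ℝ, ex (t * k) = Complex.exp ((Complex.I * k) * t) := by
    intro t
    simp only [ex]
    congr 1
    push_cast
    ring
  simp_rw [h1]
  rw [integral_exp_mul_complex hc]
  have h2 : Complex.exp (Complex.I * k * (Real.pi : ℝ)) =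
      Complex.exp (Complex.I * k * ((-Real.pi : ℝ) : ℂ)) := by
    rw [Complex.exp_eq_exp_iff_exists_int]
    refine ⟨k, ?_⟩
    push_cast
    ring
  rw [h2]
  simp

/-- An integrable function on the circle is determined by its Fourier coefficients. -/
lemma ae_eq_zero_of_fourier {F : ℝ → ℂ} (hF : Integrable F circ)
    (h : ∀ k : ℤ, ∫ t, ex (t * k) * F t ∂circ = 0) : F =ᵐ[circ] 0 := by
  have : Fact (0 < 2 * Real.pi) := ⟨by positivity⟩
  -- the functional `g ↦ ∫ g F` on continuous functions on the circle vanishes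
  have hex : ∀ (k : ℤ) (t : ℝ), fourier k (t : AddCircle (2 * Real.pi)) = ex (t * k) := by
    intro k t
    rw [fourier_coe_apply, ex]
    congr 1
    have : (Real.pi : ℂ) ≠ 0 := by exact_mod_cast Real.pi_ne_zero
    push_cast
    field_simp
  have hbd : ∀ g : C(AddCircle (2 * Real.pi), ℂ),
      Integrable (fun t : ℝ => g (t : AddCircle (2 * Real.pi)) * F t) circ := by
    intro g
    refine hF.bdd_mul (c := ‖g‖) ?_ ?_
    · exact (g.continuous.comp (AddCircle.continuous_mk' _)).aestronglyMeasurable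
    · exact Eventually.of_forall fun t => g.norm_coe_le_norm _
  let Λ : C(AddCircle (2 * Real.pi), ℂ) →ₗ[ℂ] ℂ :=
    { toFun := fun g => ∫ t : ℝ, g (t : AddCircle (2 * Real.pi)) * F t ∂circ
      map_add' := fun g g' => by
        simp only [ContinuousMap.add_apply, add_mul]
        exact integral_add (hbd g) (hbd g')
      map_smul' := fun c g => by
        simp only [ContinuousMap.smul_apply, smul_eq_mul, mul_assoc, RingHom.id_apply]
        exact integral_const_mul c _ }
  let Λ' : C(AddCircle (2 * Real.pi), ℂ) →L[ℂ] ℂ := Λ.mkContinuous (∫ t, ‖F t‖ ∂circ) (by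
    intro g
    refine (norm_integral_le_integral_norm _).trans ?_
    rw [← integral_mul_const]
    refine integral_mono (hbd g).norm (hF.norm.mul_const _) fun t => ?_
    simp only [norm_mul, mul_comm ‖F t‖]
    exact mul_le_mul_of_nonneg_right (g.norm_coe_le_norm _) (norm_nonneg _))
  have hΛ : ∀ g, Λ' g = 0 := by
    intro g
    have hg : g ∈ (Submodule.span ℂ (Set.range <| @fourier (2 * Real.pi))).topologicalClosure := by
      rw [span_fourier_closure_eq_top]; trivial
    have hle : (Submodule.span ℂ (Set.range <| @fourier (2 * Real.pi))).topologicalClosure ≤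
        LinearMap.ker (Λ' : C(AddCircle (2 * Real.pi), ℂ) →ₗ[ℂ] ℂ) := by
      refine Submodule.topologicalClosure_minimal _ ?_ Λ'.isClosed_ker
      rw [Submodule.span_le]
      rintro _ ⟨k, rfl⟩
      change ∫ t : ℝ, fourier k (t : AddCircle (2 * Real.pi)) * F t ∂circ = 0
      simp_rw [hex]
      exact h k
    exact hle hg
  have hF' : IntegrableOn F (Set.Ico (-Real.pi) Real.pi) volume := by
    rw [circ_eq, integrable_smul_measure (ENNReal.inv_ne_zero.2 ENNReal.ofReal_ne_top)
      (by simp [Real.pi_pos])] at hF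
    exact hF
  have key : ∀ᵐ t ∂(volume : Measure ℝ), t ∈ Set.Ioo (-Real.pi) Real.pi → F t = 0 := by
    refine isOpen_Ioo.ae_eq_zero_of_integral_contDiff_smul_eq_zero
      (hF'.mono_set Set.Ioo_subset_Ico_self).locallyIntegrableOn ?_
    intro g hg _ hsupp
    have hz : ∀ t, t ∉ Set.Ioo (-Real.pi) Real.pi → g t = 0 := fun t ht =>
      image_eq_zero_of_notMem_tsupport fun h' => ht (hsupp h')
    let g' : C(AddCircle (2 * Real.pi), ℂ) :=
      ⟨AddCircle.liftIco (2 * Real.pi) (-Real.pi) (fun t => (g t : ℂ)), by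
        refine AddCircle.liftIco_continuous ?_ ?_
        · rw [hz _ (by simp), hz _ (by rw [show -Real.pi + 2 * Real.pi = Real.pi by ring]; simp)]
        · exact (Complex.continuous_ofReal.comp hg.continuous).continuousOn⟩
    have h1 : ∫ t : ℝ, g' (t : AddCircle (2 * Real.pi)) * F t ∂circ = 0 := hΛ g'
    have h2 : ∀ t ∈ Set.Ico (-Real.pi) Real.pi,
        g' (t : AddCircle (2 * Real.pi)) * F t = g t • F t := by
      intro t ht
      change AddCircle.liftIco (2 * Real.pi) (-Real.pi) (fun t => (g t : ℂ)) t * F t = _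
      rw [AddCircle.liftIco_coe_apply (by
        rw [show -Real.pi + 2 * Real.pi = Real.pi by ring]; exact ht)]
      simp
    rw [circ_eq, integral_smul_measure, setIntegral_congr_fun measurableSet_Ico h2, smul_eq_zero] at h1
    have h3 : ∫ t in Set.Ico (-Real.pi) Real.pi, g t • F t = 0 := by
      rcases h1 with h1 | h1
      · exfalso
        rw [ENNReal.toReal_inv, ENNReal.toReal_ofReal (by positivity)] at h1
        have := Real.pi_pos
        simp at h1
      · exact h1
    rw [← h3]
    symm
    refine setIntegral_eq_integral_of_forall_compl_eq_zero fun t ht => ?_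
    rw [hz t fun h' => ht (Set.Ioo_subset_Ico_self h'), zero_smul]
  rw [circ_eq]
  refine Measure.ae_smul_measure ?_ _
  rw [← restrict_Ioo_eq_restrict_Ico]
  exact (ae_restrict_iff' measurableSet_Ioo).2 key

/-! ### Products of analytic functions on the circle -/

lemma inner_toLp {α E : Type*} [MeasurableSpace α] {μ : Measure α} [NormedAddCommGroup E]
    [InnerProductSpace ℂ E] {f g : α → E} (hf : MemLp f 2 μ) (hg : MemLp g 2 μ) :
    inner ℂ (hf.toLp f) (hg.toLp g) = ∫ t, inner ℂ (f t) (g t) ∂μ := by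
  rw [L2.inner_def]
  refine integral_congr_ae ?_
  filter_upwards [hf.coeFn_toLp, hg.coeFn_toLp] with t h1 h2
  rw [h1, h2]

lemma norm_toLp_sq {α E : Type*} [MeasurableSpace α] {μ : Measure α} [NormedAddCommGroup E]
    [InnerProductSpace ℂ E] {f : α → E} (hf : MemLp f 2 μ) :
    ‖hf.toLp f‖ ^ 2 = ∫ t, ‖f t‖ ^ 2 ∂μ := by
  have h := inner_toLp hf hf
  rw [inner_self_eq_norm_sq_to_K] at h
  have h2 : ∀ t, inner ℂ (f t) (f t) = ((‖f t‖ ^ 2 : ℝ) : ℂ) := fun t => by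
    rw [inner_self_eq_norm_sq_to_K]; push_cast; rfl
  simp_rw [h2] at h
  rw [integral_complex_ofReal] at h
  refine Complex.ofReal_injective ?_
  rw [← h]
  push_cast
  rfl

lemma memLp_ex (x : ℝ) (p : ℝ≥0∞) : MemLp (fun t => ex (t * x)) p circ :=
  MemLp.of_bound (continuous_ex.comp (by fun_prop)).aestronglyMeasurable 1
    (Eventually.of_forall fun t => by simp)

lemma memLp_ex_mul {E : Type*} [NormedAddCommGroup E] [NormedSpace ℂ E] {p : ℝ≥0∞} {F : ℝ → E}
    (hF : MemLp F p circ) (x : ℝ) : MemLp (fun t => ex (t * x) • F t) p circ := by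
  refine MemLp.of_le hF ?_ (Eventually.of_forall fun t => by simp [norm_smul])
  exact (continuous_ex.comp (by fun_prop)).aestronglyMeasurable.smul hF.1

lemma integrable_ex_mul {E : Type*} [NormedAddCommGroup E] [NormedSpace ℂ E] {F : ℝ → E}
    (hF : Integrable F circ) (x : ℝ) : Integrable (fun t => ex (t * x) • F t) circ :=
  memLp_one_iff_integrable.1 (memLp_ex_mul (memLp_one_iff_integrable.2 hF) x)

lemma integrable_ex_mul' {F : ℝ → ℂ} (hF : Integrable F circ) (x : ℝ) :
    Integrable (fun t => ex (t * x) * F t) circ := integrable_ex_mul hF x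

lemma integrable_mul_of_memLp {α : Type*} [MeasurableSpace α] {μ : Measure α} {F G : α → ℂ}
    (hF : MemLp F 2 μ) (hG : MemLp G 2 μ) : Integrable (fun t => F t * G t) μ :=
  hF.integrable_mul hG

lemma MemLp.conj_fun {α : Type*} [MeasurableSpace α] {μ : Measure α} {p : ℝ≥0∞} {F : α → ℂ}
    (hF : MemLp F p μ) : MemLp (fun t => conj (F t)) p μ :=
  MemLp.of_le hF (Complex.continuous_conj.comp_aestronglyMeasurable hF.1)
    (Eventually.of_forall fun t => by simp)

/-- The exponentials form a Hilbert basis of `L²` of the circle. -/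
lemma exists_hilbertBasis_ex : ∃ b : HilbertBasis ℤ ℂ (Lp ℂ 2 circ),
    ∀ k : ℤ, b k = (memLp_ex k 2).toLp _ := by
  have ho : Orthonormal ℂ fun k : ℤ => (memLp_ex k 2).toLp (fun t => ex (t * (k : ℝ))) := by
    rw [orthonormal_iff_ite]
    intro j k
    rw [inner_toLp]
    have : ∀ t : ℝ, inner ℂ (ex (t * j)) (ex (t * k)) = ex (t * ((k - j : ℤ) : ℝ)) := by
      intro t
      rw [RCLike.inner_apply, conj_ex, ← ex_add]
      congr 1
      push_cast
      ring
    simp_rw [this]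
    rw [integral_ex]
    simp only [sub_eq_zero, eq_comm]
  refine ⟨HilbertBasis.mkOfOrthogonalEqBot ho ?_, fun k => by
    rw [HilbertBasis.coe_mkOfOrthogonalEqBot]⟩
  rw [Submodule.eq_bot_iff]
  intro y hy
  rw [Lp.eq_zero_iff_ae_eq_zero]
  refine ae_eq_zero_of_fourier ((Lp.memLp y).integrable (by norm_num)) fun k => ?_
  have h := (Submodule.mem_orthogonal _ _).1 hy _ (Submodule.subset_span ⟨-k, rfl⟩)
  rw [L2.inner_def] at h
  rw [← h]
  refine integral_congr_ae ?_
  filter_upwards [(memLp_ex ((-k : ℤ) : ℝ) 2).coeFn_toLp] with t ht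
  rw [ht, RCLike.inner_apply, conj_ex, mul_comm]
  simp

/-- The product of a function of `H²` with one of `H²` and mean zero has mean zero. -/
lemma integral_mul_eq_zero_of_memLp {F G : ℝ → ℂ} (hF : MemLp F 2 circ) (hG : MemLp G 2 circ)
    (hF0 : ∀ k : ℤ, 0 ≤ k → ∫ t, ex (t * k) * F t ∂circ = 0)
    (hG0 : ∀ k : ℤ, 0 < k → ∫ t, ex (t * k) * G t ∂circ = 0) :
    ∫ t, F t * G t ∂circ = 0 := by
  obtain ⟨b, hb⟩ := exists_hilbertBasis_ex
  have h := b.hasSum_inner_mul_inner ((MemLp.conj_fun hF).toLp _) (hG.toLp _)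
  have h0 : ∀ k, inner ℂ ((MemLp.conj_fun hF).toLp _) (b k) * inner ℂ (b k) (hG.toLp _) = 0 := by
    intro k
    rw [hb, inner_toLp, inner_toLp]
    simp only [RCLike.inner_apply, conj_ex, Complex.conj_conj]
    rcases le_or_gt 0 k with hk | hk
    · rw [hF0 k hk, zero_mul]
    · have := hG0 (-k) (by omega)
      rw [← mul_zero, ← this]
      congr 1
      refine integral_congr_ae (Eventually.of_forall fun t => ?_)
      simp only
      rw [mul_comm]
      simp
  simp_rw [h0] at h
  have h1 := h.unique hasSum_zero
  rw [inner_toLp] at h1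
  rw [← h1]
  refine integral_congr_ae (Eventually.of_forall fun t => ?_)
  simp [RCLike.inner_apply, mul_comm]

/-! ### Szegő's extremal problem and a theorem of Smirnov -/

lemma memLp_ex_mul_sqrt {ψ : ℝ → ℝ} (hψ : Integrable ψ circ) (h1 : ∀ t, 1 ≤ ψ t) (x : ℝ) :
    MemLp (fun t => ex (t * x) * (√(ψ t) : ℂ)) 2 circ := by
  have h : MemLp (fun t => (√(ψ t) : ℂ)) 2 circ := by
    rw [memLp_two_iff_integrable_sq_norm]
    · refine hψ.congr (Eventually.of_forall fun t => ?_)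
      simp only [Complex.norm_real, Real.norm_eq_abs, sq_abs]
      rw [Real.sq_sqrt (by linarith [h1 t])]
    · exact Complex.continuous_ofReal.comp_aestronglyMeasurable
        (Real.continuous_sqrt.comp_aestronglyMeasurable hψ.1)
  exact memLp_ex_mul h x

/-- The element `√ψ e_k` of `L²` of the circle. -/
def sqrtEx {ψ : ℝ → ℝ} (hψ : Integrable ψ circ) (h1 : ∀ t, 1 ≤ ψ t) (k : ℤ) : Lp ℂ 2 circ :=
  (memLp_ex_mul_sqrt hψ h1 k).toLp _

/-- The closed span of `√ψ e_k`, `k ≥ n`. -/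
def sqrtExSpan {ψ : ℝ → ℝ} (hψ : Integrable ψ circ) (h1 : ∀ t, 1 ≤ ψ t) (n : ℤ) :
    Submodule ℂ (Lp ℂ 2 circ) :=
  (Submodule.span ℂ (sqrtEx hψ h1 '' Set.Ici n)).topologicalClosure

/-- A continuous functional `x ↦ ∫ g x` that vanishes on the generators vanishes on their
closed span. -/
lemma integral_mul_eq_zero_of_mem_sqrtExSpan {ψ : ℝ → ℝ} {hψ : Integrable ψ circ}
    {h1 : ∀ t, 1 ≤ ψ t} {n : ℤ} {g : ℝ → ℂ} (hg : MemLp g 2 circ)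
    (h : ∀ k ≥ n, ∫ t, g t * (ex (t * k) * (√(ψ t) : ℂ)) ∂circ = 0) {x : Lp ℂ 2 circ}
    (hx : x ∈ sqrtExSpan hψ h1 n) : ∫ t, g t * x t ∂circ = 0 := by
  have hle : sqrtExSpan hψ h1 n ≤
      LinearMap.ker (innerSL ℂ ((MemLp.conj_fun hg).toLp _) : Lp ℂ 2 circ →ₗ[ℂ] ℂ) := by
    refine Submodule.topologicalClosure_minimal _ ?_ (ContinuousLinearMap.isClosed_ker _)
    rw [Submodule.span_le]
    rintro _ ⟨k, hk, rfl⟩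
    change inner ℂ ((MemLp.conj_fun hg).toLp _) (sqrtEx hψ h1 k) = 0
    rw [sqrtEx, inner_toLp, ← h k hk]
    refine integral_congr_ae (Eventually.of_forall fun t => ?_)
    simp [RCLike.inner_apply, mul_comm]
  have h2 : inner ℂ ((MemLp.conj_fun hg).toLp _) x = 0 := hle hx
  rw [L2.inner_def] at h2
  rw [← h2]
  refine integral_congr_ae ?_
  filter_upwards [(MemLp.conj_fun hg).coeFn_toLp] with t ht
  rw [ht]
  simp [RCLike.inner_apply, mul_comm]

/-- Szegő's extremal problem for the weight `ψ`. The residual `y` of the projection of `√ψ` on the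
span of `√ψ e_k`, `k ≥ 1`, has constant modulus, because `|y|²` is orthogonal to every nonconstant
exponential; so `y / √ψ` is a function of `H²` of modulus `const / √ψ` and of mean one. -/
lemma exists_szego {ψ : ℝ → ℝ} (hψ : Integrable ψ circ) (h1 : ∀ t, 1 ≤ ψ t) :
    ∃ (y : Lp ℂ 2 circ) (σ : ℝ), y ∈ sqrtExSpan hψ h1 0 ∧ (∀ᵐ t ∂circ, ‖y t‖ ^ 2 = σ) ∧
      σ ≤ ∫ t, ψ t ∂circ ∧ ∫ t, y t / (√(ψ t) : ℂ) ∂circ = 1 := by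
  set V := sqrtExSpan hψ h1 1 with hV
  have : CompleteSpace V := by rw [hV, sqrtExSpan]; infer_instance
  have hpos : ∀ t, 0 < √(ψ t) := fun t => Real.sqrt_pos.2 (by linarith [h1 t])
  have hne : ∀ t, (√(ψ t) : ℂ) ≠ 0 := fun t => by exact_mod_cast (hpos t).ne'
  set x0 := sqrtEx hψ h1 0 with hx0
  set y := x0 - V.starProjection x0 with hy
  have hPV : V.starProjection x0 ∈ V := Submodule.starProjection_apply_mem V x0
  have horth : ∀ v ∈ V, inner ℂ v y = 0 := fun v hv =>
    (Submodule.mem_orthogonal _ _).1 (Submodule.sub_starProjection_mem_orthogonal x0) v hv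
  have hmem : y ∈ sqrtExSpan hψ h1 0 := by
    refine Submodule.sub_mem _ ?_ ?_
    · exact Submodule.le_topologicalClosure _ (Submodule.subset_span ⟨0, by simp, rfl⟩)
    · exact Submodule.topologicalClosure_mono
        (Submodule.span_mono (Set.image_mono (Set.Ici_subset_Ici.2 zero_le_one))) hPV
  have hyL := Lp.memLp y
  have hint : Integrable (fun t => conj (y t) * y t) circ := (MemLp.conj_fun hyL).integrable_mul hyL
  -- `e_k y` lies in the span for `k > 0`, so it is orthogonal to `y`
  have hk : ∀ k : ℤ, 0 < k → ∫ t, ex (t * k) * (conj (y t) * y t) ∂circ = 0 := by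
    intro k hk
    have := integral_mul_eq_zero_of_mem_sqrtExSpan (memLp_ex_mul (MemLp.conj_fun hyL) k)
      (fun j hj => ?_) hmem
    · simpa only [smul_eq_mul, mul_assoc] using this
    · have hv := horth (sqrtEx hψ h1 (k + j)) (Submodule.le_topologicalClosure _
        (Submodule.subset_span ⟨k + j, by simp; omega, rfl⟩))
      rw [← inner_conj_symm, map_eq_zero, L2.inner_def] at hv
      rw [← hv]
      refine integral_congr_ae ?_
      filter_upwards [(memLp_ex_mul_sqrt hψ h1 ((k + j : ℤ) : ℝ)).coeFn_toLp] with t ht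
      rw [sqrtEx, ht, RCLike.inner_apply]
      simp only [smul_eq_mul]
      push_cast
      rw [mul_add, ex_add]
      ring
  -- all Fourier coefficients of `|y|²` but the one at `0` vanish, those at `k < 0` by conjugation
  have hconst : (fun t => conj (y t) * y t - ((‖y‖ ^ 2 : ℝ) : ℂ)) =ᵐ[circ] 0 := by
    refine ae_eq_zero_of_fourier (hint.sub (integrable_const _)) fun k => ?_
    have hs : ∫ t, ex (t * k) * (conj (y t) * y t - ((‖y‖ ^ 2 : ℝ) : ℂ)) ∂circ =
        ∫ t, ex (t * k) * (conj (y t) * y t) ∂circ -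
          (∫ t, ex (t * k) ∂circ) * ((‖y‖ ^ 2 : ℝ) : ℂ) := by
      simp_rw [mul_sub]
      rw [integral_sub (integrable_ex_mul' hint k)
        (((memLp_ex k 1).integrable le_rfl).mul_const _), integral_mul_const]
    rw [hs, integral_ex]
    rcases lt_trichotomy k 0 with h | h | h
    · rw [if_neg h.ne, zero_mul, sub_zero]
      have := congrArg conj (hk (-k) (by omega))
      rw [map_zero, ← integral_conj] at this
      rw [← this]
      refine integral_congr_ae (Eventually.of_forall fun t => ?_)
      simp [conj_ex, mul_comm]
    · have hn : inner ℂ y y = ((‖y‖ ^ 2 : ℝ) : ℂ) := by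
        rw [inner_self_eq_norm_sq_to_K]; push_cast; rfl
      rw [if_pos h, one_mul, ← hn, L2.inner_def, sub_eq_zero]
      refine integral_congr_ae (Eventually.of_forall fun t => ?_)
      simp only [h, Int.cast_zero, mul_zero, ex_zero, one_mul, RCLike.inner_apply]
      ring
    · rw [if_neg h.ne', zero_mul, sub_zero, hk k h]
  refine ⟨y, ‖y‖ ^ 2, hmem, ?_, ?_, ?_⟩
  · filter_upwards [hconst] with t ht
    have h2 : ((‖y t‖ ^ 2 : ℝ) : ℂ) = ((‖y‖ ^ 2 : ℝ) : ℂ) := by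
      have : conj (y t) * y t = ((‖y‖ ^ 2 : ℝ) : ℂ) := sub_eq_zero.1 ht
      rw [← this, mul_comm, Complex.mul_conj, Complex.normSq_eq_norm_sq]
    exact_mod_cast h2
  · have hle : ‖y‖ ≤ ‖x0‖ := by
      have h2 : inner ℂ y y = inner ℂ x0 y := by
        conv_lhs => rw [hy, inner_sub_left, ← hy]
        rw [horth _ hPV, sub_zero]
      have h3 : ‖y‖ * ‖y‖ ≤ ‖x0‖ * ‖y‖ := by
        have h4 : ‖inner ℂ y y‖ = ‖y‖ * ‖y‖ := by
          rw [inner_self_eq_norm_sq_to_K]; simp [sq]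
        rw [← h4, h2]
        exact norm_inner_le_norm _ _
      rcases (norm_nonneg y).eq_or_lt with h | h
      · rw [← h]; exact norm_nonneg _
      · exact le_of_mul_le_mul_right h3 h
    have hx : ‖x0‖ ^ 2 = ∫ t, ψ t ∂circ := by
      rw [hx0, sqrtEx, norm_toLp_sq]
      refine integral_congr_ae (Eventually.of_forall fun t => ?_)
      simp only [norm_mul, norm_ex, one_mul, Complex.norm_real, Real.norm_eq_abs, sq_abs]
      rw [Real.sq_sqrt (by linarith [h1 t])]
    rw [← hx]
    gcongr
  · have hg : MemLp (fun t => (√(ψ t) : ℂ)⁻¹) 2 circ := by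
      refine MemLp.of_bound ?_ 1 (Eventually.of_forall fun t => ?_)
      · exact (Complex.measurable_ofReal.comp_aemeasurable
          (Real.continuous_sqrt.measurable.comp_aemeasurable hψ.1.aemeasurable)).inv.aestronglyMeasurable
      · rw [norm_inv, Complex.norm_real, Real.norm_of_nonneg (Real.sqrt_nonneg _)]
        exact inv_le_one_of_one_le₀ (Real.one_le_sqrt.2 (h1 t))
    have hP := integral_mul_eq_zero_of_mem_sqrtExSpan hg (fun j hj => by
      have : ∀ t, (√(ψ t) : ℂ)⁻¹ * (ex (t * j) * (√(ψ t) : ℂ)) = ex (t * j) := fun t => by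
        field_simp [hne t]
      simp_rw [this]
      rw [integral_ex, if_neg (by omega)]) hPV
    have hsub : (fun t => y t / (√(ψ t) : ℂ)) =ᵐ[circ] fun t =>
        1 - (√(ψ t) : ℂ)⁻¹ * V.starProjection x0 t := by
      filter_upwards [Lp.coeFn_sub x0 (V.starProjection x0),
        (memLp_ex_mul_sqrt hψ h1 ((0 : ℤ) : ℝ)).coeFn_toLp] with t ht1 ht2
      rw [hy, ht1, Pi.sub_apply, hx0, sqrtEx, ht2]
      simp only [Int.cast_zero, mul_zero, ex_zero, one_mul]
      field_simp [hne t]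
    rw [integral_congr_ae hsub, integral_sub (integrable_const _)
      (integrable_mul_of_memLp hg (Lp.memLp _)), hP]
    simp

/-- Multiplication by `y / √ψ` keeps the vanishing of Fourier coefficients, and takes functions
dominated by `ψ` to `L²`. -/
lemma szego_mul {ψ : ℝ → ℝ} {hψ : Integrable ψ circ} {h1 : ∀ t, 1 ≤ ψ t} {y : Lp ℂ 2 circ} {σ : ℝ}
    (hy : y ∈ sqrtExSpan hψ h1 0) (hσ : ∀ᵐ t ∂circ, ‖y t‖ ^ 2 = σ) {g : ℝ → ℂ}
    (hg : Integrable g circ) {K : ℝ} (hK : ∀ t, ‖g t‖ ≤ K * ψ t) :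
    MemLp (fun t => y t / (√(ψ t) : ℂ) * g t) 2 circ ∧
      ∀ n : ℤ, (∀ m ≥ n, ∫ t, ex (t * m) * g t ∂circ = 0) →
        ∫ t, ex (t * n) * (y t / (√(ψ t) : ℂ) * g t) ∂circ = 0 := by
  have hpos : ∀ t, 0 < √(ψ t) := fun t => Real.sqrt_pos.2 (by linarith [h1 t])
  have hne : ∀ t, (√(ψ t) : ℂ) ≠ 0 := fun t => by exact_mod_cast (hpos t).ne'
  have hmeas : AEStronglyMeasurable (fun t => (√(ψ t) : ℂ)⁻¹) circ :=
    (Complex.measurable_ofReal.comp_aemeasurable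
      (Real.continuous_sqrt.measurable.comp_aemeasurable
        hψ.1.aemeasurable)).inv.aestronglyMeasurable
  have hg' : MemLp (fun t => (√(ψ t) : ℂ)⁻¹ * g t) 2 circ := by
    refine (memLp_two_iff_integrable_sq_norm (hmeas.mul hg.1)).2 ?_
    refine (hg.norm.const_mul K).mono' ((hmeas.mul hg.1).norm.pow 2)
      (Eventually.of_forall fun t => ?_)
    rw [Real.norm_of_nonneg (by positivity), Pi.mul_apply, norm_mul, norm_inv, Complex.norm_real,
      Real.norm_of_nonneg (Real.sqrt_nonneg _), mul_pow, inv_pow, Real.sq_sqrt (by linarith [h1 t]),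
      inv_mul_le_iff₀ (by linarith [h1 t])]
    nlinarith [hK t, norm_nonneg (g t)]
  constructor
  · refine MemLp.of_le_mul (c := √σ) hg' ?_ ?_
    · have := (Lp.memLp y).1.mul (hmeas.mul hg.1)
      refine this.congr (Eventually.of_forall fun t => ?_)
      simp only [Pi.mul_apply, div_eq_mul_inv, mul_assoc]
    · filter_upwards [hσ] with t ht
      rw [← ht, Real.sqrt_sq (norm_nonneg _), ← norm_mul, div_eq_mul_inv, mul_assoc]
  · intro n hn
    have := integral_mul_eq_zero_of_mem_sqrtExSpan (memLp_ex_mul hg' n) (fun j hj => ?_) hy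
    · rw [← this]
      refine integral_congr_ae (Eventually.of_forall fun t => ?_)
      simp only [smul_eq_mul]
      ring
    · rw [← hn (n + j) (by omega)]
      refine integral_congr_ae (Eventually.of_forall fun t => ?_)
      simp only [smul_eq_mul]
      push_cast
      rw [mul_add, ex_add]
      field_simp [hne t]

/-- A form of Smirnov's theorem: if `h i` and `k i` are in `H¹`, the `h i` of mean zero, and the sum of
the products `h i * k i` (not necessarily each of them) is integrable, then it has mean zero. The
functions are multiplied by bounded analytic functions `D n`, which tend to one, with `D n * h i` and
`D n * k i` in `L²`. -/
theorem integral_sum_mul_eq_zero {ι : Type*} [Fintype ι] {h k : ι → ℝ → ℂ}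
    (hh : ∀ i, Integrable (h i) circ) (hk : ∀ i, Integrable (k i) circ)
    (hh0 : ∀ i, ∀ n : ℤ, 0 ≤ n → ∫ t, ex (t * n) * h i t ∂circ = 0)
    (hk0 : ∀ i, ∀ n : ℤ, 0 < n → ∫ t, ex (t * n) * k i t ∂circ = 0)
    (hint : Integrable (fun t => ∑ i, h i t * k i t) circ) :
    ∫ t, ∑ i, h i t * k i t ∂circ = 0 := by
  set φ : ℝ → ℝ := fun t => ∑ i, (‖h i t‖ + ‖k i t‖) with hφ
  have hφi : Integrable φ circ := integrable_finsetSum _ fun i _ => (hh i).norm.add (hk i).norm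
  have hφ0 : ∀ t, 0 ≤ φ t := fun t => Finset.sum_nonneg fun i _ => by positivity
  -- the weights dominate the functions, up to a constant, and tend to one
  set ψ : ℕ → ℝ → ℝ := fun n t => 1 + φ t / ((n : ℝ) + 1) with hψ
  have hψi : ∀ n, Integrable (ψ n) circ := fun n => (integrable_const _).add (hφi.div_const _)
  have hψ1 : ∀ n t, 1 ≤ ψ n t := fun n t => by
    simp only [hψ]
    have := hφ0 t
    have : 0 ≤ φ t / ((n : ℝ) + 1) := by positivity
    linarith
  have hφψ : ∀ (n : ℕ) t, φ t ≤ ((n : ℝ) + 1) * ψ n t := fun n t => by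
    simp only [hψ]
    have : ((n : ℝ) + 1) * (1 + φ t / ((n : ℝ) + 1)) = (n : ℝ) + 1 + φ t := by field_simp
    rw [this]
    have : (0 : ℝ) ≤ n := Nat.cast_nonneg n
    linarith
  have hhφ : ∀ i t, ‖h i t‖ ≤ φ t := fun i t =>
    (le_add_of_nonneg_right (norm_nonneg (k i t))).trans
      (Finset.single_le_sum (f := fun i => ‖h i t‖ + ‖k i t‖) (fun i _ => by positivity)
        (Finset.mem_univ i))
  have hkφ : ∀ i t, ‖k i t‖ ≤ φ t := fun i t =>
    (le_add_of_nonneg_left (norm_nonneg (h i t))).trans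
      (Finset.single_le_sum (f := fun i => ‖h i t‖ + ‖k i t‖) (fun i _ => by positivity)
        (Finset.mem_univ i))
  choose y σ hy hσ hσle hy1 using fun n => exists_szego (hψi n) (hψ1 n)
  set D : ℕ → ℝ → ℂ := fun n t => y n t / (√(ψ n t) : ℂ) with hD
  -- the case of `H²`, for each product `(D n * h i) * (D n * k i)`
  have hzero : ∀ n, ∫ t, D n t ^ 2 * ∑ i, h i t * k i t ∂circ = 0 := by
    intro n
    have hA := fun i => szego_mul (hy n) (hσ n) (hh i) fun t => (hhφ i t).trans (hφψ n t)
    have hB := fun i => szego_mul (hy n) (hσ n) (hk i) fun t => (hkφ i t).trans (hφψ n t)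
    have : ∀ t, D n t ^ 2 * ∑ i, h i t * k i t = ∑ i, (D n t * h i t) * (D n t * k i t) := by
      intro t
      rw [Finset.mul_sum]
      exact Finset.sum_congr rfl fun i _ => by ring
    simp_rw [this]
    have hAB : ∀ i, Integrable (fun t => D n t * h i t * (D n t * k i t)) circ := fun i =>
      (hA i).1.integrable_mul (hB i).1
    rw [integral_finsetSum _ fun i _ => hAB i]
    refine Finset.sum_eq_zero fun i _ => ?_
    refine integral_mul_eq_zero_of_memLp (hA i).1 (hB i).1 (fun m hm => ?_) fun m hm => ?_
    · exact (hA i).2 m fun l hl => hh0 i l (by omega)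
    · exact (hB i).2 m fun l hl => hk0 i l (by omega)
  have hDmeas : ∀ n, AEStronglyMeasurable (D n) circ := fun n =>
    (((Lp.memLp (y n)).1.aemeasurable).div (Complex.measurable_ofReal.comp_aemeasurable
      (Real.continuous_sqrt.measurable.comp_aemeasurable
        (hψi n).1.aemeasurable))).aestronglyMeasurable
  have hDb : ∀ n, ∀ᵐ t ∂circ, ‖D n t‖ ^ 2 ≤ σ n := by
    intro n
    filter_upwards [hσ n] with t ht
    simp only [hD, norm_div, Complex.norm_real, Real.norm_of_nonneg (Real.sqrt_nonneg _), div_pow]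
    rw [ht, Real.sq_sqrt (by linarith [hψ1 n t])]
    exact div_le_self (by rw [← ht]; positivity) (hψ1 n t)
  have hσ' : ∀ n, σ n ≤ 1 + (∫ t, φ t ∂circ) / ((n : ℝ) + 1) := by
    intro n
    refine (hσle n).trans (le_of_eq ?_)
    simp only [hψ]
    rw [integral_add (integrable_const _) (hφi.div_const _), integral_div]
    simp
  have hφint : 0 ≤ ∫ t, φ t ∂circ := integral_nonneg hφ0
  have hD2 : ∀ n, MemLp (D n) 2 circ := fun n => by
    refine MemLp.of_bound (hDmeas n) (√(σ n)) ?_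
    filter_upwards [hDb n] with t ht
    exact Real.le_sqrt_of_sq_le ht
  -- `D n` has mean one and `∫ |D n|² ≤ σ n`, which tends to one
  have hdist : ∀ n, ∫ t, ‖D n t - 1‖ ^ 2 ∂circ ≤ (∫ t, φ t ∂circ) / ((n : ℝ) + 1) := by
    intro n
    have hi1 : Integrable (fun t => ‖D n t‖ ^ 2) circ :=
      (memLp_two_iff_integrable_sq_norm (hDmeas n)).1 (hD2 n)
    have hi2 : Integrable (D n) circ := (hD2 n).integrable (by norm_num)
    have he : ∀ t, ‖D n t - 1‖ ^ 2 = ‖D n t‖ ^ 2 - 2 * (D n t).re + 1 := by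
      intro t
      rw [← Complex.normSq_eq_norm_sq, ← Complex.normSq_eq_norm_sq, Complex.normSq_apply,
        Complex.normSq_apply]
      simp
      ring
    simp_rw [he]
    have hre : ∫ t, (D n t).re ∂circ = 1 := by
      have := integral_re hi2
      simp only [RCLike.re_to_complex] at this
      rw [this, hy1 n]
      simp
    have hi3 : Integrable (fun t => (D n t).re) circ := hi2.re
    have hi4 : Integrable (fun t => ‖D n t‖ ^ 2 - 2 * (D n t).re) circ :=
      hi1.sub (hi3.const_mul 2)
    rw [integral_add hi4 (integrable_const _),
      integral_sub hi1 (hi3.const_mul 2), integral_const_mul, hre]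
    have h2 : ∫ t, ‖D n t‖ ^ 2 ∂circ ≤ σ n := by
      refine (integral_mono_ae hi1 (integrable_const (σ n)) (hDb n)).trans ?_
      simp
    have := hσ' n
    simp
    linarith
  have hlim : Tendsto (fun n => eLpNorm (D n - fun _ => (1 : ℂ)) 2 circ) atTop (𝓝 0) := by
    have hm : ∀ n, MemLp (D n - fun _ => (1 : ℂ)) 2 circ := fun n => (hD2 n).sub (memLp_const 1)
    have he : ∀ n, eLpNorm (D n - fun _ => (1 : ℂ)) 2 circ =
        ENNReal.ofReal (√(∫ t, ‖D n t - 1‖ ^ 2 ∂circ)) := by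
      intro n
      rw [← ENNReal.ofReal_toReal (hm n).2.ne, ← Lp.norm_toLp _ (hm n)]
      congr 1
      symm
      rw [Real.sqrt_eq_iff_mul_self_eq (integral_nonneg fun t => by positivity) (norm_nonneg _),
        ← sq, norm_toLp_sq]
      rfl
    simp_rw [he]
    rw [← ENNReal.ofReal_zero]
    refine ENNReal.tendsto_ofReal ?_
    rw [← Real.sqrt_zero]
    refine (Real.continuous_sqrt.tendsto 0).comp ?_
    refine squeeze_zero (fun n => integral_nonneg fun t => by positivity) hdist ?_
    have := (tendsto_one_div_add_atTop_nhds_zero_nat (𝕜 := ℝ)).const_mul (∫ t, φ t ∂circ)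
    simpa [div_eq_mul_inv] using this
  -- the `D n` are uniformly bounded, so dominated convergence applies along a subsequence
  obtain ⟨ns, -, hns⟩ := (tendstoInMeasure_of_tendsto_eLpNorm (by norm_num) hDmeas
    aestronglyMeasurable_const hlim).exists_seq_tendsto_ae
  have hDCT := tendsto_integral_of_dominated_convergence (μ := circ)
    (F := fun j t => D (ns j) t ^ 2 * ∑ i, h i t * k i t)
    (f := fun t => ∑ i, h i t * k i t)
    (fun t => (1 + ∫ t, φ t ∂circ) * ‖∑ i, h i t * k i t‖)
    (fun j => ((hDmeas _).pow 2).mul hint.1) (hint.norm.const_mul _) (fun j => ?_) ?_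
  · simp_rw [hzero] at hDCT
    exact tendsto_nhds_unique hDCT tendsto_const_nhds
  · filter_upwards [hDb (ns j)] with t ht
    rw [norm_mul, norm_pow]
    refine mul_le_mul_of_nonneg_right (ht.trans ((hσ' _).trans ?_)) (norm_nonneg _)
    have : (∫ t, φ t ∂circ) / (((ns j : ℕ) : ℝ) + 1) ≤ ∫ t, φ t ∂circ :=
      div_le_self hφint (by linarith [(Nat.cast_nonneg (ns j) : (0 : ℝ) ≤ _)])
    linarith
  · filter_upwards [hns] with t ht
    simpa using (ht.pow 2).mul_const (∑ i, h i t * k i t)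

/-! ### Vector-valued functions on the circle -/

/-- `L²` of the circle with values in `ℂ^q`. -/
abbrev VecL2 (q : ℕ) : Type := Lp (EuclideanSpace ℂ (Fin q)) 2 circ

/-- The entries of the matrix function `M` are square integrable on the circle. -/
def MatL2 {m n : ℕ} (M : ℝ → Matrix (Fin m) (Fin n) ℂ) : Prop :=
  ∀ i j, MemLp (fun t => M t i j) 2 circ

variable {m n : ℕ} {M : ℝ → Matrix (Fin m) (Fin n) ℂ}

lemma memLp_toLp_iff {q : ℕ} {v : ℝ → Fin q → ℂ} {p : ℝ≥0∞} :
    MemLp (fun t => WithLp.toLp 2 (v t)) p circ ↔ ∀ i, MemLp (fun t => v t i) p circ :=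
  memLp_piLp_iff

lemma VecL2.memLp_apply (y : VecL2 m) (i : Fin m) : MemLp (fun t => y t i) 2 circ :=
  memLp_piLp_iff.1 (Lp.memLp y) i

lemma MatL2.memLp_col (hM : MatL2 M) (k : ℤ) (p : Fin n) :
    MemLp (fun t => WithLp.toLp 2 fun i => ex (t * k) * M t i p) 2 circ :=
  memLp_toLp_iff.2 fun i => memLp_ex_mul (hM i p) k

/-- The element of `VecL2` given by the `p`-th column of `M` times `e^{ikt}`. -/
def col (hM : MatL2 M) (k : ℤ) (p : Fin n) : VecL2 m := (hM.memLp_col k p).toLp _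

lemma coeFn_col (hM : MatL2 M) (k : ℤ) (p : Fin n) :
    ∀ᵐ t ∂circ, col hM k p t = WithLp.toLp 2 fun i => ex (t * k) * M t i p :=
  (hM.memLp_col k p).coeFn_toLp

/-- The function `Mᴴ y`. -/
def adj (M : ℝ → Matrix (Fin m) (Fin n) ℂ) (y : ℝ → EuclideanSpace ℂ (Fin m)) (t : ℝ) :
    Fin n → ℂ :=
  (M t)ᴴ *ᵥ (y t).ofLp

lemma adj_apply (y : ℝ → EuclideanSpace ℂ (Fin m)) (t : ℝ) (p : Fin n) :
    adj M y t p = ∑ i, conj (M t i p) * y t i := by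
  simp [adj, Matrix.mulVec, dotProduct]

lemma integrable_adj (hM : MatL2 M) (y : VecL2 m) (p : Fin n) :
    Integrable (fun t => adj M y t p) circ := by
  simp_rw [adj_apply]
  exact integrable_finsetSum _ fun i _ =>
    integrable_mul_of_memLp (MemLp.conj_fun (hM i p)) (y.memLp_apply i)

/-- The inner products with the columns of `M` are the Fourier coefficients of `Mᴴ y`. -/
lemma inner_col (hM : MatL2 M) (k : ℤ) (p : Fin n) (y : VecL2 m) :
    inner ℂ (col hM k p) y = ∫ t, ex (-(t * k)) * adj M y t p ∂circ := by
  rw [L2.inner_def]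
  refine integral_congr_ae ?_
  filter_upwards [coeFn_col hM k p] with t ht
  rw [ht, adj_apply, PiLp.inner_apply, Finset.mul_sum]
  refine Finset.sum_congr rfl fun i _ => ?_
  simp only [RCLike.inner_apply, map_mul, conj_ex]
  ring

lemma inner_col_col {l : ℕ} {N : ℝ → Matrix (Fin m) (Fin l) ℂ} (hM : MatL2 M) (hN : MatL2 N)
    (j k : ℤ) (p : Fin n) (q : Fin l) :
    inner ℂ (col hM j p) (col hN k q) = ∫ t, ex (t * ((k : ℝ) - j)) * ((M t)ᴴ * N t) p q ∂circ := by
  rw [inner_col]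
  refine integral_congr_ae ?_
  filter_upwards [coeFn_col hN k q] with t ht
  rw [adj_apply, Matrix.mul_apply, ht, Finset.mul_sum, Finset.mul_sum]
  refine Finset.sum_congr rfl fun i _ => ?_
  have : ex (t * ((k : ℝ) - j)) = ex (-(t * j)) * ex (t * k) := by
    rw [← ex_add]; congr 1; ring
  simp only [Matrix.conjTranspose_apply, RCLike.star_def, this]
  ring

/-- The columns of an almost everywhere invertible matrix function, times all the exponentials, are
total. -/
lemma eq_zero_of_inner_col (hM : MatL2 M) {N : ℝ → Matrix (Fin m) (Fin n) ℂ}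
    (hMN : ∀ᵐ t ∂circ, N t * (M t)ᴴ = 1) {y : VecL2 m}
    (h : ∀ k p, inner ℂ (col hM k p) y = 0) : y = 0 := by
  rw [Lp.eq_zero_iff_ae_eq_zero]
  have h1 : ∀ p, (fun t => adj M y t p) =ᵐ[circ] 0 := fun p =>
    ae_eq_zero_of_fourier (integrable_adj hM y p) fun k => by
      have := h (-k) p
      rw [inner_col] at this
      simpa using this
  filter_upwards [hMN, ae_all_iff.2 h1] with t ht1 ht2
  have h2 : (M t)ᴴ *ᵥ (y t).ofLp = 0 := funext fun p => ht2 p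
  have h3 : (y t).ofLp = 0 := by
    rw [← Matrix.one_mulVec (y t).ofLp, ← ht1, ← Matrix.mulVec_mulVec, h2, Matrix.mulVec_zero]
  ext i
  simpa using congrFun h3 i

lemma conj_adj_dotProduct_adj {N : ℝ → Matrix (Fin m) (Fin n) ℂ}
    {y : ℝ → EuclideanSpace ℂ (Fin m)} {t : ℝ} (h : M t * (N t)ᴴ = 1) :
    ∑ p, conj (adj N y t p) * adj M y t p = ((‖y t‖ ^ 2 : ℝ) : ℂ) := by
  have h1 : ∑ p, conj (adj N y t p) * adj M y t p =
      star ((N t)ᴴ *ᵥ (y t).ofLp) ⬝ᵥ ((M t)ᴴ *ᵥ (y t).ofLp) := rfl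
  have h2 : N t * (M t)ᴴ = 1 := by
    rw [← Matrix.conjTranspose_conjTranspose (N t), ← Matrix.conjTranspose_mul, h,
      Matrix.conjTranspose_one]
  rw [h1, Matrix.star_mulVec, Matrix.conjTranspose_conjTranspose, Matrix.dotProduct_mulVec,
    Matrix.vecMul_vecMul, h2, Matrix.vecMul_one, EuclideanSpace.norm_sq_eq]
  simp only [dotProduct, Pi.star_apply, RCLike.star_def]
  push_cast
  refine Finset.sum_congr rfl fun i _ => ?_
  rw [mul_comm, Complex.mul_conj, Complex.normSq_eq_norm_sq]
  push_cast
  rfl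

/-- The past generated by the columns of `M` and the future generated by those of the biorthogonal
matrix `N` have no common orthogonal vector: for such a vector `z`, `|z|²` is the inner product of
the analytic function `Mᴴ z` with the function `Nᴴ z`, whose conjugate is analytic of mean zero. -/
theorem eq_zero_of_inner_past_future {N : ℝ → Matrix (Fin m) (Fin n) ℂ} (hM : MatL2 M)
    (hN : MatL2 N) (hMN : ∀ᵐ t ∂circ, M t * (N t)ᴴ = 1) {z : VecL2 m}
    (h1 : ∀ k : ℤ, k < 0 → ∀ p, inner ℂ (col hM k p) z = 0)
    (h2 : ∀ k : ℤ, 0 ≤ k → ∀ p, inner ℂ (col hN k p) z = 0) : z = 0 := by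
  have hz : (fun t => ∑ p, conj (adj N z t p) * adj M z t p) =ᵐ[circ]
      fun t => ((‖z t‖ ^ 2 : ℝ) : ℂ) := by
    filter_upwards [hMN] with t ht
    exact conj_adj_dotProduct_adj ht
  have hz2 : Integrable (fun t => ‖z t‖ ^ 2) circ := (Lp.memLp z).integrable_norm_pow (by norm_num)
  have hint : Integrable (fun t => ∑ p, conj (adj N z t p) * adj M z t p) circ :=
    hz2.ofReal.congr hz.symm
  have key := integral_sum_mul_eq_zero (h := fun p t => conj (adj N z t p))
    (k := fun p t => adj M z t p)
    (fun p => (LinearIsometryEquiv.integrable_comp_iff Complex.conjLIE).2 (integrable_adj hN z p))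
    (fun p => integrable_adj hM z p) (fun p k hk => ?_) (fun p k hk => ?_) hint
  · rw [integral_congr_ae hz, integral_complex_ofReal] at key
    have h0 : ∫ t, ‖z t‖ ^ 2 ∂circ = 0 := by exact_mod_cast key
    rw [integral_eq_zero_iff_of_nonneg (fun t => by positivity) hz2] at h0
    rw [Lp.eq_zero_iff_ae_eq_zero]
    filter_upwards [h0] with t ht
    simpa using ht
  · have := congrArg conj (h2 k hk p)
    rw [inner_col, ← integral_conj, map_zero] at this
    simpa [conj_ex] using this
  · have := h1 (-k) (by omega) p
    rw [inner_col] at this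
    simpa using this

lemma matL2_one (q : ℕ) : MatL2 fun _ : ℝ => (1 : Matrix (Fin q) (Fin q) ℂ) :=
  fun _ _ => memLp_const _

/-- The vector exponential `e^{ikt} δ_p`. -/
def vecEx (q : ℕ) (k : ℤ) (p : Fin q) : VecL2 q := col (matL2_one q) k p

lemma inner_vecEx {q : ℕ} (k : ℤ) (p : Fin q) (y : VecL2 q) :
    inner ℂ (vecEx q k p) y = ∫ t, ex (-(t * k)) * y t p ∂circ := by
  rw [vecEx, inner_col]
  simp [adj]

lemma exists_hilbertBasis_vecEx (q : ℕ) : ∃ b : HilbertBasis (ℤ × Fin q) ℂ (VecL2 q),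
    ∀ k p, b (k, p) = vecEx q k p := by
  have ho : Orthonormal ℂ fun x : ℤ × Fin q => vecEx q x.1 x.2 := by
    rw [orthonormal_iff_ite]
    rintro ⟨j, p⟩ ⟨k, q'⟩
    simp only [vecEx, inner_col_col, Matrix.conjTranspose_one, mul_one, integral_mul_const,
      Prod.mk.injEq]
    have := integral_ex (k - j)
    push_cast at this
    rw [this, Matrix.one_apply]
    simp only [sub_eq_zero]
    by_cases h : j = k
    · by_cases h' : p = q' <;> simp [h, h']
    · simp only [h, false_and, if_false, ite_mul, one_mul, zero_mul, ite_eq_right_iff]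
      exact fun h' => absurd h'.symm h
  refine ⟨HilbertBasis.mkOfOrthogonalEqBot ho ?_, fun k p => by
    rw [HilbertBasis.coe_mkOfOrthogonalEqBot]⟩
  rw [Submodule.eq_bot_iff]
  intro y hy
  refine eq_zero_of_inner_col (matL2_one q) (N := fun _ => 1) (by simp) fun k p => ?_
  exact (Submodule.mem_orthogonal _ _).1 hy _ (Submodule.subset_span ⟨(k, p), rfl⟩)

/-! ### The operator `F` as a Gram operator -/

section Abstract

variable {H : Type*} [NormedAddCommGroup H] [InnerProductSpace ℂ H] {T : ℕ}

/-- `∑ k, ∑ p, x(k)_p K(k, p)` for a finitely supported `x`. -/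
def comb (K : ℤ → Fin T → H) : (ℕ →₀ (Fin T → ℂ)) →ₗ[ℂ] H :=
  Finsupp.lsum ℂ fun k : ℕ => ∑ p, (LinearMap.proj p).smulRight (K k p)

lemma comb_apply (K : ℤ → Fin T → H) (x : ℕ →₀ (Fin T → ℂ)) :
    comb K x = x.sum fun k y => ∑ p, y p • K k p := by
  rw [comb, Finsupp.lsum_apply]
  refine Finset.sum_congr rfl fun k _ => ?_
  simp

lemma inner_comb (K : ℤ → Fin T → H) (x : ℕ →₀ (Fin T → ℂ)) (v : H) :
    inner ℂ v (comb K x) = x.sum fun k y => ∑ p, y p * inner ℂ v (K k p) := by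
  simp only [comb_apply, Finsupp.sum, inner_sum, inner_smul_right]

/-- The closed span of the vectors `K(k, p)` with `k` in `A`. -/
def closedSpan (K : ℤ → Fin T → H) (A : Set ℤ) : Submodule ℂ H :=
  (Submodule.span ℂ {v | ∃ k ∈ A, ∃ p, v = K k p}).topologicalClosure

lemma mem_closedSpan {K : ℤ → Fin T → H} {A : Set ℤ} {k : ℤ} (hk : k ∈ A) (p : Fin T) :
    K k p ∈ closedSpan K A :=
  Submodule.le_topologicalClosure _ (Submodule.subset_span ⟨k, hk, p, rfl⟩)

lemma closedSpan_le {K : ℤ → Fin T → H} {A : Set ℤ} {V : Submodule ℂ H}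
    (hV : IsClosed (V : Set H)) (h : ∀ k ∈ A, ∀ p, K k p ∈ V) : closedSpan K A ≤ V := by
  refine Submodule.topologicalClosure_minimal _ (Submodule.span_le.2 ?_) hV
  rintro _ ⟨k, hk, p, rfl⟩
  exact h k hk p

lemma inner_eq_zero_of_mem_closedSpan {K : ℤ → Fin T → H} {A : Set ℤ} {v w : H}
    (h : ∀ k ∈ A, ∀ p, inner ℂ w (K k p) = 0) (hv : v ∈ closedSpan K A) : inner ℂ w v = 0 := by
  have hle : closedSpan K A ≤ LinearMap.ker (innerSL ℂ w : H →ₗ[ℂ] ℂ) :=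
    closedSpan_le (ContinuousLinearMap.isClosed_ker _) h
  exact hle hv

lemma inner_eq_zero_of_mem_closedSpan' {K : ℤ → Fin T → H} {A : Set ℤ} {v w : H}
    (h : ∀ k ∈ A, ∀ p, inner ℂ (K k p) w = 0) (hv : v ∈ closedSpan K A) : inner ℂ v w = 0 := by
  rw [← inner_conj_symm, inner_eq_zero_of_mem_closedSpan (fun k hk p => ?_) hv, map_zero]
  rw [← inner_conj_symm, h k hk p, map_zero]

lemma comb_mem_closedSpan (K : ℤ → Fin T → H) (x : ℕ →₀ (Fin T → ℂ)) :
    comb K x ∈ closedSpan K (Set.Ici 0) := by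
  rw [comb_apply]
  exact Submodule.sum_mem _ fun k _ => Submodule.sum_mem _ fun p _ =>
    Submodule.smul_mem _ _ (mem_closedSpan (by simp) p)

lemma exists_comb_of_mem_span {K : ℤ → Fin T → H} {v : H}
    (hv : v ∈ Submodule.span ℂ {v | ∃ k ∈ Set.Ici (0 : ℤ), ∃ p, v = K k p}) :
    ∃ x, comb K x = v := by
  have hle : Submodule.span ℂ {v | ∃ k ∈ Set.Ici (0 : ℤ), ∃ p, v = K k p} ≤
      LinearMap.range (comb K) := by
    rw [Submodule.span_le]
    rintro _ ⟨k, hk, p, rfl⟩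
    refine ⟨Finsupp.single k.toNat (Pi.single p 1), ?_⟩
    have : ((k.toNat : ℕ) : ℤ) = k := Int.toNat_of_nonneg hk
    simp [comb, this, Pi.single_apply]
  exact hle hv

variable {r : ℕ} {μ s d : Fin r → ℕ} {f : ℝ → Matrix (Fin T) (Fin T) ℂ} {J K : ℤ → Fin T → H}

lemma Fapply_eq_inner
    (hF : ∀ (j k : ℕ) (p q : Fin T), Fcoef μ s d f j k p q = inner ℂ (K j p) (K k q))
    (x : ℕ →₀ (Fin T → ℂ)) (j : ℕ) (p : Fin T) :
    Fapply μ s d f x j p = inner ℂ (K j p) (comb K x) := by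
  rw [inner_comb, Fapply, Finsupp.sum, Finset.sum_apply]
  refine Finset.sum_congr rfl fun k _ => ?_
  simp only [Matrix.mulVec, dotProduct, hF, mul_comm]

lemma Fform_eq_norm_sq
    (hF : ∀ (j k : ℕ) (p q : Fin T), Fcoef μ s d f j k p q = inner ℂ (K j p) (K k q))
    (x : ℕ →₀ (Fin T → ℂ)) : Fform μ s d f x = ‖comb K x‖ ^ 2 := by
  have h : (x.sum fun j y => Fapply μ s d f x j ⬝ᵥ star y) = inner ℂ (comb K x) (comb K x) := by
    conv_rhs => rw [← inner_conj_symm, inner_comb, Finsupp.sum, map_sum]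
    refine Finset.sum_congr rfl fun k _ => ?_
    simp only [dotProduct, Fapply_eq_inner hF, map_sum, map_mul, Pi.star_apply, RCLike.star_def,
      inner_conj_symm, mul_comm]
  rw [Fform, h, inner_self_eq_norm_sq_to_K]
  norm_cast

lemma inner_comb_biorthogonal
    (hJK : ∀ j k p q, inner ℂ (J j p) (K k q) = if j = k ∧ p = q then 1 else 0)
    (x : ℕ →₀ (Fin T → ℂ)) (k : ℕ) (p : Fin T) : inner ℂ (J k p) (comb K x) = x k p := by
  rw [inner_comb, Finsupp.sum, Finset.sum_eq_single k]
  · simp [hJK]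
  · intro j _ hj
    refine Finset.sum_eq_zero fun q _ => ?_
    rw [hJK, if_neg (fun h => hj (by exact_mod_cast h.1.symm)), mul_zero]
  · intro hk
    simp [Finsupp.notMem_support_iff.1 hk]

lemma eq_of_inner_eq_of_mem_closedSpan {A : Set ℤ} {y y' : H} (hy : y ∈ closedSpan K A)
    (hy' : y' ∈ closedSpan K A) (h : ∀ k ∈ A, ∀ p, inner ℂ (K k p) y = inner ℂ (K k p) y') :
    y = y' := by
  rw [← sub_eq_zero, ← inner_self_eq_zero (𝕜 := ℂ)]
  refine inner_eq_zero_of_mem_closedSpan' (fun k hk p => ?_) (Submodule.sub_mem _ hy hy')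
  rw [inner_sub_right, h k hk p, sub_self]

/-- If the matrix of `F` is bounded on `ℓ²`, then ordinary solutions in `ℓ²` are solutions of the
extended equation. -/
theorem FRel_of_bounded
    (hF : ∀ (j k : ℕ) (p q : Fin T), Fcoef μ s d f j k p q = inner ℂ (K j p) (K k q)) {B : ℝ}
    (hB : ∀ x : ℕ →₀ (Fin T → ℂ), Fform μ s d f x ≤ B * x.sum fun _ y => eucl y ^ 2)
    {c b : ℕ → Fin T → ℂ} (hc : Summable fun k => eucl (c k) ^ 2)
    (hb : ∀ j, HasSum (fun k => Fcoef μ s d f j k *ᵥ c k) (b j)) : FRel μ s d f c b := by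
  classical
  let x : ℕ → ℕ →₀ (Fin T → ℂ) := fun n =>
    ∑ k ∈ Finset.range n, Finsupp.single k (c k)
  have hsingle : ∀ (A : Finset ℕ) k, (∑ k ∈ A, Finsupp.single k (c k)) k =
      if k ∈ A then c k else 0 := by
    intro A k
    rw [Finsupp.finsetSum_apply]
    simp [Finsupp.single_apply]
  have hxk : ∀ n k, x n k = if k < n then c k else 0 := by
    intro n k
    simp only [x, hsingle, Finset.mem_range]
  have hsum : ∀ A : Finset ℕ, ((∑ k ∈ A, Finsupp.single k (c k)).sum
      fun _ y => eucl y ^ 2) = ∑ k ∈ A, eucl (c k) ^ 2 := by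
    intro A
    rw [Finsupp.sum_of_support_subset _ (s := A) _ _ (by simp [eucl])]
    · exact Finset.sum_congr rfl fun k hk => by rw [hsingle, if_pos hk]
    · intro k hk
      by_contra h
      rw [Finsupp.mem_support_iff, hsingle, if_neg h] at hk
      exact hk rfl
  have hle : ∀ A : Finset ℕ, ‖comb K (∑ k ∈ A, Finsupp.single k (c k))‖ ^ 2 ≤
      |B| * ∑ k ∈ A, eucl (c k) ^ 2 := by
    intro A
    rw [← Fform_eq_norm_sq hF, ← hsum]
    refine (hB _).trans (mul_le_mul_of_nonneg_right (le_abs_self B) ?_)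
    exact Finset.sum_nonneg fun k _ => by positivity
  refine ⟨x, fun ε hε => ?_, fun k => ?_, fun j => ?_⟩
  · have hC := (hc.mul_left |B|).hasSum.tendsto_sum_nat.cauchySeq
    obtain ⟨n₀, hn₀⟩ := Metric.cauchySeq_iff.1 hC ε hε
    have key : ∀ m ≥ n₀, ∀ n ≥ n₀, n ≤ m → Fform μ s d f (x m - x n) < ε := by
      intro m hm n hn hnm
      have h1 : x m - x n = ∑ k ∈ Finset.Ico n m, Finsupp.single k (c k) := by
        simp only [x]
        rw [Finset.sum_Ico_eq_sub _ hnm]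
      rw [Fform_eq_norm_sq hF, h1]
      refine (hle _).trans_lt ?_
      have := hn₀ m hm n hn
      rw [Real.dist_eq, ← Finset.sum_Ico_eq_sub _ hnm, ← Finset.mul_sum] at this
      exact (le_abs_self _).trans_lt this
    refine ⟨n₀, fun m hm n hn => ?_⟩
    rcases le_total n m with h | h
    · exact key m hm n hn h
    · have h1 := key n hn m hm h
      rw [Fform_eq_norm_sq hF, map_sub] at h1 ⊢
      rwa [norm_sub_rev]
  · refine tendsto_const_nhds.congr' ?_
    filter_upwards [eventually_gt_atTop k] with n hn
    rw [hxk, if_pos hn]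
  · have := (hb j).tendsto_sum_nat
    refine this.congr fun n => ?_
    simp only [Fapply]
    rw [Finsupp.sum_of_support_subset _ (s := Finset.range n) _ _ (by simp)]
    · exact Finset.sum_congr rfl fun k hk => by rw [hxk, if_pos (Finset.mem_range.1 hk)]
    · intro k hk
      rw [Finsupp.mem_support_iff, hxk] at hk
      by_contra h
      rw [Finset.mem_range] at h
      exact hk (if_neg h)

variable [CompleteSpace H]

instance (K : ℤ → Fin T → H) (A : Set ℤ) : CompleteSpace (closedSpan K A) := by
  rw [closedSpan]; infer_instance

/-- The relation `F c = b` says that some `y` in the closed span of the `K(j, p)`, `j ≥ 0`, has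
coordinates `c` with respect to the biorthogonal family `J`, and inner products `b` with the family
`K`. -/
theorem FRel_iff
    (hF : ∀ (j k : ℕ) (p q : Fin T), Fcoef μ s d f j k p q = inner ℂ (K j p) (K k q))
    (hJK : ∀ j k p q, inner ℂ (J j p) (K k q) = if j = k ∧ p = q then 1 else 0)
    {c b : ℕ → Fin T → ℂ} :
    FRel μ s d f c b ↔ ∃ y ∈ closedSpan K (Set.Ici 0),
      (∀ (k : ℕ) p, inner ℂ (J k p) y = c k p) ∧ ∀ (j : ℕ) p, inner ℂ (K j p) y = b j p := by
  constructor
  · rintro ⟨x, hx, hc, hb⟩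
    have hC : CauchySeq fun n => comb K (x n) := by
      rw [Metric.cauchySeq_iff]
      intro ε hε
      obtain ⟨n₀, hn₀⟩ := hx (ε ^ 2) (by positivity)
      refine ⟨n₀, fun m hm n hn => ?_⟩
      have := hn₀ m hm n hn
      rw [Fform_eq_norm_sq hF, map_sub] at this
      rw [dist_eq_norm]
      exact lt_of_pow_lt_pow_left₀ 2 hε.le this
    obtain ⟨y, hy⟩ := cauchySeq_tendsto_of_complete hC
    have hlim : ∀ v, Tendsto (fun n => inner ℂ v (comb K (x n))) atTop (𝓝 (inner ℂ v y)) :=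
      fun v => tendsto_const_nhds.inner hy
    refine ⟨y, ?_, fun k p => ?_, fun j p => ?_⟩
    · exact (Submodule.isClosed_topologicalClosure _).mem_of_tendsto hy
        (Eventually.of_forall fun n => comb_mem_closedSpan K (x n))
    · refine tendsto_nhds_unique (hlim _) ?_
      simp_rw [inner_comb_biorthogonal hJK]
      exact (tendsto_pi_nhds.1 (hc k)) p
    · refine tendsto_nhds_unique (hlim _) ?_
      simp_rw [← Fapply_eq_inner hF]
      exact (tendsto_pi_nhds.1 (hb j)) p
  · rintro ⟨y, hy, hc, hb⟩
    rw [closedSpan, ← SetLike.mem_coe, Submodule.topologicalClosure_coe,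
      mem_closure_iff_seq_limit] at hy
    obtain ⟨v, hv, hlim⟩ := hy
    choose x hx using fun n => exists_comb_of_mem_span (hv n)
    have hlim' : ∀ w, Tendsto (fun n => inner ℂ w (comb K (x n))) atTop (𝓝 (inner ℂ w y)) := by
      intro w
      simp_rw [hx]
      exact tendsto_const_nhds.inner hlim
    refine ⟨x, fun ε hε => ?_, fun k => ?_, fun j => ?_⟩
    · obtain ⟨n₀, hn₀⟩ := Metric.cauchySeq_iff.1 hlim.cauchySeq (√ε) (Real.sqrt_pos.2 hε)
      refine ⟨n₀, fun m hm n hn => ?_⟩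
      have := hn₀ m hm n hn
      rw [Fform_eq_norm_sq hF, map_sub, hx, hx, ← dist_eq_norm]
      exact (Real.lt_sqrt dist_nonneg).1 this
    · rw [tendsto_pi_nhds]
      intro p
      simpa only [inner_comb_biorthogonal hJK, hc] using hlim' (J k p)
    · rw [tendsto_pi_nhds]
      intro p
      simpa only [← Fapply_eq_inner hF, hb] using hlim' (K j p)

/-- The residual of the projection on the future of `K` lies in the past of `J`. -/
theorem sub_starProjection_mem_past
    (hJK : ∀ j k p q, inner ℂ (J j p) (K k q) = if j = k ∧ p = q then 1 else 0)
    (hkey : ∀ z, (∀ k : ℤ, k < 0 → ∀ p, inner ℂ (J k p) z = 0) →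
      (∀ k : ℤ, 0 ≤ k → ∀ p, inner ℂ (K k p) z = 0) → z = 0) {w : H}
    (hw : ∀ k : ℤ, 0 ≤ k → ∀ p, inner ℂ (K k p) w = 0) : w ∈ closedSpan J (Set.Iio 0) := by
  set V := closedSpan J (Set.Iio 0)
  have hPV : V.starProjection w ∈ V := Submodule.starProjection_apply_mem V w
  have horth : ∀ v ∈ V, inner ℂ v (w - V.starProjection w) = 0 :=
    (Submodule.mem_orthogonal _ _).1 (Submodule.sub_starProjection_mem_orthogonal w)
  have h0 : w - V.starProjection w = 0 := by
    refine hkey _ (fun k hk p => ?_) fun k hk p => ?_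
    · have hmem : J k p ∈ V := mem_closedSpan (Set.mem_Iio.2 hk) p
      exact horth _ hmem
    -- the future of `K` is orthogonal to the past of `J` by biorthogonality
    · rw [inner_sub_right, hw k hk p, inner_eq_zero_of_mem_closedSpan (fun j hj q => ?_) hPV,
        sub_zero]
      rw [← inner_conj_symm, hJK, if_neg, map_zero]
      rintro ⟨rfl, -⟩
      exact absurd hj (not_lt.2 hk)
  rw [sub_eq_zero] at h0
  rw [h0]
  exact hPV

end Abstract

/-! ### The ratio `χ / β` -/

/-- An entire function that vanishes at finitely many points is divisible by the corresponding
linear factors. -/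
lemma exists_eq_prod_mul {ι : Type*} (S : Finset ι) (a : ι → ℂ) (ha : Set.InjOn a S) {g : ℂ → ℂ}
    (hg : Differentiable ℂ g) (hz : ∀ i ∈ S, g (a i) = 0) :
    ∃ h : ℂ → ℂ, Differentiable ℂ h ∧ ∀ z, g z = (∏ i ∈ S, (z - a i)) * h z := by
  classical
  induction S using Finset.induction_on generalizing g with
  | empty => exact ⟨g, hg, fun z => by simp⟩
  | insert i S hi ih =>
    have hd : Differentiable ℂ (dslope g (a i)) := by
      rw [← differentiableOn_univ, Complex.differentiableOn_dslope univ_mem]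
      exact hg.differentiableOn
    have h0 : g (a i) = 0 := hz i (Finset.mem_insert_self _ _)
    obtain ⟨h, hh, hgh⟩ := ih (ha.mono (by simp)) hd (fun j hj => by
      have hne : a j ≠ a i := fun h => hi (by
        rwa [← ha (Finset.mem_insert_of_mem hj) (Finset.mem_insert_self _ _) h])
      rw [dslope_of_ne _ hne, slope, h0, hz j (Finset.mem_insert_of_mem hj)]
      simp)
    refine ⟨h, hh, fun z => ?_⟩
    rw [Finset.prod_insert hi, mul_assoc, ← hgh]
    have := sub_smul_dslope g (a i) z
    rw [h0, sub_zero, smul_eq_mul] at this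
    exact this.symm

lemma ex_zpow (x : ℝ) (k : ℤ) : ex x ^ k = ex (k * x) := by
  rw [ex, ex, ← Complex.exp_int_mul]
  congr 1
  push_cast
  ring

lemma conj_chi {r : ℕ} (μ : Fin r → ℤ) (s d : Fin r → ℕ) (t : ℝ) :
    conj (chi μ s d (ex t)) = chi μ s d (ex (-t)) := by
  simp only [chi, map_prod, map_pow, map_sub, map_one, map_zpow₀, conj_ex]

/-- The ratio `χ_μ(e^{-iλ}) / β(iλ)`. -/
def ratio {r : ℕ} (μ : Fin r → ℤ) (s d : Fin r → ℕ) (t : ℝ) : ℂ :=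
  chi μ s d (ex (-t)) / beta s d t

/-- Each zero of `β` on `[-π, π]` is a zero of `χ`, of no smaller order, so their ratio is bounded. -/
lemma exists_ratio_bound {r : ℕ} (μ : Fin r → ℤ) (s d : Fin r → ℕ) (hs : ∀ i, 0 < s i) :
    ∃ C : ℝ, ∀ t ∈ Set.Icc (-Real.pi) Real.pi, ‖ratio μ s d t‖ ≤ C := by
  have hfac : ∀ j, ∃ C : ℝ, 0 ≤ C ∧ ∀ t ∈ Set.Icc (-Real.pi) Real.pi,
      ‖1 - ex (-t) ^ (μ j * (s j : ℤ))‖ ≤ C *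
        ‖∏ k ∈ Finset.Icc (-((s j / 2 : ℕ) : ℤ)) ((s j / 2 : ℕ) : ℤ),
          (Complex.I * (t : ℂ) - 2 * (Real.pi : ℂ) * Complex.I * (k : ℂ) / (s j : ℂ))‖ := by
    intro j
    have hsj : (s j : ℂ) ≠ 0 := by exact_mod_cast (hs j).ne'
    have hpi : (Real.pi : ℂ) ≠ 0 := by exact_mod_cast Real.pi_ne_zero
    -- the factors of `β` vanish at `2πk / s_j`, where `1 - e^{-iμ_j s_j λ}` vanishes too
    obtain ⟨h, hh, hgh⟩ := exists_eq_prod_mul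
      (Finset.Icc (-((s j / 2 : ℕ) : ℤ)) ((s j / 2 : ℕ) : ℤ))
      (fun k : ℤ => 2 * (Real.pi : ℂ) * (k : ℂ) / (s j : ℂ))
      (fun k _ l _ hkl => by
        simp only at hkl
        field_simp at hkl
        exact_mod_cast hkl)
      (g := fun z => 1 - Complex.exp (-(Complex.I * ((μ j * (s j : ℤ) : ℤ) : ℂ)) * z))
      (by fun_prop)
      (fun k _ => by
        rw [sub_eq_zero, eq_comm, Complex.exp_eq_one_iff]
        refine ⟨-(μ j * k), ?_⟩
        push_cast
        field_simp)
    obtain ⟨C, hC⟩ := isCompact_Icc.exists_bound_of_continuousOn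
      (hh.continuous.comp Complex.continuous_ofReal).continuousOn (s := Set.Icc (-Real.pi) Real.pi)
    refine ⟨|C|, abs_nonneg C, fun t ht => ?_⟩
    have h1 : 1 - ex (-t) ^ (μ j * (s j : ℤ)) =
        1 - Complex.exp (-(Complex.I * ((μ j * (s j : ℤ) : ℤ) : ℂ)) * (t : ℂ)) := by
      rw [ex_zpow, ex]
      congr 2
      push_cast
      ring
    rw [h1, hgh, norm_mul, mul_comm, norm_prod, norm_prod]
    have h2 : ∀ k : ℤ, ‖Complex.I * (t : ℂ) - 2 * (Real.pi : ℂ) * Complex.I * (k : ℂ) / (s j : ℂ)‖ =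
        ‖(t : ℂ) - 2 * (Real.pi : ℂ) * (k : ℂ) / (s j : ℂ)‖ := by
      intro k
      rw [show Complex.I * (t : ℂ) - 2 * (Real.pi : ℂ) * Complex.I * (k : ℂ) / (s j : ℂ) =
        Complex.I * ((t : ℂ) - 2 * (Real.pi : ℂ) * (k : ℂ) / (s j : ℂ)) by ring, norm_mul]
      simp
    simp_rw [h2]
    exact mul_le_mul_of_nonneg_right ((hC t ht).trans (le_abs_self C))
      (Finset.prod_nonneg fun _ _ => norm_nonneg _)
  choose C hC0 hC using hfac
  refine ⟨∏ j, C j ^ d j, fun t ht => ?_⟩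
  rw [ratio, norm_div]
  refine div_le_of_le_mul₀ (norm_nonneg _) (Finset.prod_nonneg fun j _ => pow_nonneg (hC0 j) _) ?_
  rw [chi, beta, norm_prod, norm_prod, ← Finset.prod_mul_distrib]
  refine Finset.prod_le_prod (fun j _ => norm_nonneg _) fun j _ => ?_
  rw [Finset.prod_pow, norm_pow, norm_pow, ← mul_pow]
  exact pow_le_pow_left₀ (norm_nonneg _) (hC j t ht) _

lemma ae_circ_mem_Icc : ∀ᵐ t ∂circ, t ∈ Set.Icc (-Real.pi) Real.pi := by
  refine ae_circ_of_countable ?_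
  convert Set.countable_empty (α := ℝ)
  ext t
  simp only [Set.mem_ofPred_eq, Set.mem_empty_iff_false, iff_false, not_and, not_not]
  exact fun h => ⟨h.1, h.2.le⟩

lemma continuous_chi {r : ℕ} (μ : Fin r → ℤ) (s d : Fin r → ℕ) :
    Continuous fun t : ℝ => chi μ s d (ex (-t)) := by
  simp only [chi, ex_zpow]
  exact continuous_finsetProd _ fun i _ =>
    (continuous_const.sub (continuous_ex.comp (by fun_prop))).pow _

lemma continuous_beta {r : ℕ} (s d : Fin r → ℕ) : Continuous (beta s d) := by
  unfold beta
  fun_prop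

lemma measurable_ratio {r : ℕ} (μ : Fin r → ℤ) (s d : Fin r → ℕ) : Measurable (ratio μ s d) :=
  (continuous_chi μ s d).measurable.div (continuous_beta s d).measurable

lemma memLp_ratio {r : ℕ} (μ : Fin r → ℤ) (s d : Fin r → ℕ) (hs : ∀ i, 0 < s i) (p : ℝ≥0∞) :
    MemLp (ratio μ s d) p circ := by
  obtain ⟨C, hC⟩ := exists_ratio_bound μ s d hs
  refine MemLp.of_bound (measurable_ratio μ s d).aestronglyMeasurable C ?_
  filter_upwards [ae_circ_mem_Icc] with t ht using hC t ht

lemma ae_beta_ne_zero {r : ℕ} (s d : Fin r → ℕ) : ∀ᵐ t ∂circ, beta s d t ≠ 0 := by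
  refine ae_circ_of_countable ?_
  refine (Set.countable_range fun x : Fin r × ℤ =>
    2 * Real.pi * (x.2 : ℝ) / (s x.1 : ℝ)).mono ?_
  rintro t ⟨-, ht⟩
  rw [not_not, beta, Finset.prod_eq_zero_iff] at ht
  obtain ⟨j, -, hj⟩ := ht
  obtain ⟨k, -, hk⟩ := Finset.prod_eq_zero_iff.1 hj
  refine ⟨(j, k), ?_⟩
  have h1 := eq_zero_of_pow_eq_zero hk
  have h2 : Complex.I * ((t : ℂ) - 2 * (Real.pi : ℂ) * (k : ℂ) / (s j : ℂ)) = 0 := by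
    rw [← h1]; ring
  have h3 := (mul_eq_zero.1 h2).resolve_left Complex.I_ne_zero
  have h4 : (t : ℂ) = ((2 * Real.pi * (k : ℝ) / (s j : ℝ) : ℝ) : ℂ) := by
    push_cast
    exact sub_eq_zero.1 h3
  exact (Complex.ofReal_injective h4).symm

lemma ae_chi_ne_zero {r : ℕ} (μ : Fin r → ℤ) (s d : Fin r → ℕ) (hs : ∀ i, 0 < s i)
    (hμ : ∀ i, μ i ≠ 0) : ∀ᵐ t ∂circ, chi μ s d (ex (-t)) ≠ 0 := by
  refine ae_circ_of_countable ?_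
  refine (Set.countable_range fun x : Fin r × ℤ =>
    -(2 * Real.pi * (x.2 : ℝ) / (μ x.1 * s x.1 : ℝ))).mono ?_
  rintro t ⟨-, ht⟩
  rw [not_not, chi, Finset.prod_eq_zero_iff] at ht
  obtain ⟨j, -, hj⟩ := ht
  have h1 := eq_zero_of_pow_eq_zero hj
  rw [sub_eq_zero, eq_comm, ex_zpow, ex, Complex.exp_eq_one_iff] at h1
  obtain ⟨k, hk⟩ := h1
  refine ⟨(j, k), ?_⟩
  have hne : ((μ j : ℝ) * (s j : ℝ)) ≠ 0 :=
    mul_ne_zero (by exact_mod_cast hμ j) (by exact_mod_cast (hs j).ne')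
  have h2 : ((((μ j * (s j : ℤ) : ℤ) : ℝ) * -t : ℝ) : ℂ) = ((2 * Real.pi * k : ℝ) : ℂ) := by
    refine mul_left_cancel₀ Complex.I_ne_zero ?_
    rw [hk]
    push_cast
    ring
  have h3 := Complex.ofReal_injective h2
  push_cast at h3
  simp only
  rw [neg_eq_iff_eq_neg, div_eq_iff hne]
  linarith

lemma ae_ratio_ne_zero {r : ℕ} (μ : Fin r → ℤ) (s d : Fin r → ℕ) (hs : ∀ i, 0 < s i)
    (hμ : ∀ i, μ i ≠ 0) : ∀ᵐ t ∂circ, ratio μ s d t ≠ 0 := by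
  filter_upwards [ae_beta_ne_zero s d, ae_chi_ne_zero μ s d hs hμ] with t h1 h2
  exact div_ne_zero h2 h1

lemma weight_eq {r : ℕ} (μ s d : Fin r → ℕ) (t : ℝ) :
    weight μ s d t = (‖ratio (zstep μ) s d t‖ ^ 2)⁻¹ := by
  rw [weight, ratio, norm_div, div_pow, inv_div]

/-! ### Factors of the spectral density -/

/-- `R` is a measurable factor of `f`: almost everywhere `f = R Rᴴ`. -/
structure SpecFactor {T : ℕ} (f R : ℝ → Matrix (Fin T) (Fin T) ℂ) : Prop where
  meas : ∀ i j, AEStronglyMeasurable (fun t => R t i j) circ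
  mul : ∀ᵐ t ∂circ, R t * (R t)ᴴ = f t

lemma measurable_of_continuousOn_isClosed {α : Type*} [TopologicalSpace α] [MeasurableSpace α]
    [OpensMeasurableSpace α] {F : α → ℂ} {S : Set α} (hS : IsClosed S) (hF : ContinuousOn F S)
    (h0 : ∀ x, x ∉ S → F x = 0) : Measurable F := by
  classical
  have h2 := hF.measurable_piecewise (g := fun _ => (0 : ℂ)) continuousOn_const hS.measurableSet
  convert h2 using 1
  ext x
  by_cases hx : x ∈ S
  · rw [Set.piecewise_eq_of_mem _ _ _ hx]
  · rw [Set.piecewise_eq_of_notMem _ _ _ hx, h0 x hx]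

open scoped Matrix.Norms.L2Operator MatrixOrder in
lemma exists_specFactor {T : ℕ} {f : ℝ → Matrix (Fin T) (Fin T) ℂ}
    (hf : ∀ i j, AEStronglyMeasurable (fun t => f t i j) circ)
    (hpos : ∀ᵐ t ∂circ, (f t).PosSemidef) : ∃ R, SpecFactor f R := by
  classical
  refine ⟨fun t => CFC.sqrt (f t), fun i j => ?_, ?_⟩
  · have hf' : AEMeasurable (fun t => (fun i j => f t i j : Fin T → Fin T → ℂ)) circ :=
      aemeasurable_pi_lambda _ fun i => aemeasurable_pi_lambda _ fun j => (hf i j).aemeasurable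
    have hclosed : IsClosed {A : Fin T → Fin T → ℂ | (0 : Matrix (Fin T) (Fin T) ℂ) ≤ Matrix.of A} :=
      isClosed_le continuous_const (continuous_id (X := Matrix (Fin T) (Fin T) ℂ))
    have hcont : ContinuousOn (fun A : Fin T → Fin T → ℂ => CFC.sqrt (Matrix.of A) i j)
        {A : Fin T → Fin T → ℂ | (0 : Matrix (Fin T) (Fin T) ℂ) ≤ Matrix.of A} := by
      have h := CFC.continuousOn_sqrt (A := Matrix (Fin T) (Fin T) ℂ)
      exact ((continuous_apply j).comp (continuous_apply i)).comp_continuousOn h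
    have hm : Measurable fun A : Fin T → Fin T → ℂ => CFC.sqrt (Matrix.of A) i j := by
      refine measurable_of_continuousOn_isClosed hclosed hcont fun A hA => ?_
      rw [CFC.sqrt_of_not_nonneg hA]
      rfl
    exact (hm.comp_aemeasurable hf').aestronglyMeasurable
  · filter_upwards [hpos] with t ht
    have h0 : 0 ≤ f t := Matrix.nonneg_iff_posSemidef.2 ht
    have h1 : (CFC.sqrt (f t))ᴴ = CFC.sqrt (f t) := (CFC.sqrt_nonneg (f t)).isSelfAdjoint
    rw [h1, CFC.sqrt_mul_sqrt_self (f t) h0]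

/-! ### The isometry of `L²(f)` with `L²` of the circle -/

section Lift

variable {T : ℕ} {f R : ℝ → Matrix (Fin T) (Fin T) ℂ}

/-- The map `g ↦ Rᵀ g`. It is isometric from `L²(f)` to `VecL2 T` if `R` is a factor of `f`. -/
def lift (R : ℝ → Matrix (Fin T) (Fin T) ℂ) (g : ℝ → Fin T → ℂ) (t : ℝ) :
    EuclideanSpace ℂ (Fin T) :=
  WithLp.toLp 2 ((R t)ᵀ *ᵥ g t)

lemma lift_apply (g : ℝ → Fin T → ℂ) (t : ℝ) (i : Fin T) :
    lift R g t i = ∑ p, R t p i * g t p := rfl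

lemma lift_sub (g h : ℝ → Fin T → ℂ) : lift R (g - h) = lift R g - lift R h := by
  ext t i
  simp [lift_apply, mul_sub]

lemma lift_add (g h : ℝ → Fin T → ℂ) : lift R (g + h) = lift R g + lift R h := by
  ext t i
  simp [lift_apply, mul_add, Finset.sum_add_distrib]

lemma lift_smul (c : ℂ) (g : ℝ → Fin T → ℂ) : lift R (c • g) = c • lift R g := by
  ext t i
  simp only [lift_apply, Pi.smul_apply, smul_eq_mul, PiLp.smul_apply, Finset.mul_sum]
  exact Finset.sum_congr rfl fun p _ => by ring

lemma aestronglyMeasurable_pi_iff {q : ℕ} {g : ℝ → Fin q → ℂ} :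
    AEStronglyMeasurable g circ ↔ ∀ p, AEStronglyMeasurable (fun t => g t p) circ := by
  constructor
  · intro h p
    exact (continuous_apply p).comp_aestronglyMeasurable h
  · intro h
    exact (aemeasurable_pi_lambda _ fun p => (h p).aemeasurable).aestronglyMeasurable

lemma SpecFactor.aestronglyMeasurable_lift (hR : SpecFactor f R) {g : ℝ → Fin T → ℂ}
    (hg : AEStronglyMeasurable g circ) : AEStronglyMeasurable (lift R g) circ := by
  refine (PiLp.continuous_toLp 2 _).comp_aestronglyMeasurable
    (aestronglyMeasurable_pi_iff.2 fun i => ?_)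
  change AEStronglyMeasurable (fun t => ∑ p, R t p i * g t p) circ
  exact Finset.aestronglyMeasurable_fun_sum _ fun p _ =>
    (hR.meas p i).mul (aestronglyMeasurable_pi_iff.1 hg p)

lemma inner_lift {t : ℝ} (h : R t * (R t)ᴴ = f t) (g₁ g₂ : ℝ → Fin T → ℂ) :
    inner ℂ (lift R g₂ t) (lift R g₁ t) = g₁ t ⬝ᵥ (f t *ᵥ star (g₂ t)) := by
  rw [EuclideanSpace.inner_eq_star_dotProduct, lift, lift, Matrix.mulVec_transpose,
    Matrix.mulVec_transpose, Matrix.star_vecMul, ← h, ← Matrix.mulVec_mulVec,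
    Matrix.dotProduct_mulVec (g₁ t)]

lemma SpecFactor.specNormSq_eq (hR : SpecFactor f R) (g : ℝ → Fin T → ℂ) :
    specNormSq f g = eLpNorm (lift R g) 2 circ ^ 2 := by
  have h : specNormSq f g = ∫⁻ t, ‖lift R g t‖ₑ ^ 2 ∂circ := by
    refine lintegral_congr_ae ?_
    filter_upwards [hR.mul] with t ht
    rw [← inner_lift ht, inner_self_eq_norm_sq_to_K]
    have : (((‖lift R g t‖ : ℝ) : ℂ) ^ 2).re = ‖lift R g t‖ ^ 2 := by
      rw [← Complex.ofReal_pow, Complex.ofReal_re]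
    rw [RCLike.ofReal_eq_complex_ofReal, this, ENNReal.ofReal_pow (norm_nonneg _), ofReal_norm]
  rw [h, eLpNorm_eq_lintegral_rpow_enorm_toReal (by norm_num) (by norm_num)]
  simp only [ENNReal.toReal_ofNat, ENNReal.rpow_ofNat, one_div]
  rw [← ENNReal.rpow_natCast, ← ENNReal.rpow_mul]
  norm_num

lemma SpecFactor.memLp_lift (hR : SpecFactor f R) {g : ℝ → Fin T → ℂ} (hg : MemL2 f g) :
    MemLp (lift R g) 2 circ := by
  refine ⟨hR.aestronglyMeasurable_lift hg.1, ?_⟩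
  have := hg.2
  rw [hR.specNormSq_eq] at this
  by_contra h
  rw [not_lt, top_le_iff] at h
  rw [h] at this
  simp at this

lemma SpecFactor.memL2_of_memLp (hR : SpecFactor f R) {g : ℝ → Fin T → ℂ}
    (hg : AEStronglyMeasurable g circ) (h : MemLp (lift R g) 2 circ) : MemL2 f g :=
  ⟨hg, by rw [hR.specNormSq_eq]; exact ENNReal.pow_lt_top h.2⟩

/-- The image in `VecL2 T` of a function in `L²(f)`. -/
def SpecFactor.toH (hR : SpecFactor f R) {g : ℝ → Fin T → ℂ} (hg : MemL2 f g) : VecL2 T :=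
  (hR.memLp_lift hg).toLp _

lemma SpecFactor.coeFn_toH (hR : SpecFactor f R) {g : ℝ → Fin T → ℂ} (hg : MemL2 f g) :
    hR.toH hg =ᵐ[circ] lift R g := (hR.memLp_lift hg).coeFn_toLp

lemma SpecFactor.specInner_eq (hR : SpecFactor f R) {g₁ g₂ : ℝ → Fin T → ℂ} (h₁ : MemL2 f g₁)
    (h₂ : MemL2 f g₂) : specInner f g₁ g₂ = inner ℂ (hR.toH h₂) (hR.toH h₁) := by
  rw [SpecFactor.toH, SpecFactor.toH, inner_toLp]
  refine integral_congr_ae ?_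
  filter_upwards [hR.mul] with t ht
  exact (inner_lift ht _ _).symm

lemma SpecFactor.memL2_sub (hR : SpecFactor f R) {g₁ g₂ : ℝ → Fin T → ℂ} (h₁ : MemL2 f g₁)
    (h₂ : MemL2 f g₂) : MemL2 f (g₁ - g₂) :=
  hR.memL2_of_memLp (h₁.1.sub h₂.1) (by
    rw [lift_sub]; exact (hR.memLp_lift h₁).sub (hR.memLp_lift h₂))

lemma SpecFactor.memL2_add (hR : SpecFactor f R) {g₁ g₂ : ℝ → Fin T → ℂ} (h₁ : MemL2 f g₁)
    (h₂ : MemL2 f g₂) : MemL2 f (g₁ + g₂) :=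
  hR.memL2_of_memLp (h₁.1.add h₂.1) (by
    rw [lift_add]; exact (hR.memLp_lift h₁).add (hR.memLp_lift h₂))

lemma SpecFactor.memL2_smul (hR : SpecFactor f R) {g : ℝ → Fin T → ℂ} (h : MemL2 f g) (c : ℂ) :
    MemL2 f (c • g) :=
  hR.memL2_of_memLp (h.1.const_smul c) (by
    rw [lift_smul]; exact (hR.memLp_lift h).const_smul c)

lemma SpecFactor.memL2_zero (hR : SpecFactor f R) : MemL2 f (0 : ℝ → Fin T → ℂ) :=
  hR.memL2_of_memLp aestronglyMeasurable_const (by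
    have : lift R (0 : ℝ → Fin T → ℂ) = 0 := by ext t i; simp [lift_apply]
    rw [this]; exact MemLp.zero)

lemma SpecFactor.toH_sub (hR : SpecFactor f R) {g₁ g₂ : ℝ → Fin T → ℂ} (h₁ : MemL2 f g₁)
    (h₂ : MemL2 f g₂) : hR.toH (hR.memL2_sub h₁ h₂) = hR.toH h₁ - hR.toH h₂ := by
  rw [SpecFactor.toH, SpecFactor.toH, SpecFactor.toH, ← MemLp.toLp_sub]
  simp only [lift_sub]

lemma SpecFactor.toH_add (hR : SpecFactor f R) {g₁ g₂ : ℝ → Fin T → ℂ} (h₁ : MemL2 f g₁)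
    (h₂ : MemL2 f g₂) : hR.toH (hR.memL2_add h₁ h₂) = hR.toH h₁ + hR.toH h₂ := by
  rw [SpecFactor.toH, SpecFactor.toH, SpecFactor.toH, ← MemLp.toLp_add]
  simp only [lift_add]

lemma SpecFactor.toH_smul (hR : SpecFactor f R) {g : ℝ → Fin T → ℂ} (h : MemL2 f g) (c : ℂ) :
    hR.toH (hR.memL2_smul h c) = c • hR.toH h := by
  rw [SpecFactor.toH, SpecFactor.toH, ← MemLp.toLp_const_smul]
  simp only [lift_smul]

lemma SpecFactor.toH_zero (hR : SpecFactor f R) : hR.toH hR.memL2_zero = 0 := by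
  rw [Lp.eq_zero_iff_ae_eq_zero]
  refine (hR.coeFn_toH hR.memL2_zero).trans (Eventually.of_forall fun t => ?_)
  ext i
  simp [lift_apply]

/-- The functions of `L²(f)` whose image in `VecL2 T` lies in `V`. -/
def SpecFactor.comap (hR : SpecFactor f R) (V : Submodule ℂ (VecL2 T)) :
    Submodule ℂ (ℝ → Fin T → ℂ) where
  carrier := {g | ∃ hg : MemL2 f g, hR.toH hg ∈ V}
  add_mem' := by
    rintro a b ⟨ha, ha'⟩ ⟨hb, hb'⟩
    exact ⟨hR.memL2_add ha hb, by rw [hR.toH_add ha hb]; exact V.add_mem ha' hb'⟩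
  zero_mem' := ⟨hR.memL2_zero, by rw [hR.toH_zero]; exact V.zero_mem⟩
  smul_mem' := by
    rintro c a ⟨ha, ha'⟩
    exact ⟨hR.memL2_smul ha c, by rw [hR.toH_smul ha c]; exact V.smul_mem c ha'⟩

lemma SpecFactor.specNormSq_sub_eq (hR : SpecFactor f R) {g₁ g₂ : ℝ → Fin T → ℂ} (h₁ : MemL2 f g₁)
    (h₂ : MemL2 f g₂) : specNormSq f (g₁ - g₂) = ENNReal.ofReal (‖hR.toH h₁ - hR.toH h₂‖ ^ 2) := by
  rw [← hR.toH_sub h₁ h₂, hR.specNormSq_eq, SpecFactor.toH, Lp.norm_toLp,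
    ENNReal.ofReal_pow ENNReal.toReal_nonneg, ENNReal.ofReal_toReal]
  exact (hR.memLp_lift (hR.memL2_sub h₁ h₂)).2.ne

lemma SpecFactor.tendsto_specNormSq_iff (hR : SpecFactor f R) {g : ℝ → Fin T → ℂ}
    {S : ℕ → ℝ → Fin T → ℂ} (hg : MemL2 f g) (hS : ∀ n, MemL2 f (S n)) :
    Tendsto (fun n => specNormSq f (g - S n)) atTop (𝓝 0) ↔
      Tendsto (fun n => hR.toH (hS n)) atTop (𝓝 (hR.toH hg)) := by
  simp_rw [fun n => hR.specNormSq_sub_eq hg (hS n)]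
  rw [tendsto_iff_norm_sub_tendsto_zero]
  simp_rw [norm_sub_rev _ (hR.toH hg)]
  constructor
  · intro h
    have h1 := (ENNReal.tendsto_toReal ENNReal.zero_ne_top).comp h
    have h2 := (Real.continuous_sqrt.tendsto _).comp h1
    refine (h2.congr fun n => ?_).trans (by simp)
    simp only [Function.comp_apply]
    rw [ENNReal.toReal_ofReal (by positivity), Real.sqrt_sq (norm_nonneg _)]
  · intro h
    have h1 := ENNReal.tendsto_ofReal (h.pow 2)
    simpa using h1

/-! ### The matrices of the two biorthogonal families -/

lemma SpecFactor.matL2 (hR : SpecFactor f R) (hf : ∀ i j, Integrable (fun t => f t i j) circ) :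
    MatL2 R := by
  intro i j
  rw [memLp_two_iff_integrable_sq_norm (hR.meas i j)]
  refine (hf i i).norm.mono' ((hR.meas i j).norm.pow 2) ?_
  filter_upwards [hR.mul] with t ht
  have h1 : f t i i = ((∑ k, ‖R t i k‖ ^ 2 : ℝ) : ℂ) := by
    rw [← ht, Matrix.mul_apply]
    push_cast
    refine Finset.sum_congr rfl fun k _ => ?_
    rw [Matrix.conjTranspose_apply, RCLike.star_def, Complex.mul_conj, Complex.normSq_eq_norm_sq]
    push_cast
    rfl
  rw [h1, Complex.norm_real, Real.norm_of_nonneg (by positivity), Real.norm_of_nonneg (by positivity)]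
  exact Finset.single_le_sum (f := fun k => ‖R t i k‖ ^ 2) (fun k _ => by positivity)
    (Finset.mem_univ j)

lemma MatL2.mul_of_bounded {m n : ℕ} {M : ℝ → Matrix (Fin m) (Fin n) ℂ} (hM : MatL2 M) {u : ℝ → ℂ}
    (hu : MemLp u ⊤ circ) (i : Fin m) (j : Fin n) : MemLp (fun t => u t * M t i j) 2 circ :=
  (hM i j).mul' hu

lemma aestronglyMeasurable_inv {A : ℝ → Matrix (Fin T) (Fin T) ℂ}
    (hA : ∀ i j, AEStronglyMeasurable (fun t => A t i j) circ) (i j : Fin T) :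
    AEStronglyMeasurable (fun t => (A t)⁻¹ i j) circ := by
  have hA' : AEMeasurable (fun t => (fun i j => A t i j : Fin T → Fin T → ℂ)) circ :=
    aemeasurable_pi_lambda _ fun i => aemeasurable_pi_lambda _ fun j => (hA i j).aemeasurable
  have hm : Measurable fun B : Fin T → Fin T → ℂ => (Matrix.of B)⁻¹ i j := by
    have hc : Continuous fun B : Fin T → Fin T → ℂ => Matrix.of B :=
      continuous_id (X := Matrix (Fin T) (Fin T) ℂ)
    have h1 : Measurable fun B : Fin T → Fin T → ℂ => (Matrix.of B).det⁻¹ :=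
      hc.matrix_det.measurable.inv
    have h2 : Measurable fun B : Fin T → Fin T → ℂ => (Matrix.of B).adjugate i j :=
      (hc.matrix_adjugate.matrix_elem i j).measurable
    have : (fun B : Fin T → Fin T → ℂ => (Matrix.of B)⁻¹ i j) =
        fun B => (Matrix.of B).det⁻¹ * (Matrix.of B).adjugate i j := by
      ext B
      rw [Matrix.inv_def, Ring.inverse_eq_inv, Matrix.smul_apply, smul_eq_mul]
    rw [this]
    exact h1.mul h2
  exact (hm.comp_aemeasurable hA').aestronglyMeasurable

variable {r : ℕ} (μ s d : Fin r → ℕ)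

/-- The matrix `(χ_μ / β) Rᵀ`, whose columns are the images of the generators of `L²(f)`. -/
def genMat (R : ℝ → Matrix (Fin T) (Fin T) ℂ) (t : ℝ) : Matrix (Fin T) (Fin T) ℂ :=
  (ratio (zstep μ) s d t • R t)ᵀ

/-- The matrix biorthogonal to `genMat`. -/
def dualMat (R : ℝ → Matrix (Fin T) (Fin T) ℂ) (t : ℝ) : Matrix (Fin T) (Fin T) ℂ :=
  ((genMat μ s d R t)ᴴ)⁻¹

lemma matL2_genMat (hR : MatL2 R) (hs : ∀ i, 0 < s i) : MatL2 (genMat μ s d R) := fun i j => by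
  change MemLp (fun t => ratio (zstep μ) s d t * R t j i) 2 circ
  exact hR.mul_of_bounded (memLp_ratio _ s d hs ⊤) j i

lemma genMat_conjTranspose_mul {t : ℝ} (ht : R t * (R t)ᴴ = f t) :
    (genMat μ s d R t)ᴴ * genMat μ s d R t =
      ((‖ratio (zstep μ) s d t‖ ^ 2 : ℝ) : ℂ) • (f t)ᵀ := by
  rw [genMat, ← ht, Matrix.transpose_mul, Matrix.transpose_smul, Matrix.conjTranspose_smul,
    Matrix.smul_mul, Matrix.mul_smul, smul_smul]
  congr 1
  · rw [RCLike.star_def, mul_comm, Complex.mul_conj, Complex.normSq_eq_norm_sq]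

lemma isUnit_det_genMat {t : ℝ} (ht : R t * (R t)ᴴ = f t) (hdet : IsUnit (f t).det)
    (hu : ratio (zstep μ) s d t ≠ 0) : IsUnit (genMat μ s d R t).det := by
  rw [genMat, Matrix.det_transpose, Matrix.det_smul]
  rw [← ht, Matrix.det_mul] at hdet
  exact (IsUnit.mk0 _ (pow_ne_zero _ hu)).mul (isUnit_of_mul_isUnit_left hdet)

lemma genMat_mul_dualMat {t : ℝ} (h : IsUnit (genMat μ s d R t).det) :
    genMat μ s d R t * (dualMat μ s d R t)ᴴ = 1 := by
  rw [dualMat, Matrix.conjTranspose_nonsing_inv, Matrix.conjTranspose_conjTranspose,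
    Matrix.mul_nonsing_inv _ h]

lemma conjTranspose_genMat_mul_dualMat {t : ℝ} (h : IsUnit (genMat μ s d R t).det) :
    (genMat μ s d R t)ᴴ * dualMat μ s d R t = 1 := by
  rw [dualMat, Matrix.mul_nonsing_inv]
  rw [Matrix.det_conjTranspose]
  exact h.star

lemma dualMat_mul_conjTranspose_genMat {t : ℝ} (h : IsUnit (genMat μ s d R t).det) :
    dualMat μ s d R t * (genMat μ s d R t)ᴴ = 1 := by
  rw [dualMat, Matrix.nonsing_inv_mul]
  rw [Matrix.det_conjTranspose]
  exact h.star

lemma conjTranspose_dualMat_mul {t : ℝ} (ht : R t * (R t)ᴴ = f t)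
    (h : IsUnit (genMat μ s d R t).det) (hu : ratio (zstep μ) s d t ≠ 0) :
    (dualMat μ s d R t)ᴴ * dualMat μ s d R t = ((weight μ s d t : ℝ) : ℂ) • ((f t)⁻¹)ᵀ := by
  have h1 := genMat_conjTranspose_mul μ s d ht
  have h2 : (dualMat μ s d R t)ᴴ * dualMat μ s d R t =
      ((genMat μ s d R t)ᴴ * genMat μ s d R t)⁻¹ := by
    rw [Matrix.mul_inv_rev, dualMat, Matrix.conjTranspose_nonsing_inv,
      Matrix.conjTranspose_conjTranspose]
  have hk : ((‖ratio (zstep μ) s d t‖ ^ 2 : ℝ) : ℂ) ≠ 0 := by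
    have := norm_pos_iff.2 hu
    exact_mod_cast (by positivity : ‖ratio (zstep μ) s d t‖ ^ 2 ≠ 0)
  rw [h2, h1, weight_eq, Matrix.transpose_nonsing_inv]
  push_cast
  by_cases hd : IsUnit (f t)ᵀ.det
  · refine Matrix.inv_eq_right_inv ?_
    rw [Matrix.smul_mul, Matrix.mul_smul, smul_smul, Matrix.mul_nonsing_inv _ hd]
    push_cast at hk
    rw [mul_inv_cancel₀ hk, one_smul]
  · exfalso
    apply hd
    rw [Matrix.det_transpose, ← ht, Matrix.det_mul, Matrix.det_conjTranspose]
    rw [genMat, Matrix.det_transpose, Matrix.det_smul] at h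
    have := isUnit_of_mul_isUnit_right h
    exact this.mul this.star

end Lift

/-! ### The biorthogonal families `J` and `K` -/

/-- The data of the spectral side: a factor `R` of an integrable spectral density `f` which satisfies
the minimality condition. -/
structure Setting {r T : ℕ} (μ s d : Fin r → ℕ) (f R : ℝ → Matrix (Fin T) (Fin T) ℂ) : Prop where
  spec : SpecFactor f R
  step_pos : ∀ i, 0 < μ i
  season_pos : ∀ i, 0 < s i
  integrable : ∀ i j, Integrable (fun t => f t i j) circ
  minimality : Minimality μ s d f

namespace Setting

variable {r T : ℕ} {μ s d : Fin r → ℕ} {f R : ℝ → Matrix (Fin T) (Fin T) ℂ}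

lemma matL2 (S : Setting μ s d f R) : MatL2 R := S.spec.matL2 S.integrable

lemma ae_ratio_ne_zero (S : Setting μ s d f R) : ∀ᵐ t ∂circ, ratio (zstep μ) s d t ≠ 0 :=
  GM.ae_ratio_ne_zero _ s d S.season_pos fun i => by
    have := S.step_pos i
    simp only [zstep]
    omega

lemma ae_isUnit (S : Setting μ s d f R) : ∀ᵐ t ∂circ, IsUnit (genMat μ s d R t).det := by
  filter_upwards [S.spec.mul, S.minimality.1, S.ae_ratio_ne_zero] with t h1 h2 h3
  exact isUnit_det_genMat μ s d h1 h2 h3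

lemma matL2_genMat (S : Setting μ s d f R) : MatL2 (genMat μ s d R) :=
  GM.matL2_genMat μ s d S.matL2 S.season_pos

lemma matL2_dualMat (S : Setting μ s d f R) : MatL2 (dualMat μ s d R) := by
  intro i p
  have hmeas : AEStronglyMeasurable (fun t => dualMat μ s d R t i p) circ :=
    aestronglyMeasurable_inv (fun i j =>
      Complex.continuous_conj.comp_aestronglyMeasurable (S.matL2_genMat j i).1) i p
  rw [memLp_two_iff_integrable_sq_norm hmeas]
  refine S.minimality.2.norm.mono' (hmeas.norm.pow 2) ?_
  filter_upwards [S.spec.mul, S.ae_ratio_ne_zero, S.ae_isUnit] with t h1 h2 h3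
  have h4 : (((weight μ s d t : ℝ) : ℂ) • (f t)⁻¹).trace =
      ((∑ p, ∑ i, ‖dualMat μ s d R t i p‖ ^ 2 : ℝ) : ℂ) := by
    rw [← Matrix.trace_transpose, Matrix.transpose_smul,
      ← conjTranspose_dualMat_mul μ s d h1 h3 h2, Matrix.trace]
    push_cast
    refine Finset.sum_congr rfl fun p _ => ?_
    rw [Matrix.diag_apply, Matrix.mul_apply]
    refine Finset.sum_congr rfl fun i _ => ?_
    rw [Matrix.conjTranspose_apply, RCLike.star_def, mul_comm, Complex.mul_conj,
      Complex.normSq_eq_norm_sq]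
    push_cast
    rfl
  rw [h4, Complex.norm_real, Real.norm_of_nonneg (by positivity), Real.norm_of_nonneg (by positivity)]
  refine (Finset.single_le_sum (f := fun i => ‖dualMat μ s d R t i p‖ ^ 2)
    (fun k _ => by positivity) (Finset.mem_univ i)).trans ?_
  exact Finset.single_le_sum (f := fun p => ∑ i, ‖dualMat μ s d R t i p‖ ^ 2)
    (fun k _ => by positivity) (Finset.mem_univ p)

/-- The images of the generators `e^{iλk} χ_μ(e^{-iλ}) β(iλ)⁻¹ δ_p` of `L²(f)`. -/
def J (S : Setting μ s d f R) (k : ℤ) (p : Fin T) : VecL2 T := col S.matL2_genMat k p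

/-- The family biorthogonal to `J`. -/
def K (S : Setting μ s d f R) (k : ℤ) (p : Fin T) : VecL2 T := col S.matL2_dualMat k p

lemma inner_K_K (S : Setting μ s d f R) (j k : ℕ) (p q : Fin T) :
    Fcoef μ s d f j k p q = inner ℂ (S.K j p) (S.K k q) := by
  rw [K, K, inner_col_col]
  refine integral_congr_ae ?_
  filter_upwards [S.spec.mul, S.ae_ratio_ne_zero, S.ae_isUnit] with t h1 h2 h3
  rw [conjTranspose_dualMat_mul μ s d h1 h3 h2]
  simp [mul_assoc]

lemma inner_J_K (S : Setting μ s d f R) (j k : ℤ) (p q : Fin T) :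
    inner ℂ (S.J j p) (S.K k q) = if j = k ∧ p = q then 1 else 0 := by
  rw [J, K, inner_col_col]
  have h : ∫ t, ex (t * ((k : ℝ) - j)) * ((genMat μ s d R t)ᴴ * dualMat μ s d R t) p q ∂circ =
      ∫ t, ex (t * ((k - j : ℤ) : ℝ)) * (1 : Matrix (Fin T) (Fin T) ℂ) p q ∂circ := by
    refine integral_congr_ae ?_
    filter_upwards [S.ae_isUnit] with t h
    rw [conjTranspose_genMat_mul_dualMat μ s d h]
    push_cast
    rfl
  rw [h, integral_mul_const, integral_ex, Matrix.one_apply]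
  by_cases h1 : j = k <;> by_cases h2 : p = q <;> simp [h1, h2, sub_eq_zero, eq_comm]

lemma inner_K_J (S : Setting μ s d f R) (j k : ℤ) (p q : Fin T) :
    inner ℂ (S.K j p) (S.J k q) = if k = j ∧ q = p then 1 else 0 := by
  rw [← inner_conj_symm, S.inner_J_K]
  split_ifs <;> simp

lemma eq_zero_of_inner_J (S : Setting μ s d f R) {y : VecL2 T}
    (h : ∀ k p, inner ℂ (S.J k p) y = 0) : y = 0 :=
  eq_zero_of_inner_col S.matL2_genMat (N := dualMat μ s d R) (by
    filter_upwards [S.ae_isUnit] with t h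
    exact dualMat_mul_conjTranspose_genMat μ s d h) h

lemma eq_of_inner_K (S : Setting μ s d f R) {y y' : VecL2 T}
    (h : ∀ k p, inner ℂ (S.K k p) y = inner ℂ (S.K k p) y') : y = y' := by
  rw [← sub_eq_zero]
  refine eq_zero_of_inner_col S.matL2_dualMat (N := genMat μ s d R) (by
    filter_upwards [S.ae_isUnit] with t h
    exact genMat_mul_dualMat μ s d h) fun k p => ?_
  have := h k p
  rw [← sub_eq_zero, ← inner_sub_right] at this
  exact this

lemma eq_zero_of_inner (S : Setting μ s d f R) (z : VecL2 T)
    (h1 : ∀ k : ℤ, k < 0 → ∀ p, inner ℂ (S.J k p) z = 0)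
    (h2 : ∀ k : ℤ, 0 ≤ k → ∀ p, inner ℂ (S.K k p) z = 0) : z = 0 :=
  eq_zero_of_inner_past_future S.matL2_genMat S.matL2_dualMat (by
    filter_upwards [S.ae_isUnit] with t h
    exact genMat_mul_dualMat μ s d h) h1 h2

lemma memL2_of_memLp_top (S : Setting μ s d f R) {g : ℝ → Fin T → ℂ}
    (hg : ∀ p, MemLp (fun t => g t p) ⊤ circ) : MemL2 f g := by
  refine S.spec.memL2_of_memLp (aestronglyMeasurable_pi_iff.2 fun p => (hg p).1) ?_
  refine memLp_toLp_iff.2 fun i => ?_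
  change MemLp (fun t => ∑ p, R t p i * g t p) 2 circ
  exact memLp_finsetSum _ fun p _ => (hg p).mul' (S.matL2 p i)

lemma memL2_gen (S : Setting μ s d f R) (ν : Fin r → ℤ) (k : ℤ) (p : Fin T) :
    MemL2 f (gen ν s d k p) := by
  refine S.memL2_of_memLp_top fun q => ?_
  have h : (fun t => gen ν s d k p t q) =
      fun t => ex (t * k) • (ratio ν s d t * (Pi.single p 1 : Fin T → ℂ) q) := by
    ext t
    simp only [gen, ratio, Pi.smul_apply, smul_eq_mul]
    ring
  rw [h]
  exact memLp_ex_mul ((memLp_ratio ν s d S.season_pos ⊤).mul_const _) k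

lemma toH_gen (S : Setting μ s d f R) (k : ℤ) (p : Fin T) :
    S.spec.toH (S.memL2_gen (zstep μ) k p) = S.J k p := by
  rw [SpecFactor.toH, J, col]
  congr 1
  ext t i
  rw [lift_apply]
  simp [gen, genMat, ratio, Pi.single_apply]
  ring

/-- The matrix function `genMat` applied to a bounded function `g` gives the image of `(χ_μ / β) g`. -/
lemma lift_ratio_smul (g : ℝ → Fin T → ℂ) (t : ℝ) :
    lift R (fun t => ratio (zstep μ) s d t • g t) t =
      WithLp.toLp 2 (genMat μ s d R t *ᵥ g t) := by
  ext i
  rw [lift_apply]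
  simp only [genMat, Matrix.mulVec, dotProduct, Pi.smul_apply, smul_eq_mul]
  refine Finset.sum_congr rfl fun p _ => ?_
  simp
  ring

/-! ### The past subspace of `L²(f)` -/

lemma memL2Past_iff (S : Setting μ s d f R) {h : ℝ → Fin T → ℂ} (hh : MemL2 f h) :
    MemL2Past (zstep μ) s d f h ↔ S.spec.toH hh ∈ closedSpan S.J (Set.Iio 0) := by
  set G : Set (ℝ → Fin T → ℂ) := {g | ∃ k : ℤ, k ≤ -1 ∧ ∃ l : Fin T, g = gen (zstep μ) s d k l}
  set V : Submodule ℂ (VecL2 T) := Submodule.span ℂ {v | ∃ k ∈ Set.Iio (0 : ℤ), ∃ p, v = S.J k p}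
  have h1 : ∀ g ∈ Submodule.span ℂ G, ∃ hg : MemL2 f g, S.spec.toH hg ∈ V := by
    intro g hg
    have hle : Submodule.span ℂ G ≤ S.spec.comap V := by
      rw [Submodule.span_le]
      rintro _ ⟨k, hk, l, rfl⟩
      refine ⟨S.memL2_gen _ k l, ?_⟩
      rw [S.toH_gen]
      exact Submodule.subset_span ⟨k, Set.mem_Iio.2 (by omega), l, rfl⟩
    exact hle hg
  have h2 : ∀ v ∈ V, ∃ g ∈ Submodule.span ℂ G, ∃ hg : MemL2 f g, S.spec.toH hg = v := by
    intro v hv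
    induction hv using Submodule.span_induction with
    | mem x hx =>
      obtain ⟨k, hk, p, rfl⟩ := hx
      rw [Set.mem_Iio] at hk
      exact ⟨_, Submodule.subset_span ⟨k, by omega, p, rfl⟩, S.memL2_gen _ k p, S.toH_gen k p⟩
    | zero => exact ⟨0, Submodule.zero_mem _, S.spec.memL2_zero, S.spec.toH_zero⟩
    | add x y _ _ hx hy =>
      obtain ⟨g, hg, hg', rfl⟩ := hx
      obtain ⟨g₂, hg₂, hg₂', rfl⟩ := hy
      exact ⟨g + g₂, Submodule.add_mem _ hg hg₂, S.spec.memL2_add hg' hg₂', S.spec.toH_add _ _⟩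
    | smul c x _ hx =>
      obtain ⟨g, hg, hg', rfl⟩ := hx
      exact ⟨c • g, Submodule.smul_mem _ c hg, S.spec.memL2_smul hg' c, S.spec.toH_smul _ c⟩
  have h3 : S.spec.toH hh ∈ closedSpan S.J (Set.Iio 0) ↔
      ∀ ε > 0, ∃ v ∈ V, dist (S.spec.toH hh) v < ε := by
    rw [closedSpan, ← SetLike.mem_coe, Submodule.topologicalClosure_coe, Metric.mem_closure_iff]
    rfl
  rw [h3]
  constructor
  · rintro ⟨-, h⟩ ε hε
    obtain ⟨g, hg, hlt⟩ := h (ENNReal.ofReal (ε ^ 2)) (by simp; positivity)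
    obtain ⟨hg', hV⟩ := h1 g hg
    refine ⟨_, hV, ?_⟩
    rw [S.spec.specNormSq_sub_eq hh hg', ENNReal.ofReal_lt_ofReal_iff (by positivity)] at hlt
    rw [dist_eq_norm]
    exact lt_of_pow_lt_pow_left₀ 2 hε.le hlt
  · intro h
    refine ⟨hh, fun ε hε => ?_⟩
    obtain ⟨δ, hδ, hδε⟩ : ∃ δ : ℝ, 0 < δ ∧ ENNReal.ofReal (δ ^ 2) ≤ ε := by
      rcases eq_or_ne ε ⊤ with rfl | htop
      · exact ⟨1, one_pos, le_top⟩
      · refine ⟨√ε.toReal, Real.sqrt_pos.2 (ENNReal.toReal_pos hε.ne' htop), ?_⟩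
        rw [Real.sq_sqrt ENNReal.toReal_nonneg, ENNReal.ofReal_toReal htop]
    obtain ⟨v, hv, hlt⟩ := h δ hδ
    obtain ⟨g, hg, hg', rfl⟩ := h2 v hv
    refine ⟨g, hg, lt_of_lt_of_le ?_ hδε⟩
    rw [S.spec.specNormSq_sub_eq hh hg', ENNReal.ofReal_lt_ofReal_iff (by positivity),
      ← dist_eq_norm]
    exact pow_lt_pow_left₀ hlt dist_nonneg (by norm_num)

end Setting

/-! ### The projection on the past -/

lemma norm_apply_le_eucl {T : ℕ} (x : Fin T → ℂ) (p : Fin T) : ‖x p‖ ≤ eucl x :=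
  PiLp.norm_apply_le (WithLp.toLp 2 x) p

lemma eucl_nonneg {T : ℕ} (x : Fin T → ℂ) : 0 ≤ eucl x := norm_nonneg _

lemma eucl_sq {T : ℕ} (x : Fin T → ℂ) : eucl x ^ 2 = ∑ p, ‖x p‖ ^ 2 := by
  rw [eucl, EuclideanSpace.norm_sq_eq]

lemma norm_le_eucl {T : ℕ} (x : Fin T → ℂ) : ‖x‖ ≤ eucl x :=
  (pi_norm_le_iff_of_nonneg (eucl_nonneg x)).2 (norm_apply_le_eucl x)

/-- The sum `∑ b(k) e^{ikt}` of an absolutely convergent trigonometric series. -/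
def trigSum {T : ℕ} (b : ℕ → Fin T → ℂ) (t : ℝ) : Fin T → ℂ := ∑' k : ℕ, ex (t * k) • b k

section TrigSum

variable {T : ℕ} {b : ℕ → Fin T → ℂ}

lemma hasSum_trigSum (hb : Summable fun k => eucl (b k)) (t : ℝ) :
    HasSum (fun k : ℕ => ex (t * k) • b k) (trigSum b t) := by
  refine Summable.hasSum (Summable.of_norm_bounded hb fun k => ?_)
  rw [norm_smul, norm_ex, one_mul]
  exact norm_le_eucl _

lemma continuous_trigSum (hb : Summable fun k => eucl (b k)) : Continuous (trigSum b) := by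
  refine continuous_tsum (fun k => ?_) hb fun k t => ?_
  · exact (continuous_ex.comp (by fun_prop)).smul continuous_const
  · rw [norm_smul, norm_ex, one_mul]
    exact norm_le_eucl _

lemma norm_trigSum_le (hb : Summable fun k => eucl (b k)) (t : ℝ) :
    ‖trigSum b t‖ ≤ ∑' k, eucl (b k) := by
  refine tsum_of_norm_bounded hb.hasSum fun k => ?_
  rw [norm_smul, norm_ex, one_mul]
  exact norm_le_eucl _

lemma memLp_trigSum (hb : Summable fun k => eucl (b k)) (p : Fin T) (q : ℝ≥0∞) :
    MemLp (fun t => trigSum b t p) q circ :=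
  MemLp.of_bound ((continuous_apply p).comp (continuous_trigSum hb)).aestronglyMeasurable
    (∑' k, eucl (b k)) (Eventually.of_forall fun t =>
      (norm_le_pi_norm _ p).trans (norm_trigSum_le hb t))

lemma integral_ex_mul_trigSum (hb : Summable fun k => eucl (b k)) (j : ℤ) (p : Fin T) :
    ∫ t, ex (-(t * j)) * trigSum b t p ∂circ = if 0 ≤ j then b j.toNat p else 0 := by
  have hsum : ∀ t, HasSum (fun k : ℕ => ex (-(t * j)) * (ex (t * k) * b k p))
      (ex (-(t * j)) * trigSum b t p) := fun t =>
    ((Pi.hasSum.1 (hasSum_trigSum hb t)) p).mul_left _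
  have hterm : ∀ (k : ℕ) (t : ℝ), ex (-(t * j)) * (ex (t * k) * b k p) =
      ex (t * ((k - j : ℤ) : ℝ)) * b k p := by
    intro k t
    rw [← mul_assoc, ← ex_add]
    congr 2
    push_cast
    ring
  have hint : ∀ k : ℕ, Integrable (fun t => ex (-(t * j)) * (ex (t * k) * b k p)) circ := by
    intro k
    simp_rw [hterm k]
    exact ((memLp_ex _ 1).integrable le_rfl).mul_const _
  have h := hasSum_integral_of_summable_integral_norm hint (by
    refine hb.of_nonneg_of_le (fun k => by positivity) fun k => ?_
    simp only [norm_mul, norm_ex, one_mul]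
    rw [integral_const]
    simpa using norm_apply_le_eucl (b k) p)
  simp_rw [fun t => (hsum t).tsum_eq, hterm, integral_mul_const, integral_ex] at h
  refine h.unique ?_
  split_ifs with hj
  · have h1 := hasSum_single (f := fun k : ℕ => (if (k : ℤ) - j = 0 then (1 : ℂ) else 0) * b k p)
      j.toNat fun k hk => by rw [if_neg (by omega), zero_mul]
    simpa [Int.toNat_of_nonneg hj] using h1
  · have h0 : ∀ k : ℕ, (if (k : ℤ) - j = 0 then (1 : ℂ) else 0) * b k p = 0 := fun k => by
      rw [if_neg (by omega), zero_mul]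
    simp_rw [h0]
    exact hasSum_zero

end TrigSum

namespace Setting

variable {r T : ℕ} {μ s d : Fin r → ℕ} {f R : ℝ → Matrix (Fin T) (Fin T) ℂ}

lemma memL2_ratio_smul (S : Setting μ s d f R) {g : ℝ → Fin T → ℂ}
    (hg : ∀ p, MemLp (fun t => g t p) ⊤ circ) :
    MemL2 f fun t => ratio (zstep μ) s d t • g t :=
  S.memL2_of_memLp_top fun p => (hg p).mul' (memLp_ratio _ s d S.season_pos ⊤)

/-- The inner products with `K` are the Fourier coefficients of `g` for the image of
`(χ_μ / β) g`. -/
lemma inner_K_toH (S : Setting μ s d f R) {g : ℝ → Fin T → ℂ}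
    (hg : MemL2 f fun t => ratio (zstep μ) s d t • g t) (j : ℤ) (p : Fin T) :
    inner ℂ (S.K j p) (S.spec.toH hg) = ∫ t, ex (-(t * j)) * g t p ∂circ := by
  rw [K, inner_col]
  refine integral_congr_ae ?_
  filter_upwards [S.spec.coeFn_toH hg, S.ae_isUnit] with t h1 h2
  rw [adj, h1, lift_ratio_smul, Matrix.mulVec_mulVec,
    mul_eq_one_comm.1 (genMat_mul_dualMat μ s d h2), Matrix.one_mulVec]

lemma norm_J (S : Setting μ s d f R) (k : ℤ) (p : Fin T) : ‖S.J k p‖ = ‖S.J 0 p‖ := by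
  have h : ‖S.J k p‖ ^ 2 = ‖S.J 0 p‖ ^ 2 := by
    rw [J, J, col, col, norm_toLp_sq, norm_toLp_sq]
    refine integral_congr_ae (Eventually.of_forall fun t => ?_)
    simp [EuclideanSpace.norm_sq_eq]
  exact (pow_left_inj₀ (norm_nonneg _) (norm_nonneg _) two_ne_zero).1 h

lemma memL2_trigSum (S : Setting μ s d f R) {b : ℕ → Fin T → ℂ}
    (hb : Summable fun k => eucl (b k)) : MemL2 f fun t => ratio (zstep μ) s d t • trigSum b t :=
  S.memL2_ratio_smul fun p => memLp_trigSum hb p ⊤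

lemma inner_K_trigSum (S : Setting μ s d f R) {b : ℕ → Fin T → ℂ}
    (hb : Summable fun k => eucl (b k)) (j : ℤ) (p : Fin T) :
    inner ℂ (S.K j p) (S.spec.toH (S.memL2_trigSum hb)) = if 0 ≤ j then b j.toNat p else 0 := by
  rw [inner_K_toH, integral_ex_mul_trigSum hb]

lemma hasSum_J (S : Setting μ s d f R) {b : ℕ → Fin T → ℂ} (hb : Summable fun k => eucl (b k)) :
    HasSum (fun k : ℕ => ∑ p, b k p • S.J k p) (S.spec.toH (S.memL2_trigSum hb)) := by
  have hs : Summable fun k : ℕ => ∑ p, b k p • S.J k p := by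
    refine Summable.of_norm_bounded (hb.mul_right (∑ p, ‖S.J 0 p‖)) fun k => ?_
    refine (norm_sum_le _ _).trans ?_
    rw [Finset.mul_sum]
    refine Finset.sum_le_sum fun p _ => ?_
    rw [norm_smul, S.norm_J]
    exact mul_le_mul_of_nonneg_right (norm_apply_le_eucl _ p) (norm_nonneg _)
  have : ∑' k : ℕ, ∑ p, b k p • S.J k p = S.spec.toH (S.memL2_trigSum hb) := by
    refine S.eq_of_inner_K fun j p => ?_
    rw [S.inner_K_trigSum hb]
    have h := (innerSL ℂ (S.K j p)).hasSum hs.hasSum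
    simp only [innerSL_apply_apply, inner_sum, inner_smul_right, S.inner_K_J] at h
    refine h.unique ?_
    split_ifs with hj
    · have h1 := hasSum_single (f := fun k : ℕ => ∑ q, b k q *
          if (k : ℤ) = j ∧ q = p then (1 : ℂ) else 0) j.toNat fun k hk =>
        Finset.sum_eq_zero fun q _ => by rw [if_neg (by omega), mul_zero]
      simpa [Int.toNat_of_nonneg hj] using h1
    · have h0 : ∀ k : ℕ, (∑ q, b k q * if (k : ℤ) = j ∧ q = p then (1 : ℂ) else 0) = 0 :=
        fun k => Finset.sum_eq_zero fun q _ => by rw [if_neg (by omega), mul_zero]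
      simp_rw [h0]
      exact hasSum_zero
  rw [← this]
  exact hs.hasSum

lemma memL2_Bchi (S : Setting μ s d f R) {a : ℕ → Fin T → ℂ}
    (hb : Summable fun k => eucl (Dop μ s d a k)) : MemL2 f (Bchi μ s d a) :=
  S.memL2_trigSum hb

variable {y : VecL2 T}

lemma adj_genMat_isFourierSum (S : Setting μ s d f R) (hy : y ∈ closedSpan S.K (Set.Ici 0)) :
    IsFourierSum (adj (genMat μ s d R) y) fun k p => inner ℂ (S.J k p) y := by
  have hint : Integrable (adj (genMat μ s d R) y) circ :=
    Integrable.of_eval fun p => integrable_adj S.matL2_genMat y p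
  refine ⟨hint, fun k => ?_, fun k => ?_⟩
  · ext p
    have h2 : Integrable (fun t => ex (-(t * (k : ℝ))) • adj (genMat μ s d R) y t) circ := by
      have := integrable_ex_mul hint (-(k : ℝ))
      simpa using this
    change _ = inner ℂ (S.J k p) y
    rw [eval_integral fun q => h2.eval q, J, inner_col]
    simp
  · ext p
    rw [eval_integral fun q => (integrable_ex_mul hint _).eval q]
    have h : inner ℂ (S.J (-((k : ℤ) + 1)) p) y = 0 := by
      refine inner_eq_zero_of_mem_closedSpan (fun j hj q => ?_) hy
      rw [S.inner_J_K, if_neg]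
      rintro ⟨h, -⟩
      have : (0 : ℤ) ≤ j := hj
      omega
    rw [J, inner_col] at h
    rw [Pi.zero_apply, ← h]
    refine integral_congr_ae (Eventually.of_forall fun t => ?_)
    simp only [Pi.smul_apply, smul_eq_mul]
    congr 2
    push_cast
    ring

/-- Subtracting the second term in the definition of `h` amounts to subtracting `y`, if `C` is
the function of `y`. -/
lemma lift_hChar (S : Setting μ s d f R) (a : ℕ → Fin T → ℂ)
    (hb : Summable fun k => eucl (Dop μ s d a k)) (y : VecL2 T) :
    lift R (hChar μ s d f a (adj (genMat μ s d R) y)) =ᵐ[circ]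
      ((S.spec.toH (S.memL2_Bchi hb) - y : VecL2 T) : ℝ → EuclideanSpace ℂ (Fin T)) := by
  filter_upwards [Lp.coeFn_sub (S.spec.toH (S.memL2_Bchi hb)) y, S.spec.coeFn_toH (S.memL2_Bchi hb),
    S.spec.mul, S.ae_ratio_ne_zero, S.minimality.1] with t h1 h2 h3 h4 h5
  rw [h1, Pi.sub_apply, h2]
  set C := adj (genMat μ s d R) y
  have hR : IsUnit (R t).det := by
    rw [← h3, Matrix.det_mul] at h5
    exact isUnit_of_mul_isUnit_left h5
  have hc : conj (beta s d t) / chi (zstep μ) s d (ex t) = (conj (ratio (zstep μ) s d t))⁻¹ := by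
    have h := conj_chi (zstep μ) s d (-t)
    rw [neg_neg] at h
    rw [ratio, map_div₀, h, inv_div]
  have hC : (conj (ratio (zstep μ) s d t))⁻¹ • (C t ᵥ* (f t)⁻¹) =
      (R t)ᵀ⁻¹ *ᵥ (y t).ofLp := by
    have h6 : C t = conj (ratio (zstep μ) s d t) • ((y t).ofLp ᵥ* (R t)ᴴ) := by
      simp only [C, adj, genMat]
      rw [← Matrix.mulVec_transpose, ← Matrix.smul_mulVec]
      congr 1
      ext i j
      simp
    rw [h6, Matrix.smul_vecMul, smul_smul, inv_mul_cancel₀ (by simpa using h4), one_smul,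
      Matrix.vecMul_vecMul, ← h3, Matrix.mul_inv_rev, ← Matrix.mul_assoc,
      Matrix.mul_nonsing_inv _ (by rw [Matrix.det_conjTranspose]; exact hR.star), Matrix.one_mul,
      ← Matrix.mulVec_transpose, Matrix.transpose_nonsing_inv]
  have h7 : (R t)ᵀ *ᵥ ((R t)ᵀ⁻¹ *ᵥ (y t).ofLp) = (y t).ofLp := by
    rw [Matrix.mulVec_mulVec, Matrix.mul_nonsing_inv _ (by rwa [Matrix.det_transpose]),
      Matrix.one_mulVec]
  ext i
  simp only [lift, hChar]
  rw [hc, hC, Matrix.mulVec_sub, h7]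
  rfl

lemma weight_mul_eq (S : Setting μ s d f R) (y : VecL2 T) :
    (fun t => ((weight μ s d t : ℝ) : ℂ) * (adj (genMat μ s d R) y t ⬝ᵥ
      ((f t)⁻¹ *ᵥ star (adj (genMat μ s d R) y t)))) =ᵐ[circ] fun t => ((‖y t‖ ^ 2 : ℝ) : ℂ) := by
  filter_upwards [S.spec.mul, S.ae_ratio_ne_zero, S.ae_isUnit] with t h1 h2 h3
  set C := adj (genMat μ s d R) y t with hC
  have hN : dualMat μ s d R t *ᵥ C = (y t).ofLp := by
    rw [hC, adj, Matrix.mulVec_mulVec, dualMat_mul_conjTranspose_genMat μ s d h3, Matrix.one_mulVec]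
  have h4 : ((weight μ s d t : ℝ) : ℂ) * (C ⬝ᵥ ((f t)⁻¹ *ᵥ star C)) =
      star C ⬝ᵥ ((((weight μ s d t : ℝ) : ℂ) • ((f t)⁻¹)ᵀ) *ᵥ C) := by
    rw [Matrix.smul_mulVec, dotProduct_smul, smul_eq_mul, Matrix.mulVec_transpose,
      Matrix.dotProduct_mulVec, dotProduct_comm (star C)]
  rw [h4, ← conjTranspose_dualMat_mul μ s d h1 h3 h2, ← Matrix.mulVec_mulVec, hN,
    Matrix.dotProduct_mulVec, ← Matrix.star_mulVec, hN, EuclideanSpace.norm_sq_eq]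
  simp only [dotProduct, Pi.star_apply, RCLike.star_def]
  push_cast
  refine Finset.sum_congr rfl fun i _ => ?_
  rw [mul_comm, Complex.mul_conj, Complex.normSq_eq_norm_sq]
  push_cast
  rfl

end Setting

/-! ### Isometries and spectral integrals -/

/-- Two families with the same Gram matrix, the first of them total, are related by an isometry. -/
lemma exists_isometry {ι H K : Type*} [NormedAddCommGroup H] [InnerProductSpace ℂ H]
    [CompleteSpace H] [NormedAddCommGroup K] [InnerProductSpace ℂ K] [CompleteSpace K] {v : ι → H}
    {w : ι → K} (hG : ∀ i j, inner ℂ (w i) (w j) = inner ℂ (v i) (v j))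
    (htot : ∀ y, (∀ i, inner ℂ (v i) y = 0) → y = 0) :
    ∃ U : H →ₗᵢ[ℂ] K, ∀ i, U (v i) = w i := by
  set e := Finsupp.linearCombination ℂ v
  set g := Finsupp.linearCombination ℂ w
  have hnorm : ∀ x, ‖g x‖ = ‖e x‖ := by
    intro x
    have h : inner ℂ (g x) (g x) = inner ℂ (e x) (e x) := by
      simp only [e, g, Finsupp.linearCombination_apply, Finsupp.sum, sum_inner, inner_sum,
        inner_smul_left, inner_smul_right, hG]
    rw [inner_self_eq_norm_sq_to_K, inner_self_eq_norm_sq_to_K] at h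
    have h2 : ‖g x‖ ^ 2 = ‖e x‖ ^ 2 := by exact_mod_cast h
    exact (pow_left_inj₀ (norm_nonneg _) (norm_nonneg _) two_ne_zero).1 h2
  have hd : DenseRange e := by
    have h1 : (LinearMap.range e).topologicalClosure = ⊤ := by
      rw [Submodule.topologicalClosure_eq_top_iff, Submodule.eq_bot_iff]
      intro y hy
      refine htot y fun i => (Submodule.mem_orthogonal _ _).1 hy _ ?_
      exact ⟨Finsupp.single i 1, by simp [e]⟩
    have h2 := (Submodule.dense_iff_topologicalClosure_eq_top).2 h1
    exact h2
  have hC : ∃ C, ∀ x, ‖g x‖ ≤ C * ‖e x‖ := ⟨1, fun x => by rw [hnorm, one_mul]⟩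
  set U := g.extendOfNorm e
  have hU : ∀ x, U (e x) = g x := fun x => LinearMap.extendOfNorm_eq hd hC x
  have hiso : ∀ y, ‖U y‖ = ‖y‖ := by
    intro y
    refine hd.induction_on (p := fun y => ‖U y‖ = ‖y‖) y ?_ fun x => ?_
    · exact isClosed_eq (U.continuous.norm) continuous_norm
    · rw [hU, hnorm]
  refine ⟨⟨U, hiso⟩, fun i => ?_⟩
  have := hU (Finsupp.single i 1)
  simpa [e, g] using this

/-- A vector is the image of `y` under an isometry if it has the same norm and the same inner
products with the images of a total family. -/
lemma eq_map_of_inner_eq {ι H K : Type*} [NormedAddCommGroup H] [InnerProductSpace ℂ H]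
    [CompleteSpace H] [NormedAddCommGroup K] [InnerProductSpace ℂ K] [CompleteSpace K] {v : ι → H}
    (htot : ∀ y, (∀ i, inner ℂ (v i) y = 0) → y = 0) (U : H →ₗᵢ[ℂ] K) {x : K} {y : H}
    (h : ∀ i, inner ℂ (U (v i)) x = inner ℂ (v i) y) (hn : ‖x‖ = ‖y‖) : x = U y := by
  have h1 : (ContinuousLinearMap.adjoint U.toContinuousLinearMap) x = y := by
    rw [← sub_eq_zero]
    refine htot _ fun i => ?_
    rw [inner_sub_right, ContinuousLinearMap.adjoint_inner_right, ← h i]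
    exact sub_self _
  have h2 : inner ℂ (U y) x = inner ℂ y y := by
    have := ContinuousLinearMap.adjoint_inner_right U.toContinuousLinearMap y x
    rw [h1] at this
    exact this.symm
  rw [← sub_eq_zero, ← norm_eq_zero, ← sq_eq_zero_iff, @norm_sub_sq ℂ, ← inner_conj_symm, h2,
    inner_self_eq_norm_sq_to_K, U.norm_map, hn]
  have : RCLike.re (conj ((‖y‖ : ℂ) ^ 2)) = ‖y‖ ^ 2 := by
    rw [← Complex.ofReal_pow, Complex.conj_ofReal]
    exact Complex.ofReal_re _
  rw [RCLike.ofReal_eq_complex_ofReal, this]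
  ring

/-- The half-open interval that parametrizes the circle. -/
abbrev circIco : Set ℝ := Set.Ico (-Real.pi) Real.pi

lemma ae_circ_mem_Ico : ∀ᵐ t ∂circ, t ∈ circIco := by
  refine ae_circ_of_countable ?_
  convert Set.countable_empty (α := ℝ)
  ext t
  simp

/-- An integrable function on the circle is determined by its integrals over initial intervals. -/
lemma ae_eq_zero_of_setIntegral_Ico {F : ℝ → ℂ} (hF : Integrable F circ)
    (h : ∀ x ∈ circIco, ∫ t in Set.Ico (-Real.pi) x, F t ∂circ = 0) : F =ᵐ[circ] 0 := by
  have hpi := Real.pi_pos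
  have hIio : ∀ x, x < Real.pi → ∫ t in Set.Iio x, F t ∂circ = 0 := by
    intro x hx
    rcases lt_or_ge x (-Real.pi) with h1 | h1
    · rw [setIntegral_congr_set (t := ∅), setIntegral_empty]
      filter_upwards [ae_circ_mem_Ico] with t ht
      exact propext ⟨fun h2 : t < x => absurd ht.1 (not_le.2 (h2.trans h1)), fun h2 => h2.elim⟩
    · rw [← h x ⟨h1, hx⟩]
      refine setIntegral_congr_set ?_
      filter_upwards [ae_circ_mem_Ico] with t ht
      exact propext ⟨fun h2 : t < x => ⟨ht.1, h2⟩, fun h2 => h2.2⟩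
  -- the point `π` is not in the interval, so it is approached from the left
  have huniv : ∫ t, F t ∂circ = 0 := by
    have hmono : Monotone fun n : ℕ => Set.Iio (Real.pi - 1 / ((n : ℝ) + 1)) := by
      intro m n hmn
      refine Set.Iio_subset_Iio (sub_le_sub_left ?_ _)
      exact one_div_le_one_div_of_le (by positivity) (by
        have : (m : ℝ) ≤ n := by exact_mod_cast hmn
        linarith)
    have hU : ⋃ n : ℕ, Set.Iio (Real.pi - 1 / ((n : ℝ) + 1)) = Set.Iio Real.pi := by
      ext t
      simp only [Set.mem_iUnion, Set.mem_Iio]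
      constructor
      · rintro ⟨n, hn⟩
        have : (0 : ℝ) < 1 / ((n : ℝ) + 1) := by positivity
        linarith
      · intro ht
        obtain ⟨n, hn⟩ := exists_nat_one_div_lt (sub_pos.2 ht)
        exact ⟨n, by linarith⟩
    have hlim := tendsto_setIntegral_of_monotone (μ := circ) (f := F)
      (fun n => measurableSet_Iio) hmono hF.integrableOn
    rw [hU] at hlim
    have h0 : ∀ n : ℕ, ∫ t in Set.Iio (Real.pi - 1 / ((n : ℝ) + 1)), F t ∂circ = 0 := fun n =>
      hIio _ (by have : (0 : ℝ) < 1 / ((n : ℝ) + 1) := by positivity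
                 linarith)
    simp_rw [h0] at hlim
    rw [← setIntegral_univ (μ := circ) (f := F), tendsto_nhds_unique tendsto_const_nhds hlim]
    refine setIntegral_congr_set ?_
    filter_upwards [ae_circ_mem_Ico] with t ht
    exact propext ⟨fun _ => ht.2, fun _ => trivial⟩
  refine Integrable.ae_eq_zero_of_forall_setIntegral_eq_zero hF fun A hA _ => ?_
  induction A, hA using MeasurableSpace.induction_on_inter
    (BorelSpace.measurable_eq.trans (borel_eq_generateFrom_Iio ℝ)) isPiSystem_Iio with
  | empty => simp
  | basic A hA =>
    obtain ⟨x, rfl⟩ := hA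
    rcases lt_or_ge x Real.pi with hx | hx
    · exact hIio x hx
    · rw [← huniv, ← setIntegral_univ (μ := circ) (f := F)]
      refine setIntegral_congr_set ?_
      filter_upwards [ae_circ_mem_Ico] with t ht
      exact propext ⟨fun _ => trivial, fun _ => ht.2.trans_le hx⟩
  | compl A hA ih =>
    have := integral_add_compl hA hF
    rw [ih (measure_lt_top _ _), huniv, zero_add] at this
    exact this
  | iUnion A hdisj hA ih =>
    rw [integral_iUnion hA hdisj hF.integrableOn]
    simp [ih _ (measure_lt_top _ _)]

namespace Setting

variable {r T : ℕ} {μ s d : Fin r → ℕ} {f R : ℝ → Matrix (Fin T) (Fin T) ℂ}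

/-- The function `1_{[-π, x)} δ_p`. -/
def indFn (T : ℕ) (x : ℝ) (p : Fin T) : ℝ → Fin T → ℂ :=
  (Set.Ico (-Real.pi) x).indicator fun _ => Pi.single p 1

lemma memL2_indicator (S : Setting μ s d f R) {A : Set ℝ} (hA : MeasurableSet A) (c : Fin T → ℂ) :
    MemL2 f (A.indicator fun _ => c) := by
  refine S.memL2_of_memLp_top fun q => ?_
  have h : (fun t => A.indicator (fun _ => c) t q) = A.indicator fun _ => c q := by
    ext t
    by_cases ht : t ∈ A <;> simp [ht]
  rw [h]
  exact (memLp_const _).indicator hA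

/-- The image of `1_{[-π, x)} δ_p` in `VecL2 T`. -/
def ind (S : Setting μ s d f R) (x : ℝ) (p : Fin T) : VecL2 T :=
  S.spec.toH (S.memL2_indicator measurableSet_Ico (Pi.single p 1) : MemL2 f (indFn T x p))

lemma inner_ind (S : Setting μ s d f R) (x : ℝ) (p : Fin T) (y : VecL2 T) :
    inner ℂ (S.ind x p) y = ∫ t in Set.Ico (-Real.pi) x, adj (fun t => (R t)ᵀ) y t p ∂circ := by
  rw [L2.inner_def, ← integral_indicator measurableSet_Ico]
  refine integral_congr_ae ?_
  filter_upwards [S.spec.coeFn_toH (S.memL2_indicator measurableSet_Ico (Pi.single p 1) :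
    MemL2 f (indFn T x p))] with t ht
  rw [ind, ht, PiLp.inner_apply]
  by_cases h : t ∈ Set.Ico (-Real.pi) x
  · rw [Set.indicator_of_mem h, adj_apply]
    refine Finset.sum_congr rfl fun i _ => ?_
    rw [lift_apply, Set.indicator_of_mem h]
    simp [Pi.single_apply, RCLike.inner_apply, mul_comm]
  · rw [Set.indicator_of_notMem h]
    refine Finset.sum_eq_zero fun i _ => ?_
    rw [lift_apply, Set.indicator_of_notMem h]
    simp

lemma eq_zero_of_inner_ind (S : Setting μ s d f R) {y : VecL2 T}
    (h : ∀ i : circIco × Fin T, inner ℂ (S.ind i.1 i.2) y = 0) : y = 0 := by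
  have hM : MatL2 fun t => (R t)ᵀ := fun i j => S.matL2 j i
  have h1 : ∀ p, (fun t => adj (fun t => (R t)ᵀ) y t p) =ᵐ[circ] 0 := fun p =>
    ae_eq_zero_of_setIntegral_Ico (integrable_adj hM y p) fun x hx => by
      rw [← S.inner_ind]
      exact h (⟨x, hx⟩, p)
  rw [Lp.eq_zero_iff_ae_eq_zero]
  filter_upwards [ae_all_iff.2 h1, S.spec.mul, S.minimality.1] with t h2 h3 h4
  have h5 : (R t)ᵀᴴ *ᵥ (y t).ofLp = 0 := funext fun p => h2 p
  rw [← h3, Matrix.det_mul] at h4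
  have h6 : IsUnit (R t)ᵀᴴ.det := by
    rw [Matrix.det_conjTranspose, Matrix.det_transpose]
    exact (isUnit_of_mul_isUnit_left h4).star
  have h7 : (y t).ofLp = 0 := by
    rw [← Matrix.one_mulVec (y t).ofLp, ← Matrix.nonsing_inv_mul _ h6, ← Matrix.mulVec_mulVec, h5,
      Matrix.mulVec_zero]
  ext i
  simpa using congrFun h7 i

lemma inner_ind_ind (S : Setting μ s d f R) (x y : ℝ) (p q : Fin T) :
    inner ℂ (S.ind y q) (S.ind x p) = ∫ t in Set.Ico (-Real.pi) (min x y), f t p q ∂circ := by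
  rw [ind, ind, ← S.spec.specInner_eq, specInner, ← integral_indicator measurableSet_Ico]
  refine integral_congr_ae (Eventually.of_forall fun t => ?_)
  simp only [Set.indicator_apply, Set.mem_Ico, lt_min_iff]
  by_cases h1 : -Real.pi ≤ t <;> by_cases h2 : t < x <;> by_cases h3 : t < y <;>
    simp [h1, h2, h3]

end Setting

/-! ### Step functions -/

section Sum

variable {T : ℕ} {f R : ℝ → Matrix (Fin T) (Fin T) ℂ}

lemma SpecFactor.memL2_sum (hR : SpecFactor f R) {ι : Type*} (A : Finset ι)
    {g : ι → ℝ → Fin T → ℂ} (hg : ∀ i, MemL2 f (g i)) : MemL2 f (∑ i ∈ A, g i) := by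
  classical
  induction A using Finset.induction_on with
  | empty => simpa using hR.memL2_zero
  | insert i A hi ih =>
    rw [Finset.sum_insert hi]
    exact hR.memL2_add (hg i) ih

lemma SpecFactor.toH_sum (hR : SpecFactor f R) {ι : Type*} (A : Finset ι)
    {g : ι → ℝ → Fin T → ℂ} (hg : ∀ i, MemL2 f (g i)) (h : MemL2 f (∑ i ∈ A, g i)) :
    hR.toH h = ∑ i ∈ A, hR.toH (hg i) := by
  classical
  induction A using Finset.induction_on with
  | empty => exact hR.toH_zero
  | insert i A hi ih =>
    have h2 := hR.toH_add (hg i) (hR.memL2_sum A hg)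
    rw [ih] at h2
    simp_rw [Finset.sum_insert hi]
    exact h2

end Sum

/-- The sum of two step functions. -/
def StepFn.append {T : ℕ} (S S' : StepFn T) : StepFn T where
  n := S.n + S'.n
  lo := Fin.append S.lo S'.lo
  hi := Fin.append S.hi S'.hi
  coef := Fin.append S.coef S'.coef
  mem i := by
    refine Fin.addCases (fun i => ?_) (fun i => ?_) i
    · simpa only [Fin.append_left] using S.mem i
    · simpa only [Fin.append_right] using S'.mem i

lemma ae_toLp_sub_eq {α : Type*} [MeasurableSpace α] {P : Measure α} {F : α → ℂ} {Y : Lp ℂ 2 P}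
    (hF : MemLp F 2 P) (h : (Y : α → ℂ) =ᵐ[P] F) : Y = hF.toLp F :=
  Lp.ext (h.trans hF.coeFn_toLp.symm)

namespace Setting

variable {r T : ℕ} {μ s d : Fin r → ℕ} {f R : ℝ → Matrix (Fin T) (Fin T) ℂ}

lemma toH_indicator (S : Setting μ s d f R) {x y : ℝ} (hx : -Real.pi ≤ x) (hxy : x ≤ y)
    (c : Fin T → ℂ) :
    S.spec.toH (S.memL2_indicator (measurableSet_Ico (a := x) (b := y)) c) =
      ∑ p, c p • (S.ind y p - S.ind x p) := by
  have h1 : ((Set.Ico x y).indicator fun _ => c : ℝ → Fin T → ℂ) =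
      ∑ p, c p • (indFn T y p - indFn T x p) := by
    ext t q
    simp only [Finset.sum_apply, Pi.smul_apply, Pi.sub_apply, smul_eq_mul, indFn,
      Set.indicator_apply, Set.mem_Ico]
    by_cases h1 : x ≤ t
    · by_cases h2 : t < y
      · simp [h1, h2, h1.not_gt, hx.trans h1, Pi.single_apply]
      · simp [h1, h2, h1.not_gt]
    · have h2 := not_le.1 h1
      simp [h1, h2, h2.trans_le hxy]
  have hi : ∀ x p, MemL2 f (indFn T x p) := fun x p => S.memL2_indicator measurableSet_Ico _
  have hm : ∀ p, MemL2 f (c p • (indFn T y p - indFn T x p)) := fun p =>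
    S.spec.memL2_smul (S.spec.memL2_sub (hi y p) (hi x p)) _
  have h2 := S.spec.toH_sum Finset.univ hm (S.spec.memL2_sum _ hm)
  simp_rw [h1]
  rw [h2]
  refine Finset.sum_congr rfl fun p _ => ?_
  rw [S.spec.toH_smul (S.spec.memL2_sub (hi y p) (hi x p)), S.spec.toH_sub (hi y p) (hi x p)]
  rfl

lemma stepFn_toFun_eq (F : StepFn T) :
    F.toFun = ∑ i, (Set.Ico (F.lo i) (F.hi i)).indicator fun _ => F.coef i := by
  ext t q
  simp [StepFn.toFun]

lemma memL2_stepFn (S : Setting μ s d f R) (F : StepFn T) : MemL2 f F.toFun := by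
  rw [stepFn_toFun_eq]
  exact S.spec.memL2_sum _ fun i => S.memL2_indicator measurableSet_Ico _

lemma toH_stepFn (S : Setting μ s d f R) (F : StepFn T) : S.spec.toH (S.memL2_stepFn F) =
    ∑ i, ∑ p, F.coef i p • (S.ind (F.hi i) p - S.ind (F.lo i) p) := by
  have hm : ∀ i, MemL2 f ((Set.Ico (F.lo i) (F.hi i)).indicator fun _ => F.coef i) := fun i =>
    S.memL2_indicator measurableSet_Ico _
  have h := S.spec.toH_sum Finset.univ hm (S.spec.memL2_sum _ hm)
  simp_rw [stepFn_toFun_eq F]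
  rw [h]
  exact Finset.sum_congr rfl fun i _ => S.toH_indicator (F.mem i).1.1 (F.mem i).2.2 _

lemma exists_stepFn_of_mem_span (S : Setting μ s d f R) {y : VecL2 T}
    (hy : y ∈ Submodule.span ℂ (Set.range fun i : circIco × Fin T => S.ind i.1 i.2)) :
    ∃ F : StepFn T, S.spec.toH (S.memL2_stepFn F) = y := by
  have hpi := Real.pi_pos
  induction hy using Submodule.span_induction with
  | mem x hx =>
    obtain ⟨⟨⟨x, hx⟩, p⟩, rfl⟩ := hx
    refine ⟨⟨1, fun _ => -Real.pi, fun _ => x, fun _ => Pi.single p 1, fun _ =>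
      ⟨⟨le_rfl, by linarith⟩, hx, hx.1⟩⟩, ?_⟩
    have h0 : ∀ q, S.ind (-Real.pi) q = 0 := fun q => by
      have h := S.inner_ind_ind (-Real.pi) (-Real.pi) q q
      simpa using h
    rw [S.toH_stepFn]
    simp [h0, Pi.single_apply]
  | zero =>
    refine ⟨⟨0, Fin.elim0, Fin.elim0, Fin.elim0, fun i => i.elim0⟩, ?_⟩
    rw [S.toH_stepFn]
    rfl
  | add x y _ _ hx hy =>
    obtain ⟨F, rfl⟩ := hx
    obtain ⟨F', rfl⟩ := hy
    refine ⟨F.append F', ?_⟩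
    rw [S.toH_stepFn, S.toH_stepFn, S.toH_stepFn]
    change ∑ i : Fin (F.n + F'.n), _ = _
    rw [Fin.sum_univ_add]
    simp [StepFn.append]
  | smul c x _ hx =>
    obtain ⟨F, rfl⟩ := hx
    refine ⟨⟨F.n, F.lo, F.hi, c • F.coef, F.mem⟩, ?_⟩
    rw [S.toH_stepFn, S.toH_stepFn, Finset.smul_sum]
    refine Finset.sum_congr rfl fun i _ => ?_
    rw [Finset.smul_sum]
    exact Finset.sum_congr rfl fun p _ => by simp [mul_smul]

lemma exists_stepFn_tendsto (S : Setting μ s d f R) (y : VecL2 T) :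
    ∃ F : ℕ → StepFn T, Tendsto (fun n => S.spec.toH (S.memL2_stepFn (F n))) atTop (𝓝 y) := by
  have h1 : (Submodule.span ℂ (Set.range fun i : circIco × Fin T =>
      S.ind i.1 i.2)).topologicalClosure = ⊤ := by
    rw [Submodule.topologicalClosure_eq_top_iff, Submodule.eq_bot_iff]
    intro z hz
    refine S.eq_zero_of_inner_ind fun i => ?_
    exact (Submodule.mem_orthogonal _ _).1 hz _ (Submodule.subset_span ⟨i, rfl⟩)
  have h2 : y ∈ closure (Submodule.span ℂ (Set.range fun i : circIco × Fin T =>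
      S.ind i.1 i.2) : Set (VecL2 T)) := by
    rw [← Submodule.topologicalClosure_coe, h1]
    trivial
  obtain ⟨v, hv, hlim⟩ := mem_closure_iff_seq_limit.1 h2
  choose F hF using fun n => S.exists_stepFn_of_mem_span (hv n)
  exact ⟨F, by simpa only [hF] using hlim⟩

variable {Ω : Type*} [MeasurableSpace Ω] {P : Measure Ω}

section Integral

variable {U : VecL2 T →ₗᵢ[ℂ] Lp ℂ 2 P} {Z : ℝ → Fin T → Ω → ℂ}

lemma integral_stepFn (S : Setting μ s d f R)
    (hZ : ∀ x ∈ circIco, ∀ p, (U (S.ind x p) : Ω → ℂ) =ᵐ[P] Z x p - Z (-Real.pi) p)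
    (F : StepFn T) : (U (S.spec.toH (S.memL2_stepFn F)) : Ω → ℂ) =ᵐ[P] F.integral Z := by
  rw [S.toH_stepFn, map_sum]
  simp only [map_sum, map_smul, map_sub]
  have h1 : ∀ i : Fin F.n, ∀ p : Fin T,
      ((F.coef i p • (U (S.ind (F.hi i) p) - U (S.ind (F.lo i) p)) : Lp ℂ 2 P) : Ω → ℂ) =ᵐ[P]
        fun ω => F.coef i p * (Z (F.hi i) p ω - Z (F.lo i) p ω) := by
    intro i p
    filter_upwards [Lp.coeFn_smul (F.coef i p) (U (S.ind (F.hi i) p) - U (S.ind (F.lo i) p)),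
      Lp.coeFn_sub (U (S.ind (F.hi i) p)) (U (S.ind (F.lo i) p)), hZ _ (F.mem i).2.1 p,
      hZ _ (F.mem i).1 p] with ω h1 h2 h3 h4
    rw [h1, Pi.smul_apply, h2, Pi.sub_apply, h3, h4, Pi.sub_apply, Pi.sub_apply, smul_eq_mul]
    ring
  have h2 : ∀ i : Fin F.n, (((∑ p, F.coef i p • (U (S.ind (F.hi i) p) - U (S.ind (F.lo i) p)) :
      Lp ℂ 2 P)) : Ω → ℂ) =ᵐ[P] fun ω => ∑ p, F.coef i p * (Z (F.hi i) p ω - Z (F.lo i) p ω) := by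
    intro i
    filter_upwards [Lp.coeFn_finsetSum Finset.univ
      (fun p => F.coef i p • (U (S.ind (F.hi i) p) - U (S.ind (F.lo i) p))),
      ae_all_iff.2 (h1 i)] with ω h3 h4
    rw [h3, Finset.sum_apply]
    exact Finset.sum_congr rfl fun p _ => h4 p
  filter_upwards [Lp.coeFn_finsetSum Finset.univ
    (fun i => ∑ p, F.coef i p • (U (S.ind (F.hi i) p) - U (S.ind (F.lo i) p))),
    ae_all_iff.2 h2] with ω h3 h4
  rw [h3, Finset.sum_apply]
  exact Finset.sum_congr rfl fun p _ => h4 p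

lemma isSpectralIntegral_iff (S : Setting μ s d f R)
    (hZ : ∀ x ∈ circIco, ∀ p, (U (S.ind x p) : Ω → ℂ) =ᵐ[P] Z x p - Z (-Real.pi) p)
    {h : ℝ → Fin T → ℂ} (hh : MemL2 f h) {X : Ω → ℂ} :
    IsSpectralIntegral P f Z h X ↔ X =ᵐ[P] U (S.spec.toH hh) := by
  have key : ∀ (F : ℕ → StepFn T) (hX : MemLp X 2 P),
      Tendsto (fun n => eLpNorm ((F n).integral Z - X) 2 P) atTop (𝓝 0) ↔
        Tendsto (fun n => U (S.spec.toH (S.memL2_stepFn (F n)))) atTop (𝓝 (hX.toLp X)) := by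
    intro F hX
    rw [Lp.tendsto_Lp_iff_tendsto_eLpNorm']
    refine tendsto_congr fun n => eLpNorm_congr_ae ?_
    filter_upwards [S.integral_stepFn hZ (F n), hX.coeFn_toLp] with ω h1 h2
    simp [h1, h2]
  constructor
  · rintro ⟨-, hX, F, h1, h2⟩
    rw [key F hX] at h2
    rw [S.spec.tendsto_specNormSq_iff hh fun n => S.memL2_stepFn (F n)] at h1
    have h3 := (U.continuous.tendsto _).comp h1
    rw [← tendsto_nhds_unique h2 h3]
    exact hX.coeFn_toLp.symm
  · intro h1
    have hX : MemLp X 2 P := (Lp.memLp _).ae_eq h1.symm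
    obtain ⟨F, hF⟩ := S.exists_stepFn_tendsto (S.spec.toH hh)
    refine ⟨hh, hX, F, (S.spec.tendsto_specNormSq_iff hh fun n => S.memL2_stepFn (F n)).2 hF, ?_⟩
    rw [key F hX, ← ae_toLp_sub_eq hX h1.symm]
    exact (U.continuous.tendsto _).comp hF

end Integral

end Setting

/-! ### The spectral representation -/

section Prob

variable {r T : ℕ} {μ s d : Fin r → ℕ} {f R : ℝ → Matrix (Fin T) (Fin T) ℂ}
  {Ω : Type*} [MeasurableSpace Ω] {P : Measure Ω} {ξ : ℤ → Fin T → Ω → ℂ}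

/-- The increments as elements of `L²(P)`. -/
def incLp (hξ : StationaryGM P s d ξ) {ν : Fin r → ℤ} (hν : AdmissibleStep ν) (m : ℤ) (p : Fin T) :
    Lp ℂ 2 P := (hξ.memLp ν hν m p).toLp _

lemma coeFn_incLp (hξ : StationaryGM P s d ξ) {ν : Fin r → ℤ} (hν : AdmissibleStep ν) (m : ℤ)
    (p : Fin T) : incLp hξ hν m p =ᵐ[P] vecInc ν s d ξ m p := (hξ.memLp ν hν m p).coeFn_toLp

lemma inner_toLp_eq {F G : Ω → ℂ} (hF : MemLp F 2 P) (hG : MemLp G 2 P) :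
    inner ℂ (hF.toLp F) (hG.toLp G) = ∫ ω, G ω * conj (F ω) ∂P := by
  rw [inner_toLp]
  rfl

/-- The increments have the same Gram matrix as the generators of `L²(f)`. -/
lemma inner_incLp (S : Setting μ s d f R) (hξ : StationaryGM P s d ξ)
    (hf : SpectralDensity P s d ξ f) {ν₁ ν₂ : Fin r → ℤ} (h₁ : AdmissibleStep ν₁)
    (h₂ : AdmissibleStep ν₂) (j k : ℤ) (p q : Fin T) :
    inner ℂ (incLp hξ h₂ j p) (incLp hξ h₁ k q) =
      inner ℂ (S.spec.toH (S.memL2_gen ν₂ j p)) (S.spec.toH (S.memL2_gen ν₁ k q)) := by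
  have h := hf.structural ν₁ ν₂ h₁ h₂ (k - j) j q p
  rw [add_sub_cancel] at h
  rw [incLp, incLp, inner_toLp_eq, h, ← S.spec.specInner_eq, specInner]
  refine integral_congr_ae (Eventually.of_forall fun t => ?_)
  have hc := conj_chi ν₂ s d (-t)
  rw [neg_neg] at hc
  have h3 : star (gen ν₂ s d j p t) =
      conj (ex (t * j) * chi ν₂ s d (ex (-t)) / beta s d t) • Pi.single p 1 := by
    ext i
    by_cases hi : i = p
    · subst hi; simp [gen]
    · simp [gen, hi]
  simp only
  rw [h3, gen, Matrix.mulVec_smul, smul_dotProduct, dotProduct_smul, single_one_dotProduct,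
    Matrix.mulVec_single_one, map_div₀, map_mul, hc, conj_ex, smul_eq_mul, smul_eq_mul,
    Matrix.col_apply]
  have h4 : ((‖beta s d t‖ ^ 2 : ℝ) : ℂ) = beta s d t * conj (beta s d t) := by
    rw [Complex.mul_conj, Complex.normSq_eq_norm_sq]
  have h5 : ex (t * ((k - j : ℤ) : ℝ)) = ex (t * k) * ex (-(t * j)) := by
    rw [← ex_add]
    congr 1
    push_cast
    ring
  rw [h4, h5, div_eq_mul_inv, div_eq_mul_inv, div_eq_mul_inv, mul_inv]
  ring

lemma admissible_zstep (S : Setting μ s d f R) : AdmissibleStep (zstep μ) :=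
  Or.inl fun i => by
    have := S.step_pos i
    simp only [zstep]
    omega

/-- The isometry of `L²(f)` with the space of the increments of all steps. -/
lemma exists_spectral_isometry (S : Setting μ s d f R) (hξ : StationaryGM P s d ξ)
    (hf : SpectralDensity P s d ξ f) : ∃ U : VecL2 T →ₗᵢ[ℂ] Lp ℂ 2 P,
      ∀ (ν : Fin r → ℤ) (hν : AdmissibleStep ν) (k : ℤ) (p : Fin T),
        U (S.spec.toH (S.memL2_gen ν k p)) = incLp hξ hν k p := by
  have hμ := admissible_zstep S
  have htot : ∀ y : VecL2 T, (∀ i : ℤ × Fin T, inner ℂ (S.J i.1 i.2) y = 0) → y = 0 := fun y h =>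
    S.eq_zero_of_inner_J fun k p => h (k, p)
  obtain ⟨U, hU⟩ := exists_isometry (v := fun i : ℤ × Fin T => S.J i.1 i.2)
    (w := fun i => incLp hξ hμ i.1 i.2) (fun i j => by
      rw [inner_incLp S hξ hf, S.toH_gen, S.toH_gen]) htot
  refine ⟨U, fun ν hν k p => (eq_map_of_inner_eq htot U (fun i => ?_) ?_).symm⟩
  · rw [hU, inner_incLp S hξ hf, S.toH_gen]
  · have h := inner_incLp S hξ hf hν hν k k p p
    rw [inner_self_eq_norm_sq_to_K, inner_self_eq_norm_sq_to_K] at h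
    have h2 : ‖incLp hξ hν k p‖ ^ 2 = ‖S.spec.toH (S.memL2_gen ν k p)‖ ^ 2 := by exact_mod_cast h
    exact (pow_left_inj₀ (norm_nonneg _) (norm_nonneg _) two_ne_zero).1 h2

namespace Setting

lemma inner_ind_sub (S : Setting μ s d f R) (x y x' y' : ℝ) (p q : Fin T) :
    inner ℂ (S.ind y' q - S.ind x' q) (S.ind y p - S.ind x p) =
      (∫ t in Set.Ico (-Real.pi) (min y y'), f t p q ∂circ) -
      (∫ t in Set.Ico (-Real.pi) (min x y'), f t p q ∂circ) -
      ((∫ t in Set.Ico (-Real.pi) (min y x'), f t p q ∂circ) -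
      (∫ t in Set.Ico (-Real.pi) (min x x'), f t p q ∂circ)) := by
  rw [inner_sub_left, inner_sub_right, inner_sub_right, S.inner_ind_ind, S.inner_ind_ind,
    S.inner_ind_ind, S.inner_ind_ind]

/-- The images of the indicator functions form a spectral process. -/
lemma exists_spectralRep (S : Setting μ s d f R) (hξ : StationaryGM P s d ξ)
    (hf : SpectralDensity P s d ξ f) : ∃ Z, SpectralRep P s d ξ f Z := by
  obtain ⟨U, hU⟩ := exists_spectral_isometry S hξ hf
  set Z : ℝ → Fin T → Ω → ℂ := fun x p => U (S.ind x p)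
  have hdiff : ∀ x y p, Z y p - Z x p =ᵐ[P] U (S.ind y p - S.ind x p) := fun x y p => by
    rw [map_sub]
    exact (Lp.coeFn_sub _ _).symm
  have hmem : ∀ x y p, MemLp (Z y p - Z x p) 2 P := fun x y p =>
    (Lp.memLp _).ae_eq (hdiff x y p).symm
  have hinner : ∀ x y x' y' p q, ∫ ω, (Z y p ω - Z x p ω) * conj (Z y' q ω - Z x' q ω) ∂P =
      inner ℂ (S.ind y' q - S.ind x' q) (S.ind y p - S.ind x p) := by
    intro x y x' y' p q
    rw [← U.inner_map_map, ae_toLp_sub_eq (hmem x y p) (hdiff x y p).symm,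
      ae_toLp_sub_eq (hmem x' y' q) (hdiff x' y' q).symm, inner_toLp_eq]
    rfl
  have h0 : ∀ p, U (S.ind (-Real.pi) p) = 0 := fun p => by
    have h := S.inner_ind_ind (-Real.pi) (-Real.pi) p p
    have h1 : S.ind (-Real.pi) p = 0 := by simpa using h
    rw [h1, map_zero]
  refine ⟨Z, fun x _ y _ p => hmem x y p, ?_, ?_, ?_⟩
  · intro x hx y hy hxy p q
    rw [hinner, S.inner_ind_sub, min_self, min_self, min_eq_left hxy, min_eq_right hxy, sub_self,
      sub_zero, ← Set.Ico_union_Ico_eq_Ico hx.1 hxy, setIntegral_union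
      (Set.Ico_disjoint_Ico_same) measurableSet_Ico (S.integrable p q).integrableOn
      (S.integrable p q).integrableOn]
    ring
  · intro x hx y hy x' hx' y' hy' h1 h2 h3 p q
    rw [hinner, S.inner_ind_sub, min_eq_left (h2.trans h3), min_eq_left (h1.trans (h2.trans h3)),
      min_eq_left h2, min_eq_left (h1.trans h2), sub_self]
  · intro ν hν m p
    rw [S.isSpectralIntegral_iff (U := U) (fun x _ p => ?_) (S.memL2_gen ν m p), hU ν hν]
    · exact (coeFn_incLp hξ hν m p).symm
    · filter_upwards [hdiff (-Real.pi) x p] with ω h1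
      rw [h1, map_sub, h0, sub_zero]

/-- Integrals with respect to a spectral process are the values of the isometry of `L²(f)` with the
space of the increments. -/
lemma isSpectralIntegral_iff_of_spectralRep (S : Setting μ s d f R) (hξ : StationaryGM P s d ξ)
    {U : VecL2 T →ₗᵢ[ℂ] Lp ℂ 2 P}
    (hU : ∀ k p, U (S.J k p) = incLp hξ (admissible_zstep S) k p) {Z : ℝ → Fin T → Ω → ℂ}
    (hZ : SpectralRep P s d ξ f Z) {h : ℝ → Fin T → ℂ} (hh : MemL2 f h) {X : Ω → ℂ} :
    IsSpectralIntegral P f Z h X ↔ X =ᵐ[P] U (S.spec.toH hh) := by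
  have hpi := Real.pi_pos
  have hl : -Real.pi ∈ circIco := ⟨le_rfl, by linarith⟩
  -- the increment of `Z` from `x` to `y`
  set D : circIco → circIco → Fin T → Lp ℂ 2 P := fun x y p =>
    (hZ.memLp x x.2 y y.2 p).toLp _ with hD
  have hDadd : ∀ x y z p, D x y p + D y z p = D x z p := by
    intro x y z p
    rw [hD, ← MemLp.toLp_add]
    congr 1
    abel
  have hDself : ∀ x y p q, x ≤ y → inner ℂ (D x y q) (D x y p) =
      ∫ t in Set.Ico (x : ℝ) y, f t p q ∂circ := by
    intro x y p q hxy
    rw [hD, inner_toLp_eq, ← hZ.variance x x.2 y y.2 hxy]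
    rfl
  have hDort : ∀ x y z p q, x ≤ y → y ≤ z → inner ℂ (D y z q) (D x y p) = 0 := by
    intro x y z p q hxy hyz
    rw [hD, inner_toLp_eq, ← hZ.uncorrelated x x.2 y y.2 y y.2 z z.2 hxy le_rfl hyz]
    rfl
  set l : circIco := ⟨-Real.pi, hl⟩
  have hgram : ∀ x y p q, inner ℂ (D l y q) (D l x p) = inner ℂ (S.ind y q) (S.ind x p) := by
    intro x y p q
    rw [S.inner_ind_ind]
    rcases le_total x y with h1 | h1
    · rw [min_eq_left (show (x : ℝ) ≤ y from h1), ← hDadd l x y, inner_add_left,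
        hDself l x p q x.2.1, hDort l x y p q x.2.1 h1, add_zero]
    · rw [min_eq_right (show (y : ℝ) ≤ x from h1), ← hDadd l y x, inner_add_right,
        hDself l y p q y.2.1, ← inner_conj_symm (D l y q) (D y x p), hDort l y x q p y.2.1 h1,
        map_zero, add_zero]
  obtain ⟨W, hW⟩ := exists_isometry (v := fun i : circIco × Fin T => S.ind i.1 i.2)
    (w := fun i => D l i.1 i.2) (fun i j => hgram _ _ _ _) fun y h => S.eq_zero_of_inner_ind h
  have hWZ : ∀ x ∈ circIco, ∀ p, (W (S.ind x p) : Ω → ℂ) =ᵐ[P] Z x p - Z (-Real.pi) p := by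
    intro x hx p
    have h1 := hW (⟨x, hx⟩, p)
    simp only at h1
    rw [h1]
    exact (hZ.memLp _ hl x hx p).coeFn_toLp
  have hWU : W = U := by
    have h1 : ∀ k p, W (S.J k p) = U (S.J k p) := by
      intro k p
      have h2 := (S.isSpectralIntegral_iff hWZ (S.memL2_gen (zstep μ) k p)).1
        (hZ.representation _ (admissible_zstep S) k p)
      rw [S.toH_gen] at h2
      rw [hU]
      exact Lp.ext (h2.symm.trans (coeFn_incLp hξ _ k p).symm)
    ext1 y
    refine eq_map_of_inner_eq (v := fun i : ℤ × Fin T => S.J i.1 i.2)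
      (fun y h => S.eq_zero_of_inner_J fun k p => h (k, p)) U (fun i => ?_) (W.norm_map y)
    rw [← h1, W.inner_map_map]
  rw [← hWU]
  exact S.isSpectralIntegral_iff hWZ hh

end Setting

end Prob

/-! ### Increments and the operator `D` -/

section Coef

variable {r T : ℕ} (μ s d : Fin r → ℕ)

/-- The polynomial `∏ i, (1 - x ^ (μ i * s i)) ^ (d i)`. -/
def ePoly : Polynomial ℂ := ∏ i, (1 - (Polynomial.X : Polynomial ℂ) ^ (μ i * s i)) ^ (d i)

lemma ePoly_eq_sum : ePoly μ s d = ∑ l ∈ Fintype.piFinset (fun i => Finset.range (d i + 1)),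
    Polynomial.C (∏ i, (-1 : ℂ) ^ (l i) * ((d i).choose (l i) : ℂ)) *
      Polynomial.X ^ ∑ i, μ i * s i * l i := by
  have h : ∀ i, (1 - (Polynomial.X : Polynomial ℂ) ^ (μ i * s i)) ^ (d i) =
      ∑ l ∈ Finset.range (d i + 1), Polynomial.C ((-1 : ℂ) ^ l * ((d i).choose l : ℂ)) *
        Polynomial.X ^ (μ i * s i * l) := by
    intro i
    rw [sub_eq_neg_add, add_pow]
    refine Finset.sum_congr rfl fun l _ => ?_
    rw [one_pow, mul_one, neg_pow, ← pow_mul]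
    simp only [map_mul, map_pow, map_neg, map_one, map_natCast]
    ring
  rw [ePoly, Finset.prod_congr rfl fun i _ => h i, Finset.prod_univ_sum]
  refine Finset.sum_congr rfl fun l _ => ?_
  rw [Finset.prod_mul_distrib, map_prod, Finset.prod_pow_eq_pow_sum]

lemma eCoef_eq (k : ℕ) : eCoef μ s d k = (ePoly μ s d).coeff k := rfl

lemma sum_le_nGamma {l : Fin r → ℕ}
    (hl : l ∈ Fintype.piFinset (fun i => Finset.range (d i + 1))) :
    ∑ i, μ i * s i * l i ≤ nGamma μ s d := by
  refine Finset.sum_le_sum fun i _ => Nat.mul_le_mul_left _ ?_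
  have := Fintype.mem_piFinset.1 hl i
  rw [Finset.mem_range] at this
  omega

lemma eCoef_eq_zero {k : ℕ} (hk : nGamma μ s d < k) : eCoef μ s d k = 0 := by
  rw [eCoef_eq, ePoly_eq_sum, Polynomial.finsetSum_coeff]
  refine Finset.sum_eq_zero fun l hl => ?_
  rw [Polynomial.coeff_C_mul_X_pow, if_neg]
  have := sum_le_nGamma μ s d hl
  omega

lemma vecInc_zstep {Ω : Type*} (ξ : ℤ → Fin T → Ω → ℂ) (m : ℤ) (p : Fin T) (ω : Ω) :
    vecInc (zstep μ) s d ξ m p ω =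
      ∑ j ∈ Finset.range (nGamma μ s d + 1), eCoef μ s d j * ξ (m - j) p ω := by
  simp_rw [eCoef_eq, ePoly_eq_sum, Polynomial.finsetSum_coeff, Finset.sum_mul,
    Polynomial.coeff_C_mul_X_pow]
  rw [Finset.sum_comm]
  refine Finset.sum_congr rfl fun l hl => ?_
  have h := sum_le_nGamma μ s d hl
  rw [Finset.sum_eq_single_of_mem (∑ i, μ i * s i * l i) (Finset.mem_range.2 (by omega))]
  · rw [if_pos rfl]
    simp [zstep]
  · intro j _ hj
    rw [if_neg hj, zero_mul]

lemma one_sub_X_pow_mul {a : ℕ} (ha : 0 < a) :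
    (1 - (PowerSeries.X : PowerSeries ℂ) ^ a) *
      (PowerSeries.mk fun n => if a ∣ n then (1 : ℂ) else 0) = 1 := by
  ext n
  rw [sub_mul, one_mul, map_sub, PowerSeries.coeff_X_pow_mul', PowerSeries.coeff_mk,
    PowerSeries.coeff_mk, PowerSeries.coeff_one]
  rcases Nat.eq_zero_or_pos n with rfl | hn
  · simp [ha.ne']
  · by_cases h1 : a ≤ n
    · have h2 : a ∣ n - a ↔ a ∣ n := ⟨fun h => by
        have := Nat.dvd_add h (dvd_refl a)
        rwa [Nat.sub_add_cancel h1] at this, fun h => Nat.dvd_sub h dvd_rfl⟩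
      simp [h1, h2, hn.ne']
    · have : ¬ a ∣ n := fun h => h1 (Nat.le_of_dvd hn h)
      simp [h1, this, hn.ne']

variable {μ s d}

lemma sum_eCoef_mul_dCoef (hμ : ∀ i, 0 < μ i) (hs : ∀ i, 0 < s i) (m : ℕ) :
    ∑ j ∈ Finset.range (m + 1), eCoef μ s d j * dCoef μ s d (m - j) = if m = 0 then 1 else 0 := by
  have h : ((ePoly μ s d : Polynomial ℂ) : PowerSeries ℂ) *
      ∏ i, (PowerSeries.mk fun n => if μ i * s i ∣ n then (1 : ℂ) else 0) ^ (d i) = 1 := by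
    have h1 : ((ePoly μ s d : Polynomial ℂ) : PowerSeries ℂ) =
        ∏ i, (1 - (PowerSeries.X : PowerSeries ℂ) ^ (μ i * s i)) ^ (d i) := by
      rw [ePoly, ← Polynomial.coeToPowerSeries.ringHom_apply, map_prod]
      simp
    rw [h1, ← Finset.prod_mul_distrib]
    refine Finset.prod_eq_one fun i _ => ?_
    rw [← mul_pow, one_sub_X_pow_mul (Nat.mul_pos (hμ i) (hs i)), one_pow]
  have h2 := congrArg (PowerSeries.coeff m) h
  rw [PowerSeries.coeff_mul, PowerSeries.coeff_one,
    Finset.Nat.sum_antidiagonal_eq_sum_range_succ_mk] at h2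
  simpa [Polynomial.coeff_coe, eCoef_eq, dCoef] using h2

lemma tendsto_dPartial {a : ℕ → Fin T → ℂ} (h : DConverges μ s d a) (k : ℕ) :
    Tendsto (dPartial μ s d a k) atTop (𝓝 (Dop μ s d a k)) :=
  tendsto_nhds_limUnder (h k)

/-- The operator `D` is inverted by the coefficients `e`. -/
lemma sum_eCoef_Dop (hμ : ∀ i, 0 < μ i) (hs : ∀ i, 0 < s i) {a : ℕ → Fin T → ℂ}
    (h : DConverges μ s d a) (k : ℕ) :
    ∑ j ∈ Finset.range (nGamma μ s d + 1), eCoef μ s d j • Dop μ s d a (k + j) = a k := by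
  have h1 : Tendsto (fun N => ∑ j ∈ Finset.range (nGamma μ s d + 1),
      eCoef μ s d j • dPartial μ s d a (k + j) (N - j)) atTop
      (𝓝 (∑ j ∈ Finset.range (nGamma μ s d + 1), eCoef μ s d j • Dop μ s d a (k + j))) := by
    refine tendsto_finsetSum _ fun j _ => Tendsto.const_smul ?_ _
    exact (tendsto_dPartial h (k + j)).comp (tendsto_sub_atTop_nat j)
  refine tendsto_nhds_unique h1 (tendsto_const_nhds.congr' ?_)
  filter_upwards [eventually_ge_atTop (nGamma μ s d + 1)] with N hN
  have h2 : ∑ j ∈ Finset.range (nGamma μ s d + 1),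
      eCoef μ s d j • dPartial μ s d a (k + j) (N - j) =
      ∑ j ∈ Finset.range N, ∑ i ∈ Finset.range (N - j),
        (eCoef μ s d j * dCoef μ s d i) • a (k + (j + i)) := by
    rw [← Finset.sum_subset (Finset.range_mono hN)]
    · refine Finset.sum_congr rfl fun j _ => ?_
      rw [dPartial, Finset.smul_sum]
      exact Finset.sum_congr rfl fun i _ => by rw [smul_smul, add_assoc]
    · intro j _ hj
      rw [Finset.mem_range, not_lt] at hj
      simp [eCoef_eq_zero μ s d (show nGamma μ s d < j by omega)]
  rw [h2, ← Finset.sum_range_diag_flip]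
  have h3 : ∀ m, ∑ j ∈ Finset.range (m + 1),
      (eCoef μ s d j * dCoef μ s d (m - j)) • a (k + (j + (m - j))) =
      if m = 0 then a k else 0 := by
    intro m
    rw [Finset.sum_congr rfl (g := fun j => (eCoef μ s d j * dCoef μ s d (m - j)) • a (k + m))
      fun j hj => ?_, ← Finset.sum_smul, sum_eCoef_mul_dCoef hμ hs]
    · split_ifs with hm
      · rw [hm, one_smul, add_zero]
      · rw [zero_smul]
    · rw [Finset.mem_range] at hj
      rw [Nat.add_sub_cancel' (by omega)]
  simp_rw [h3]
  rw [Finset.sum_ite_eq' _ 0, if_pos (Finset.mem_range.2 (by omega))]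

lemma dPartial_eq_of_le {x : ℕ → Fin T → ℂ} {N : ℕ} (hx : ∀ k, N ≤ k → x k = 0) (k : ℕ) {n : ℕ}
    (hn : N - k ≤ n) : dPartial μ s d x k n = dPartial μ s d x k (N - k) := by
  rw [dPartial, dPartial]
  refine (Finset.sum_subset (Finset.range_mono hn) fun j _ hj => ?_).symm
  rw [Finset.mem_range, not_lt] at hj
  rw [hx _ (by omega), smul_zero]

lemma tendsto_dPartial_of_eq_zero {x : ℕ → Fin T → ℂ} {N : ℕ} (hx : ∀ k, N ≤ k → x k = 0) (k : ℕ) :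
    Tendsto (dPartial μ s d x k) atTop (𝓝 (dPartial μ s d x k (N - k))) :=
  tendsto_const_nhds.congr' (by
    filter_upwards [eventually_ge_atTop (N - k)] with n hn
    rw [dPartial_eq_of_le hx k hn])

lemma DConverges_of_eq_zero {x : ℕ → Fin T → ℂ} {N : ℕ} (hx : ∀ k, N ≤ k → x k = 0) :
    DConverges μ s d x := fun k => ⟨_, tendsto_dPartial_of_eq_zero hx k⟩

lemma Dop_of_eq_zero {x : ℕ → Fin T → ℂ} {N : ℕ} (hx : ∀ k, N ≤ k → x k = 0) (k : ℕ) :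
    Dop μ s d x k = dPartial μ s d x k (N - k) :=
  (tendsto_dPartial_of_eq_zero hx k).limUnder_eq

lemma Dop_eq_zero {x : ℕ → Fin T → ℂ} {N : ℕ} (hx : ∀ k, N ≤ k → x k = 0) {k : ℕ} (hk : N ≤ k) :
    Dop μ s d x k = 0 := by
  rw [Dop_of_eq_zero hx, Nat.sub_eq_zero_of_le hk]
  rfl

lemma Dop_shift (a : ℕ → Fin T → ℂ) (k m : ℕ) :
    Dop μ s d (fun l => a (l + k)) m = Dop μ s d a (k + m) := by
  rw [Dop, Dop]
  congr 1
  ext N : 1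
  rw [dPartial, dPartial]
  refine Finset.sum_congr rfl fun j _ => ?_
  rw [show m + j + k = k + m + j by omega]

/-- The coefficients `∑_{l < N} e(l - k) b(l)`, whose image under `D` is the truncation of `b`. -/
def eTrunc (μ s d : Fin r → ℕ) (b : ℕ → Fin T → ℂ) (N k : ℕ) : Fin T → ℂ :=
  ∑ j ∈ Finset.range (N - k), eCoef μ s d j • b (k + j)

lemma eTrunc_eq_zero (b : ℕ → Fin T → ℂ) {N k : ℕ} (hk : N ≤ k) : eTrunc μ s d b N k = 0 := by
  rw [eTrunc, Nat.sub_eq_zero_of_le hk]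
  rfl

lemma Dop_eTrunc (hμ : ∀ i, 0 < μ i) (hs : ∀ i, 0 < s i) (b : ℕ → Fin T → ℂ) (N k : ℕ) :
    Dop μ s d (eTrunc μ s d b N) k = if k < N then b k else 0 := by
  rw [Dop_of_eq_zero fun k hk => eTrunc_eq_zero b hk, dPartial]
  have h2 : ∑ i ∈ Finset.range (N - k), dCoef μ s d i • eTrunc μ s d b N (k + i) =
      ∑ i ∈ Finset.range (N - k), ∑ j ∈ Finset.range (N - k - i),
        (dCoef μ s d i * eCoef μ s d j) • b (k + (i + j)) := by
    refine Finset.sum_congr rfl fun i _ => ?_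
    rw [eTrunc, Finset.smul_sum, Nat.sub_sub]
    exact Finset.sum_congr rfl fun j _ => by rw [smul_smul, add_assoc]
  rw [h2, ← Finset.sum_range_diag_flip]
  have h3 : ∀ m, ∑ i ∈ Finset.range (m + 1),
      (dCoef μ s d i * eCoef μ s d (m - i)) • b (k + (i + (m - i))) =
      if m = 0 then b k else 0 := by
    intro m
    rw [← Finset.sum_range_reflect, Finset.sum_congr rfl
      (g := fun j => (eCoef μ s d j * dCoef μ s d (m - j)) • b (k + m))
      fun j hj => ?_, ← Finset.sum_smul, sum_eCoef_mul_dCoef hμ hs]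
    · split_ifs with hm
      · rw [hm, one_smul, add_zero]
      · rw [zero_smul]
    · rw [Finset.mem_range] at hj
      rw [show m + 1 - 1 - j = m - j by omega, show m - (m - j) = j by omega,
        show m - j + j = m by omega, mul_comm]
  simp_rw [h3]
  rw [Finset.sum_ite_eq' _ 0]
  simp only [Finset.mem_range, Nat.sub_pos_iff_lt]

/-- Summation by parts: increments against `y` are values of the sequence, at the times `i ≥ 0` and
at the `n` times before `0`, against the corresponding transforms of `y`. -/
lemma sum_mul_increment (e : ℕ → ℂ) (n N : ℕ) {y : ℕ → ℂ} (hy : ∀ k, N ≤ k → y k = 0) (η : ℤ → ℂ) :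
    ∑ k ∈ Finset.range N, y k * ∑ j ∈ Finset.range (n + 1), e j * η (k - j) =
      ∑ i ∈ Finset.range N, (∑ j ∈ Finset.range (n + 1), e j * y (i + j)) * η i +
      ∑ i ∈ Finset.Icc 1 n, (∑ l ∈ Finset.range (n - i + 1), e (l + i) * y l) * η (-(i : ℤ)) := by
  have h1 : ∑ k ∈ Finset.range N, y k * ∑ j ∈ Finset.range (n + 1), e j * η (k - j) =
      ∑ x ∈ Finset.range N ×ˢ Finset.range (n + 1), y x.1 * (e x.2 * η (x.1 - x.2)) := by
    rw [Finset.sum_product]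
    exact Finset.sum_congr rfl fun k _ => by rw [Finset.mul_sum]
  -- the value of `η` in the term `(k, j)` is at the time `k - j`, which is `≥ 0` or `< 0`
  rw [h1, ← Finset.sum_filter_add_sum_filter_not _ (fun x => x.2 ≤ x.1)]
  congr 1
  · have h2 : ∑ i ∈ Finset.range N, (∑ j ∈ Finset.range (n + 1), e j * y (i + j)) * η i =
        ∑ x ∈ (Finset.range N ×ˢ Finset.range (n + 1)) with x.1 + x.2 < N,
          e x.2 * y (x.1 + x.2) * η x.1 := by
      rw [Finset.sum_filter, Finset.sum_product]
      refine Finset.sum_congr rfl fun i _ => ?_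
      rw [Finset.sum_mul]
      refine Finset.sum_congr rfl fun j _ => ?_
      split_ifs with h
      · rfl
      · rw [hy _ (not_lt.1 h), mul_zero, zero_mul]
    rw [h2]
    refine Finset.sum_nbij' (fun x => (x.1 - x.2, x.2)) (fun x => (x.1 + x.2, x.2)) ?_ ?_ ?_ ?_ ?_
    · rintro ⟨k, j⟩ h
      simp only [Finset.mem_filter, Finset.mem_product, Finset.mem_range] at h ⊢
      omega
    · rintro ⟨k, j⟩ h
      simp only [Finset.mem_filter, Finset.mem_product, Finset.mem_range] at h ⊢
      omega
    · rintro ⟨k, j⟩ h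
      simp only [Finset.mem_filter, Finset.mem_product, Finset.mem_range] at h
      simp only [Prod.mk.injEq, and_true]
      omega
    · rintro ⟨k, j⟩ h
      simp
    · rintro ⟨k, j⟩ h
      simp only [Finset.mem_filter, Finset.mem_product, Finset.mem_range] at h
      simp only
      rw [Nat.sub_add_cancel h.2, Nat.cast_sub h.2]
      ring
  · have h2 : ∑ i ∈ Finset.Icc 1 n, (∑ l ∈ Finset.range (n - i + 1), e (l + i) * y l) * η (-(i : ℤ)) =
        ∑ x ∈ (Finset.Icc 1 n ×ˢ Finset.range N) with x.2 + x.1 ≤ n,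
          e (x.2 + x.1) * y x.2 * η (-(x.1 : ℤ)) := by
      rw [Finset.sum_filter, Finset.sum_product]
      refine Finset.sum_congr rfl fun i hi => ?_
      rw [Finset.mem_Icc] at hi
      rw [Finset.sum_mul, ← Finset.sum_filter]
      refine (Finset.sum_subset (fun l hl => ?_) fun l hl hl' => ?_).symm
      · simp only [Finset.mem_filter, Finset.mem_range] at hl ⊢
        omega
      · simp only [Finset.mem_filter, Finset.mem_range] at hl hl'
        rw [hy l (by omega), mul_zero, zero_mul]
    rw [h2]
    refine Finset.sum_nbij' (fun x => (x.2 - x.1, x.1)) (fun x => (x.2, x.1 + x.2)) ?_ ?_ ?_ ?_ ?_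
    · rintro ⟨k, j⟩ h
      simp only [Finset.mem_filter, Finset.mem_product, Finset.mem_range, Finset.mem_Icc] at h ⊢
      omega
    · rintro ⟨k, j⟩ h
      simp only [Finset.mem_filter, Finset.mem_product, Finset.mem_range, Finset.mem_Icc] at h ⊢
      omega
    · rintro ⟨k, j⟩ h
      simp only [Finset.mem_filter, Finset.mem_product, Finset.mem_range] at h
      simp only [Prod.mk.injEq, true_and]
      omega
    · rintro ⟨k, j⟩ h
      simp
    · rintro ⟨k, j⟩ h
      simp only [Finset.mem_filter, Finset.mem_product, Finset.mem_range, not_le] at h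
      simp only
      rw [Nat.add_sub_cancel' h.2.le, Nat.cast_sub h.2.le, neg_sub]
      ring

/-- A functional with finitely many coefficients `x` is a sum of increments minus initial values. -/
lemma finFunctional_add_initial (hμ : ∀ i, 0 < μ i) (hs : ∀ i, 0 < s i) {Ω : Type*}
    (ξ : ℤ → Fin T → Ω → ℂ) (x : ℕ →₀ (Fin T → ℂ)) {N : ℕ} (hx : ∀ k, N ≤ k → x k = 0) (ω : Ω) :
    finFunctional x ξ ω + initial μ s d x ξ ω = ∑ k ∈ Finset.range N, ∑ p,
      Dop μ s d x k p * vecInc (zstep μ) s d ξ k p ω := by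
  have h1 : finFunctional x ξ ω = ∑ p, ∑ k ∈ Finset.range N, x k p * ξ k p ω := by
    rw [finFunctional, Finsupp.sum_of_support_subset (s := Finset.range N), Finset.sum_comm]
    · intro k hk
      rw [Finset.mem_range]
      by_contra h
      exact Finsupp.mem_support_iff.1 hk (hx k (not_lt.1 h))
    · simp
  have h2 : initial μ s d x ξ ω = ∑ p, ∑ j ∈ Finset.Icc 1 (nGamma μ s d),
      vCoef μ s d x j p * ξ (-(j : ℤ)) p ω := by
    rw [initial, Finset.sum_comm]
  rw [h1, h2, ← Finset.sum_add_distrib, Finset.sum_comm]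
  refine Finset.sum_congr rfl fun p _ => ?_
  simp_rw [vecInc_zstep]
  rw [sum_mul_increment (eCoef μ s d) (nGamma μ s d) N (y := fun k => Dop μ s d x k p)
    (fun k hk => by rw [Dop_eq_zero hx hk]; rfl) fun m => ξ m p ω]
  congr 1
  · refine Finset.sum_congr rfl fun k _ => ?_
    conv_lhs => rw [← sum_eCoef_Dop (d := d) hμ hs (DConverges_of_eq_zero hx) k]
    simp
  · refine Finset.sum_congr rfl fun j _ => ?_
    simp [vCoef]

end Coef

/-! ### The functional -/

/-- The functional of the initial values, as a linear map of its coefficients. -/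
def initLin {T : ℕ} {Ω : Type*} (ξ : ℤ → Fin T → Ω → ℂ) (n : ℕ) :
    (Finset.Icc 1 n → Fin T → ℂ) →ₗ[ℂ] (Ω → ℂ) where
  toFun v := fun ω => ∑ j : Finset.Icc 1 n, ∑ p, v j p * ξ (-((j : ℕ) : ℤ)) p ω
  map_add' v w := by
    ext ω
    simp [add_mul, Finset.sum_add_distrib]
  map_smul' c v := by
    ext ω
    simp [Finset.mul_sum, mul_assoc]

lemma initial_eq_initLin {r T : ℕ} {μ s d : Fin r → ℕ} {Ω : Type*} (ξ : ℤ → Fin T → Ω → ℂ)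
    (a : ℕ → Fin T → ℂ) :
    initial μ s d a ξ = initLin ξ (nGamma μ s d) fun j => vCoef μ s d a j := by
  ext ω
  exact (Finset.sum_coe_sort (Finset.Icc 1 (nGamma μ s d))
    fun j => ∑ p, vCoef μ s d a j p * ξ (-(j : ℤ)) p ω).symm

lemma initial_congr {r T : ℕ} {μ s d : Fin r → ℕ} {Ω : Type*} {ξ : ℤ → Fin T → Ω → ℂ}
    {a b : ℕ → Fin T → ℂ} (h : ∀ l, l ≤ nGamma μ s d → Dop μ s d a l = Dop μ s d b l) :
    initial μ s d a ξ = initial μ s d b ξ := by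
  ext ω
  refine Finset.sum_congr rfl fun j hj => Finset.sum_congr rfl fun p _ => ?_
  rw [Finset.mem_Icc] at hj
  have hv : vCoef μ s d a j = vCoef μ s d b j := Finset.sum_congr rfl fun l hl => by
    rw [Finset.mem_range] at hl
    rw [h l (by omega)]
  rw [hv]

section Prob

variable {Ω : Type*} [MeasurableSpace Ω] {P : Measure Ω}

/-- Random variables which depend linearly on finitely many parameters converge in mean square with
the parameters, if their differences are square integrable. -/
lemma tendsto_eLpNorm_of_finiteDimensional {E : Type*} [NormedAddCommGroup E] [NormedSpace ℂ E]
    [FiniteDimensional ℂ E] (L : E →ₗ[ℂ] (Ω → ℂ)) {v : ℕ → E} {w : E}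
    (hv : Tendsto v atTop (𝓝 w)) {n₀ : ℕ}
    (hmem : ∀ m ≥ n₀, ∀ n ≥ n₀, MemLp (L (v m - v n)) 2 P) :
    Tendsto (fun n => eLpNorm (L (v n - w)) 2 P) atTop (𝓝 0) := by
  let W : Submodule ℂ E :=
    { carrier := {e | MemLp (L e) 2 P}
      add_mem' := fun {a b} ha hb => by
        change MemLp (L (a + b)) 2 P
        rw [map_add]
        exact MemLp.add ha hb
      zero_mem' := by
        change MemLp (L 0) 2 P
        rw [map_zero]
        exact MemLp.zero
      smul_mem' := fun c a ha => by
        change MemLp (L (c • a)) 2 P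
        rw [map_smul]
        exact MemLp.const_smul ha c }
  let M : W →ₗ[ℂ] Lp ℂ 2 P :=
    { toFun := fun e => MemLp.toLp (L e) e.2
      map_add' := fun a b => by
        rw [← MemLp.toLp_add]
        simp only [Submodule.coe_add, map_add]
      map_smul' := fun c a => by
        rw [RingHom.id_apply, ← MemLp.toLp_const_smul]
        simp only [Submodule.coe_smul, map_smul] }
  have hM : Continuous M := M.continuous_of_finiteDimensional
  have hW : ∀ n ≥ n₀, v n - w ∈ W := fun n hn =>
    W.closed_of_finiteDimensional.mem_of_tendsto (tendsto_const_nhds.sub hv) (by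
      filter_upwards [eventually_ge_atTop n₀] with m hm
      exact hmem n hn m hm)
  let u : ℕ → W := fun n => ⟨v (n + n₀) - w, hW _ (Nat.le_add_left _ _)⟩
  have hu : Tendsto u atTop (𝓝 0) := by
    rw [tendsto_subtype_rng]
    have := ((tendsto_add_atTop_iff_nat n₀).2 hv).sub_const w
    rwa [sub_self] at this
  have h1 := (hM.tendsto 0).comp hu
  rw [map_zero, Lp.tendsto_Lp_iff_tendsto_eLpNorm'] at h1
  refine (tendsto_add_atTop_iff_nat n₀).1 (h1.congr fun n => eLpNorm_congr_ae ?_)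
  filter_upwards [MemLp.coeFn_toLp (hW (n + n₀) (Nat.le_add_left _ _)), Lp.coeFn_zero ℂ 2 P]
    with ω h2 h3
  rw [Pi.sub_apply, h3, Pi.zero_apply, sub_zero]
  exact h2

variable {r T : ℕ} {μ s d : Fin r → ℕ} {f R : ℝ → Matrix (Fin T) (Fin T) ℂ}
  {ξ : ℤ → Fin T → Ω → ℂ}

lemma measurable_initial (hξ : StationaryGM P s d ξ) (a : ℕ → Fin T → ℂ) :
    Measurable (initial μ s d a ξ) :=
  Finset.measurable_fun_sum _ fun _ _ => Finset.measurable_fun_sum _ fun _ _ =>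
    (hξ.measurable _ _).const_mul _

lemma measurable_finFunctional (hξ : StationaryGM P s d ξ) (x : ℕ →₀ (Fin T → ℂ)) :
    Measurable (finFunctional x ξ) :=
  Finset.measurable_fun_sum _ fun _ _ => Finset.measurable_fun_sum _ fun _ _ =>
    (hξ.measurable _ _).const_mul _

namespace Setting

/-- `∑_{k < N} ∑ p, y(k)_p J(k, p)`. -/
def sumJ (S : Setting μ s d f R) (N : ℕ) (y : ℕ → Fin T → ℂ) : VecL2 T :=
  ∑ k ∈ Finset.range N, ∑ p, y k p • S.J k p

lemma inner_K_sumJ (S : Setting μ s d f R) {N : ℕ} {y : ℕ → Fin T → ℂ}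
    (hy : ∀ k, N ≤ k → y k = 0) (j : ℤ) (p : Fin T) :
    inner ℂ (S.K j p) (S.sumJ N y) = if 0 ≤ j then y j.toNat p else 0 := by
  simp only [sumJ, inner_sum, inner_smul_right, S.inner_K_J]
  split_ifs with hj
  · have h1 : ∀ k ∈ Finset.range N, k ≠ j.toNat →
        ∑ q, y k q * (if (k : ℤ) = j ∧ q = p then (1 : ℂ) else 0) = 0 := fun k _ hk =>
      Finset.sum_eq_zero fun q _ => by rw [if_neg (by omega), mul_zero]
    by_cases h2 : j.toNat < N
    · rw [Finset.sum_eq_single_of_mem _ (Finset.mem_range.2 h2) h1]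
      simp [Int.toNat_of_nonneg hj]
    · rw [hy _ (not_lt.1 h2), Finset.sum_eq_zero fun k hk => h1 k hk ?_]
      · rfl
      · rw [Finset.mem_range] at hk
        omega
  · exact Finset.sum_eq_zero fun k _ => Finset.sum_eq_zero fun q _ => by
      rw [if_neg (by omega), mul_zero]

variable {U : VecL2 T →ₗᵢ[ℂ] Lp ℂ 2 P}

lemma map_sumJ (S : Setting μ s d f R) (hξ : StationaryGM P s d ξ)
    (hU : ∀ k p, U (S.J k p) = incLp hξ (admissible_zstep S) k p) (N : ℕ) (y : ℕ → Fin T → ℂ) :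
    (U (S.sumJ N y) : Ω → ℂ) =ᵐ[P] fun ω => ∑ k ∈ Finset.range N, ∑ p,
      y k p * vecInc (zstep μ) s d ξ k p ω := by
  simp only [sumJ, map_sum, map_smul, hU]
  have h1 : ∀ (k : ℕ) (p : Fin T),
      ((y k p • incLp hξ (admissible_zstep S) k p : Lp ℂ 2 P) : Ω → ℂ) =ᵐ[P]
        fun ω => y k p * vecInc (zstep μ) s d ξ k p ω := by
    intro k p
    filter_upwards [Lp.coeFn_smul (y k p) (incLp hξ (admissible_zstep S) k p),
      coeFn_incLp hξ (admissible_zstep S) k p] with ω h1 h2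
    rw [h1, Pi.smul_apply, h2, smul_eq_mul]
  have h2 : ∀ k : ℕ, ((∑ p, y k p • incLp hξ (admissible_zstep S) k p : Lp ℂ 2 P) : Ω → ℂ) =ᵐ[P]
      fun ω => ∑ p, y k p * vecInc (zstep μ) s d ξ k p ω := by
    intro k
    filter_upwards [Lp.coeFn_finsetSum Finset.univ
      (fun p => y k p • incLp hξ (admissible_zstep S) k p), ae_all_iff.2 (h1 k)] with ω h3 h4
    rw [h3, Finset.sum_apply]
    exact Finset.sum_congr rfl fun p _ => h4 p
  filter_upwards [Lp.coeFn_finsetSum (Finset.range N)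
    (fun k : ℕ => ∑ p, y k p • incLp hξ (admissible_zstep S) k p), ae_all_iff.2 h2] with ω h3 h4
  rw [h3, Finset.sum_apply]
  exact Finset.sum_congr rfl fun k _ => h4 k

lemma finFunctional_add_initial (S : Setting μ s d f R) (hξ : StationaryGM P s d ξ)
    (hU : ∀ k p, U (S.J k p) = incLp hξ (admissible_zstep S) k p) {N : ℕ} {x : ℕ →₀ (Fin T → ℂ)}
    (hx : ∀ k, N ≤ k → x k = 0) :
    finFunctional x ξ + initial μ s d x ξ =ᵐ[P] U (S.sumJ N (Dop μ s d x)) := by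
  filter_upwards [S.map_sumJ hξ hU N (Dop μ s d x)] with ω h
  rw [h, ← GM.finFunctional_add_initial S.step_pos S.season_pos ξ x hx ω]
  rfl

/-- The functional plus the initial values is the image of `B χ_μ / β`. -/
lemma isFunctional_add_initial (S : Setting μ s d f R) (hξ : StationaryGM P s d ξ)
    (hU : ∀ k p, U (S.J k p) = incLp hξ (admissible_zstep S) k p) {a : ℕ → Fin T → ℂ}
    (hb : Summable fun k => eucl (Dop μ s d a k)) {A : Ω → ℂ}
    (hA : IsFunctional P μ s d a ξ A) :
    A + initial μ s d a ξ =ᵐ[P] U (S.spec.toH (S.memL2_Bchi hb)) := by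
  obtain ⟨hAm, x, -, hxD, hlim⟩ := hA
  have hN : ∀ n, ∃ N, ∀ k, N ≤ k → x n k = 0 := fun n => by
    obtain ⟨N, hN⟩ := (x n).support.exists_nat_subset_range
    refine ⟨N, fun k hk => ?_⟩
    by_contra h
    have := hN (Finsupp.mem_support_iff.2 h)
    rw [Finset.mem_range] at this
    omega
  choose N hN using hN
  set w : ℕ → VecL2 T := fun n => S.sumJ (N n) (Dop μ s d (x n))
  have hFV : ∀ n, finFunctional (x n) ξ + initial μ s d (x n) ξ =ᵐ[P] U (w n) := fun n =>
    S.finFunctional_add_initial hξ hU (hN n)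
  obtain ⟨n₀, hn₀⟩ := eventually_atTop.1 (hlim.eventually (gt_mem_nhds (zero_lt_one (α := ℝ≥0∞))))
  have hFA : ∀ n ≥ n₀, MemLp (finFunctional (x n) ξ - A) 2 P := fun n hn =>
    ⟨(measurable_finFunctional hξ _).aestronglyMeasurable.sub hAm,
      (hn₀ n hn).trans ENNReal.one_lt_top⟩
  -- the initial values converge, since their differences are square integrable
  have hV : Tendsto (fun n => eLpNorm (initial μ s d (x n) ξ - initial μ s d a ξ) 2 P) atTop
      (𝓝 0) := by
    have hv : Tendsto (fun n => (fun j : Finset.Icc 1 (nGamma μ s d) => vCoef μ s d (x n) j)) atTop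
        (𝓝 fun j => vCoef μ s d a j) :=
      tendsto_pi_nhds.2 fun j => tendsto_finsetSum _ fun l _ => (hxD l).const_smul _
    have h := tendsto_eLpNorm_of_finiteDimensional (P := P) (initLin ξ (nGamma μ s d)) hv
      (n₀ := n₀) fun m hm n hn => by
        have h1 : MemLp ((U (w m) : Ω → ℂ) - (U (w n) : Ω → ℂ) - (finFunctional (x m) ξ - A) +
            (finFunctional (x n) ξ - A)) 2 P :=
          (((Lp.memLp _).sub (Lp.memLp _)).sub (hFA m hm)).add (hFA n hn)
        refine h1.ae_eq ?_
        rw [map_sub, ← initial_eq_initLin, ← initial_eq_initLin]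
        filter_upwards [hFV m, hFV n] with ω h2 h3
        simp only [Pi.add_apply, Pi.sub_apply] at h2 h3 ⊢
        rw [← h2, ← h3]
        ring
    simpa only [map_sub, ← initial_eq_initLin] using h
  have hG : Tendsto (fun n => eLpNorm ((U (w n) : Ω → ℂ) - (A + initial μ s d a ξ)) 2 P) atTop
      (𝓝 0) := by
    have h1 := hlim.add hV
    rw [add_zero] at h1
    refine tendsto_of_tendsto_of_tendsto_of_le_of_le tendsto_const_nhds h1 (fun n => zero_le)
      fun n => ?_
    have h2 := eLpNorm_add_le (μ := P) (p := 2)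
      ((measurable_finFunctional hξ (x n)).aestronglyMeasurable.sub hAm)
      ((measurable_initial (μ := μ) hξ (x n)).sub
        (measurable_initial (μ := μ) hξ a)).aestronglyMeasurable (by norm_num)
    refine le_trans (le_of_eq (eLpNorm_congr_ae ?_)) h2
    filter_upwards [hFV n] with ω h3
    simp only [Pi.add_apply, Pi.sub_apply] at h3 ⊢
    rw [← h3]
    ring
  have hmeas : AEStronglyMeasurable (A + initial μ s d a ξ) P :=
    hAm.add (measurable_initial hξ a).aestronglyMeasurable
  have hmem : MemLp (A + initial μ s d a ξ) 2 P := by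
    obtain ⟨n, hn⟩ := (hG.eventually (gt_mem_nhds (zero_lt_one (α := ℝ≥0∞)))).exists
    have h1 : MemLp ((U (w n) : Ω → ℂ) - (A + initial μ s d a ξ)) 2 P :=
      ⟨(Lp.aestronglyMeasurable _).sub hmeas, hn.trans ENNReal.one_lt_top⟩
    have h2 := (Lp.memLp (U (w n))).sub h1
    rwa [sub_sub_cancel] at h2
  -- the limit is in the range of `U`, and its preimage is determined by its products with `K`
  have hlimU : Tendsto (fun n => U (w n)) atTop (𝓝 (hmem.toLp _)) := by
    rw [Lp.tendsto_Lp_iff_tendsto_eLpNorm']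
    refine hG.congr fun n => eLpNorm_congr_ae ?_
    filter_upwards [hmem.coeFn_toLp] with ω h
    rw [Pi.sub_apply, Pi.sub_apply, h]
  obtain ⟨y, hy⟩ : hmem.toLp _ ∈ Set.range U :=
    U.isometry.isClosedEmbedding.isClosed_range.mem_of_tendsto hlimU
      (Eventually.of_forall fun n => ⟨w n, rfl⟩)
  have hwy : Tendsto w atTop (𝓝 y) := by
    rw [U.isometry.isClosedEmbedding.isEmbedding.tendsto_nhds_iff, hy]
    exact hlimU
  have hyB : y = S.spec.toH (S.memL2_Bchi hb) := by
    refine S.eq_of_inner_K fun j p => ?_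
    have h1 := ((innerSL ℂ (S.K j p)).continuous.tendsto y).comp hwy
    have h2 : ∀ n, inner ℂ (S.K j p) (w n) =
        if 0 ≤ j then Dop μ s d (x n) j.toNat p else 0 := fun n =>
      S.inner_K_sumJ (fun k hk => Dop_eq_zero (hN n) hk) j p
    refine tendsto_nhds_unique h1 ?_
    refine (Tendsto.congr (fun n => (h2 n).symm) ?_)
    have h3 : inner ℂ (S.K j p) (S.spec.toH (S.memL2_Bchi hb)) =
        if 0 ≤ j then Dop μ s d a j.toNat p else 0 := S.inner_K_trigSum hb j p
    rw [h3]
    split_ifs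
    · exact (tendsto_pi_nhds.1 (hxD j.toNat)) p
    · exact tendsto_const_nhds
  rw [← hyB, hy]
  exact hmem.coeFn_toLp.symm

/-- The functional exists: the finite sums of increments with the coefficients `b` converge, and the
initial values are eventually constant along the approximation. -/
lemma exists_isFunctional (S : Setting μ s d f R) (hξ : StationaryGM P s d ξ)
    (hU : ∀ k p, U (S.J k p) = incLp hξ (admissible_zstep S) k p) {a : ℕ → Fin T → ℂ}
    (hDa : DConverges μ s d a) (hb : Summable fun k => eucl (Dop μ s d a k)) :
    ∃ A, IsFunctional P μ s d a ξ A := by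
  set b := Dop μ s d a with hbdef
  set X := U (S.spec.toH (S.memL2_trigSum hb))
  -- the coefficients are chosen such that `D x_N` is the truncation of `b = D a` to `k < N`
  set x : ℕ → ℕ →₀ (Fin T → ℂ) := fun N => Finsupp.onFinset (Finset.range N) (eTrunc μ s d b N)
    fun k hk => by
      rw [Finset.mem_range]
      by_contra h
      exact hk (eTrunc_eq_zero b (not_lt.1 h))
  have hx : ∀ N, (x N : ℕ → Fin T → ℂ) = eTrunc μ s d b N := fun N => rfl
  have hD : ∀ N k, Dop μ s d (x N) k = if k < N then b k else 0 := fun N k => by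
    rw [hx, Dop_eTrunc S.step_pos S.season_pos]
  refine ⟨(X : Ω → ℂ) - initial μ s d a ξ, (Lp.aestronglyMeasurable _).sub
    (measurable_initial hξ a).aestronglyMeasurable, x, fun k => ?_, fun k => ?_, ?_⟩
  · refine tendsto_const_nhds.congr' ?_
    filter_upwards [eventually_ge_atTop (k + (nGamma μ s d + 1))] with N hN
    rw [hx, eTrunc, ← sum_eCoef_Dop S.step_pos S.season_pos hDa k]
    refine Finset.sum_subset (Finset.range_mono (by omega)) fun j _ hj => ?_
    rw [Finset.mem_range, not_lt] at hj
    rw [eCoef_eq_zero μ s d (by omega), zero_smul]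
  · refine tendsto_const_nhds.congr' ?_
    filter_upwards [eventually_gt_atTop k] with N hN
    rw [hD, if_pos hN]
  · have h1 := (S.hasSum_J hb).tendsto_sum_nat
    have h2 := (U.continuous.tendsto _).comp h1
    rw [Lp.tendsto_Lp_iff_tendsto_eLpNorm'] at h2
    refine h2.congr' ?_
    filter_upwards [eventually_gt_atTop (nGamma μ s d)] with N hN
    refine eLpNorm_congr_ae ?_
    have h3 := S.finFunctional_add_initial hξ hU (N := N) (x := x N) fun k hk =>
      eTrunc_eq_zero b hk
    have h4 : S.sumJ N (Dop μ s d (x N)) = ∑ k ∈ Finset.range N, ∑ p, b k p • S.J k p :=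
      Finset.sum_congr rfl fun k hk => by rw [hD, if_pos (Finset.mem_range.1 hk)]
    have h5 : initial μ s d (x N) ξ = initial μ s d a ξ :=
      initial_congr fun l hl => by rw [hD, if_pos (by omega)]
    rw [h4, h5] at h3
    filter_upwards [h3] with ω h6
    simp only [Function.comp_apply, Pi.sub_apply, Pi.add_apply] at h6 ⊢
    rw [← h6]
    ring

/-- The partial sums of the series are an admissible approximation, since `D` of a truncation of `a` is
a partial sum of `D a`. -/
lemma isFunctional_of_isSeriesSum {a : ℕ → Fin T → ℂ} (hDa : DConverges μ s d a) {A : Ω → ℂ}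
    (hA : IsSeriesSum P a ξ A) : IsFunctional P μ s d a ξ A := by
  set x : ℕ → ℕ →₀ (Fin T → ℂ) := fun N => Finsupp.onFinset (Finset.range N)
    (fun k => if k < N then a k else 0) fun k hk => by
      rw [Finset.mem_range]
      by_contra h
      exact hk (if_neg h)
  have hx : ∀ N k, x N k = if k < N then a k else 0 := fun N k => rfl
  refine ⟨hA.1, x, fun k => ?_, fun k => ?_, ?_⟩
  · refine tendsto_const_nhds.congr' ?_
    filter_upwards [eventually_gt_atTop k] with N hN
    rw [hx, if_pos hN]
  · refine ((tendsto_dPartial hDa k).comp (tendsto_sub_atTop_nat k)).congr fun N => ?_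
    rw [Function.comp_apply, Dop_of_eq_zero (N := N) fun j hj => by rw [hx, if_neg (by omega)]]
    refine Finset.sum_congr rfl fun j hj => ?_
    rw [Finset.mem_range] at hj
    have h := hx N (k + j)
    rw [if_pos (by omega)] at h
    exact congrArg _ h.symm
  · refine hA.2.congr fun N => ?_
    congr 2
    ext ω
    rw [finFunctional, Finsupp.sum_of_support_subset (s := Finset.range N) _
      Finsupp.support_onFinset_subset]
    · refine Finset.sum_congr rfl fun k hk => ?_
      rw [hx, if_pos (Finset.mem_range.1 hk)]
    · simp

end Setting

end Prob

/-! ### The optimal estimate -/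

lemma lintegral_enorm_sq_Lp {α : Type*} [MeasurableSpace α] {P : Measure α} (Y : Lp ℂ 2 P) :
    ∫⁻ ω, ‖Y ω‖ₑ ^ 2 ∂P = ENNReal.ofReal (‖Y‖ ^ 2) := by
  have h := eLpNorm_nnreal_pow_eq_lintegral (μ := P) (f := Y) (p := 2) (by norm_num)
  simp only [NNReal.coe_ofNat, ENNReal.rpow_ofNat, ENNReal.coe_ofNat] at h
  rw [← h, Lp.norm_def, ENNReal.ofReal_pow ENNReal.toReal_nonneg,
    ENNReal.ofReal_toReal (Lp.eLpNorm_ne_top Y)]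

lemma norm_Lp_sq {α E : Type*} [MeasurableSpace α] {P : Measure α} [NormedAddCommGroup E]
    [InnerProductSpace ℂ E] (Y : Lp E 2 P) : ‖Y‖ ^ 2 = ∫ ω, ‖Y ω‖ ^ 2 ∂P := by
  conv_lhs => rw [← Lp.toLp_coeFn Y (Lp.memLp Y)]
  exact norm_toLp_sq _

namespace Setting

variable {r T : ℕ} {μ s d : Fin r → ℕ} {f R : ℝ → Matrix (Fin T) (Fin T) ℂ}
  {Ω : Type*} [MeasurableSpace Ω] {P : Measure Ω} {ξ : ℤ → Fin T → Ω → ℂ}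
  {U : VecL2 T →ₗᵢ[ℂ] Lp ℂ 2 P} {a : ℕ → Fin T → ℂ}

lemma eq_of_FRel (S : Setting μ s d f R) {c c' b : ℕ → Fin T → ℂ} (h : FRel μ s d f c b)
    (h' : FRel μ s d f c' b) :
    c' = c := by
  obtain ⟨y, hy, hc, hyb⟩ := (FRel_iff S.inner_K_K S.inner_J_K).1 h
  obtain ⟨y', hy', hc', hyb'⟩ := (FRel_iff S.inner_K_K S.inner_J_K).1 h'
  have : y' = y := eq_of_inner_eq_of_mem_closedSpan hy' hy fun k hk p => by
    have h1 := hyb k.toNat p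
    rw [← hyb' k.toNat p, Int.toNat_of_nonneg hk] at h1
    exact h1.symm
  ext k p
  rw [← hc, ← hc', this]

/-- The component of `B χ_μ / β` in the closed span of the `K(j, p)`, `j ≥ 0`. It is orthogonal to
the past. -/
def resid (S : Setting μ s d f R) (hb : Summable fun k => eucl (Dop μ s d a k)) : VecL2 T :=
  (closedSpan S.K (Set.Ici 0)).starProjection (S.spec.toH (S.memL2_Bchi hb))

section Resid

variable (S : Setting μ s d f R) (hb : Summable fun k => eucl (Dop μ s d a k))

lemma resid_mem : S.resid hb ∈ closedSpan S.K (Set.Ici 0) :=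
  Submodule.starProjection_apply_mem _ _

lemma inner_K_resid {j : ℤ} (hj : 0 ≤ j) (p : Fin T) :
    inner ℂ (S.K j p) (S.resid hb) = inner ℂ (S.K j p) (S.spec.toH (S.memL2_Bchi hb)) := by
  rw [resid]
  generalize S.spec.toH (S.memL2_Bchi hb) = z
  have h := (Submodule.mem_orthogonal _ _).1 (Submodule.sub_starProjection_mem_orthogonal
    (K := closedSpan S.K (Set.Ici 0)) z) (S.K j p) (mem_closedSpan (Set.mem_Ici.2 hj) p)
  rw [inner_sub_right, sub_eq_zero] at h
  exact h.symm

lemma sub_resid_mem_past :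
    S.spec.toH (S.memL2_Bchi hb) - S.resid hb ∈ closedSpan S.J (Set.Iio 0) :=
  sub_starProjection_mem_past S.inner_J_K S.eq_zero_of_inner fun k hk p => by
    rw [inner_sub_right, S.inner_K_resid hb hk, sub_self]

lemma inner_J_resid {k : ℤ} (hk : k < 0) (p : Fin T) : inner ℂ (S.J k p) (S.resid hb) = 0 := by
  refine inner_eq_zero_of_mem_closedSpan (fun j hj q => ?_) (S.resid_mem hb)
  rw [S.inner_J_K, if_neg]
  rintro ⟨h, -⟩
  exact absurd hj (by rw [Set.mem_Ici]; omega)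

lemma inner_past_resid {v : VecL2 T} (hv : v ∈ closedSpan S.J (Set.Iio 0)) :
    inner ℂ v (S.resid hb) = 0 :=
  inner_eq_zero_of_mem_closedSpan' (fun _ hk p => S.inner_J_resid hb hk p) hv

/-- A vector is the residual if it is orthogonal to the past and differs from `B χ_μ / β` by an
element of the past. -/
lemma eq_sub_resid {v : VecL2 T} (hv : v ∈ closedSpan S.J (Set.Iio 0))
    (h : ∀ k : ℤ, k < 0 → ∀ p, inner ℂ (S.J k p) (S.spec.toH (S.memL2_Bchi hb) - v) = 0) :
    v = S.spec.toH (S.memL2_Bchi hb) - S.resid hb := by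
  refine eq_of_inner_eq_of_mem_closedSpan hv (S.sub_resid_mem_past hb) fun k hk p => ?_
  have h1 := h k hk p
  rw [inner_sub_right, sub_eq_zero] at h1
  rw [inner_sub_right, S.inner_J_resid hb hk, sub_zero, h1]

lemma FRel_resid :
    FRel μ s d f (fun k p => inner ℂ (S.J k p) (S.resid hb)) (Dop μ s d a) := by
  refine (FRel_iff S.inner_K_K S.inner_J_K).2 ⟨S.resid hb, S.resid_mem hb, fun _ _ => rfl,
    fun j p => ?_⟩
  rw [S.inner_K_resid hb (by positivity)]
  exact (S.inner_K_trigSum hb j p).trans (by simp)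

lemma memL2_hChar : MemL2 f (hChar μ s d f a (adj (genMat μ s d R) (S.resid hb))) := by
  refine S.spec.memL2_of_memLp ?_ ?_
  · have h1 : AEStronglyMeasurable (fun t => conj (beta s d t) / chi (zstep μ) s d (ex t)) circ := by
      refine Measurable.aestronglyMeasurable (Measurable.div ?_ ?_)
      · exact (Complex.continuous_conj.comp (continuous_beta s d)).measurable
      · have := (continuous_chi (zstep μ) s d).comp continuous_neg
        simpa [Function.comp_def] using this.measurable
    have h2 : AEStronglyMeasurable
        (fun t => adj (genMat μ s d R) (S.resid hb) t ᵥ* (f t)⁻¹) circ := by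
      refine aestronglyMeasurable_pi_iff.2 fun q => ?_
      change AEStronglyMeasurable (fun t => ∑ p,
        adj (genMat μ s d R) (S.resid hb) t p * (f t)⁻¹ p q) circ
      exact Finset.aestronglyMeasurable_fun_sum _ fun p _ =>
        (integrable_adj S.matL2_genMat _ p).1.mul
          (aestronglyMeasurable_inv (fun i j => (S.integrable i j).1) p q)
    exact (S.memL2_Bchi hb).1.sub (h1.smul h2)
  · exact (Lp.memLp _).ae_eq (S.lift_hChar a hb (S.resid hb)).symm

lemma toH_hChar : S.spec.toH (S.memL2_hChar hb) =
    S.spec.toH (S.memL2_Bchi hb) - S.resid hb :=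
  Lp.ext ((S.spec.coeFn_toH _).trans (S.lift_hChar a hb (S.resid hb)))

lemma isPastProjection_of_toH {h : ℝ → Fin T → ℂ} (hh : MemL2 f h)
    (hr : S.spec.toH hh = S.spec.toH (S.memL2_Bchi hb) - S.resid hb) :
    IsPastProjection (zstep μ) s d f (Bchi μ s d a) h := by
  refine ⟨S.memL2_Bchi hb, (S.memL2Past_iff hh).2 ?_, fun k l hk => ?_⟩
  · rw [hr]
    exact S.sub_resid_mem_past hb
  · rw [S.spec.specInner_eq (S.spec.memL2_sub (S.memL2_Bchi hb) hh) (S.memL2_gen (zstep μ) k l),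
      S.toH_gen, S.spec.toH_sub (S.memL2_Bchi hb) hh, hr, sub_sub_cancel,
      S.inner_J_resid hb (by omega)]

lemma hasSum_resid :
    HasSum (fun k => Dop μ s d a k ⬝ᵥ star (fun p => inner ℂ (S.J k p) (S.resid hb)))
      ((‖S.resid hb‖ ^ 2 : ℝ) : ℂ) := by
  have h := (innerSL ℂ (S.resid hb)).hasSum (S.hasSum_J hb)
  have h1 : inner ℂ (S.resid hb) (S.spec.toH (S.memL2_trigSum hb)) =
      ((‖S.resid hb‖ ^ 2 : ℝ) : ℂ) := by
    have h2 := S.inner_past_resid hb (S.sub_resid_mem_past hb)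
    rw [← inner_conj_symm, map_eq_zero, inner_sub_right, inner_self_eq_norm_sq_to_K,
      sub_eq_zero] at h2
    push_cast
    exact h2
  rw [innerSL_apply_apply, h1] at h
  have h3 : ∀ k : ℕ, innerSL ℂ (S.resid hb) (∑ p, Dop μ s d a k p • S.J k p) =
      Dop μ s d a k ⬝ᵥ star (fun p => inner ℂ (S.J k p) (S.resid hb)) := fun k => by
    rw [innerSL_apply_apply, inner_sum]
    refine Finset.sum_congr rfl fun p _ => ?_
    rw [inner_smul_right, Pi.star_apply, RCLike.star_def, inner_conj_symm]
  simp_rw [h3] at h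
  exact h

lemma integrable_weight : Integrable (fun t => ((weight μ s d t : ℝ) : ℂ) *
    (adj (genMat μ s d R) (S.resid hb) t ⬝ᵥ
      ((f t)⁻¹ *ᵥ star (adj (genMat μ s d R) (S.resid hb) t)))) circ :=
  (((Lp.memLp (S.resid hb)).integrable_norm_pow (by norm_num)).ofReal).congr
    (S.weight_mul_eq (S.resid hb)).symm

lemma integral_weight : ∫ t, ((weight μ s d t : ℝ) : ℂ) *
    (adj (genMat μ s d R) (S.resid hb) t ⬝ᵥ
      ((f t)⁻¹ *ᵥ star (adj (genMat μ s d R) (S.resid hb) t))) ∂circ =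
    ((‖S.resid hb‖ ^ 2 : ℝ) : ℂ) := by
  rw [integral_congr_ae (S.weight_mul_eq (S.resid hb)), norm_Lp_sq]
  exact integral_ofReal

end Resid

/-- The space of the observed increments is the image of the past subspace. -/
lemma mem_pastSpace_iff (S : Setting μ s d f R) (hξ : StationaryGM P s d ξ)
    (hU : ∀ k p, U (S.J k p) = incLp hξ (admissible_zstep S) k p) (m : ℤ) (Y : Lp ℂ 2 P) :
    Y ∈ pastSpace P (vecInc (zstep μ) s d ξ) m ↔ ∃ v ∈ closedSpan S.J (Set.Iic m), U v = Y := by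
  have h1 : {x : Lp ℂ 2 P | ∃ k ≤ m, ∃ p, x =ᵐ[P] vecInc (zstep μ) s d ξ k p} =
      U '' {v | ∃ k ∈ Set.Iic m, ∃ p, v = S.J k p} := by
    ext x
    constructor
    · rintro ⟨k, hk, p, hx⟩
      refine ⟨_, ⟨k, hk, p, rfl⟩, ?_⟩
      rw [hU]
      exact (Lp.ext (hx.trans (coeFn_incLp hξ _ k p).symm)).symm
    · rintro ⟨_, ⟨k, hk, p, rfl⟩, rfl⟩
      refine ⟨k, hk, p, ?_⟩
      rw [hU]
      exact coeFn_incLp hξ _ k p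
  have h2 : (pastSpace P (vecInc (zstep μ) s d ξ) m : Set (Lp ℂ 2 P)) =
      U '' (closedSpan S.J (Set.Iic m) : Set (VecL2 T)) := by
    rw [pastSpace, closedSpan, h1, Submodule.topologicalClosure_coe,
      Submodule.topologicalClosure_coe, ← U.isometry.isClosedEmbedding.closure_image_eq]
    congr 1
    have h3 := Submodule.map_span U.toLinearMap {v | ∃ k ∈ Set.Iic m, ∃ p, v = S.J k p}
    exact (congrArg (fun V : Submodule ℂ (Lp ℂ 2 P) => (V : Set (Lp ℂ 2 P))) h3).symm
  rw [← SetLike.mem_coe, h2]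
  rfl

section Estimate

variable (S : Setting μ s d f R) (hξ : StationaryGM P s d ξ)
  (hU : ∀ k p, U (S.J k p) = incLp hξ (admissible_zstep S) k p)
  (hb : Summable fun k => eucl (Dop μ s d a k)) {A X : Ω → ℂ}

include hU hb

omit hb in
lemma isLinearEstimate_iff : IsLinearEstimate P μ s d a ξ X ↔
    ∃ v ∈ closedSpan S.J (Set.Iio 0), X =ᵐ[P] fun ω => (U v : Ω → ℂ) ω - initial μ s d a ξ ω := by
  have hset : Set.Iic (-1 : ℤ) = Set.Iio 0 := by
    ext k
    simp only [Set.mem_Iic, Set.mem_Iio]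
    omega
  constructor
  · rintro ⟨Y, hY, hX⟩
    obtain ⟨v, hv, rfl⟩ := (S.mem_pastSpace_iff hξ hU _ _).1 hY
    exact ⟨v, by rwa [← hset], hX⟩
  · rintro ⟨v, hv, hX⟩
    exact ⟨U v, (S.mem_pastSpace_iff hξ hU _ _).2 ⟨v, by rwa [hset], rfl⟩, hX⟩

lemma sub_ae_eq (hA : IsFunctional P μ s d a ξ A) {v : VecL2 T}
    (hX : X =ᵐ[P] fun ω => (U v : Ω → ℂ) ω - initial μ s d a ξ ω) :
    (fun ω => A ω - X ω) =ᵐ[P] U (S.spec.toH (S.memL2_Bchi hb) - v) := by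
  rw [map_sub]
  filter_upwards [S.isFunctional_add_initial hξ hU hb hA, hX,
    Lp.coeFn_sub (U (S.spec.toH (S.memL2_Bchi hb))) (U v)] with ω h1 h2 h3
  rw [h3, h2, Pi.sub_apply, ← h1, Pi.add_apply]
  ring

lemma error_eq (hA : IsFunctional P μ s d a ξ A) {v : VecL2 T}
    (hX : X =ᵐ[P] fun ω => (U v : Ω → ℂ) ω - initial μ s d a ξ ω) :
    ∫⁻ ω, ‖A ω - X ω‖ₑ ^ 2 ∂P =
      ENNReal.ofReal (‖S.spec.toH (S.memL2_Bchi hb) - v‖ ^ 2) := by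
  rw [← U.norm_map, ← lintegral_enorm_sq_Lp]
  refine lintegral_congr_ae ?_
  filter_upwards [S.sub_ae_eq hξ hU hb hA hX] with ω h
  rw [h]

omit hU in
lemma norm_sub_sq_of_mem_past {v : VecL2 T} (hv : v ∈ closedSpan S.J (Set.Iio 0)) :
    ‖S.spec.toH (S.memL2_Bchi hb) - v‖ ^ 2 =
      ‖S.spec.toH (S.memL2_Bchi hb) - S.resid hb - v‖ ^ 2 + ‖S.resid hb‖ ^ 2 := by
  have h := S.inner_past_resid hb (Submodule.sub_mem _ (S.sub_resid_mem_past hb) hv)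
  have h1 := norm_add_sq_eq_norm_sq_add_norm_sq_of_inner_eq_zero (𝕜 := ℂ) _ _ h
  rw [← sq, ← sq, ← sq] at h1
  rw [← h1]
  congr 2
  abel

lemma isOptimalEstimate_iff (hA : IsFunctional P μ s d a ξ A) :
    IsOptimalEstimate P μ s d a ξ A X ↔ X =ᵐ[P] fun ω =>
      (U (S.spec.toH (S.memL2_Bchi hb) - S.resid hb) : Ω → ℂ) ω - initial μ s d a ξ ω := by
  have hmem := S.sub_resid_mem_past hb
  have hpyth := fun v => S.norm_sub_sq_of_mem_past hb (v := v)
  have herr := fun X v => S.error_eq hξ hU hb hA (X := X) (v := v)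
  have hself : S.spec.toH (S.memL2_Bchi hb) - (S.spec.toH (S.memL2_Bchi hb) - S.resid hb) =
      S.resid hb := sub_sub_cancel _ _
  generalize S.spec.toH (S.memL2_Bchi hb) - S.resid hb = w at hmem hpyth hself ⊢
  generalize S.spec.toH (S.memL2_Bchi hb) = z at hpyth herr hself
  constructor
  · rintro ⟨hX, hmin⟩
    obtain ⟨v, hv, hXv⟩ := (S.isLinearEstimate_iff hξ hU).1 hX
    have h0 : IsLinearEstimate P μ s d a ξ fun ω => (U w : Ω → ℂ) ω - initial μ s d a ξ ω :=
      (S.isLinearEstimate_iff hξ hU).2 ⟨w, hmem, EventuallyEq.rfl⟩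
    have h1 := hmin _ h0
    rw [herr X v hXv, herr _ w EventuallyEq.rfl, hself,
      ENNReal.ofReal_le_ofReal_iff (by positivity), hpyth v hv] at h1
    have h2 : ‖w - v‖ ^ 2 = 0 := le_antisymm (by linarith) (by positivity)
    rw [sq_eq_zero_iff, norm_eq_zero, sub_eq_zero] at h2
    rwa [h2]
  · intro hX
    refine ⟨(S.isLinearEstimate_iff hξ hU).2 ⟨w, hmem, hX⟩, fun X' hX' => ?_⟩
    obtain ⟨v, hv, hXv⟩ := (S.isLinearEstimate_iff hξ hU).1 hX'
    rw [herr X w hX, herr X' v hXv, hself, hpyth v hv]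
    exact ENNReal.ofReal_le_ofReal (le_add_of_nonneg_left (by positivity))

lemma memLp_error (hA : IsFunctional P μ s d a ξ A) (hX : IsOptimalEstimate P μ s d a ξ A X) :
    MemLp (fun ω => A ω - X ω) 2 P :=
  (Lp.memLp _).ae_eq
    (S.sub_ae_eq hξ hU hb hA ((S.isOptimalEstimate_iff hξ hU hb hA).1 hX)).symm

lemma integral_error (hA : IsFunctional P μ s d a ξ A) (hX : IsOptimalEstimate P μ s d a ξ A X) :
    ∫ ω, ‖A ω - X ω‖ ^ 2 ∂P = ‖S.resid hb‖ ^ 2 := by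
  have h := S.sub_ae_eq hξ hU hb hA ((S.isOptimalEstimate_iff hξ hU hb hA).1 hX)
  rw [sub_sub_cancel] at h
  rw [← U.norm_map, norm_Lp_sq]
  refine integral_congr_ae ?_
  filter_upwards [h] with ω h
  rw [h]

lemma isSpectralIntegral_of_toH (hA : IsFunctional P μ s d a ξ A)
    (hX : IsOptimalEstimate P μ s d a ξ A X) {Z : ℝ → Fin T → Ω → ℂ}
    (hZ : SpectralRep P s d ξ f Z) {h : ℝ → Fin T → ℂ} (hh : MemL2 f h)
    (hr : S.spec.toH hh = S.spec.toH (S.memL2_Bchi hb) - S.resid hb) :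
    IsSpectralIntegral P f Z h fun ω => X ω + initial μ s d a ξ ω := by
  rw [S.isSpectralIntegral_iff_of_spectralRep hξ hU hZ hh, hr]
  filter_upwards [(S.isOptimalEstimate_iff hξ hU hb hA).1 hX] with ω h1
  rw [h1]
  ring

end Estimate

end Setting

/-! ### The canonical factorization: the function `ρ` -/

lemma measurePreserving_neg_circ : MeasurePreserving (fun t : ℝ => -t) circ circ := by
  refine ⟨measurable_neg, ?_⟩
  rw [circ_eq, Measure.map_smul]
  congr 1
  have h := (Measure.measurePreserving_neg (volume : Measure ℝ)).restrict_preimage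
    (measurableSet_Ico (a := -Real.pi) (b := Real.pi))
  have h2 : Neg.neg ⁻¹' Set.Ico (-Real.pi) Real.pi = Set.Ioc (-Real.pi) Real.pi := by
    ext t
    simp only [Set.mem_preimage, Set.mem_Ico, Set.mem_Ioc]
    constructor <;> rintro ⟨h1, h2⟩ <;> constructor <;> linarith
  rw [h2, ← restrict_Ico_eq_restrict_Ioc] at h
  exact h.map_eq

section Factor

variable {r T q : ℕ} {μ s d : Fin r → ℕ} {f R : ℝ → Matrix (Fin T) (Fin T) ℂ}
  {Ω : Type*} [MeasurableSpace Ω] {P : Measure Ω} {ξ : ℤ → Fin T → Ω → ℂ}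
  {φ : ℕ → Matrix (Fin T) (Fin q) ℂ} {Φ : ℝ → Matrix (Fin T) (Fin q) ℂ} {ε : ℤ → Fin q → Ω → ℂ}
  {a : ℕ → Fin T → ℂ}

namespace CanonicalFactorization

lemma integrable (hC : CanonicalFactorization P μ s d ξ f φ Φ ε) (i : Fin T) (j : Fin q) :
    Integrable (fun t => Φ t i j) circ := by
  have h := measurePreserving_neg_circ.integrable_comp_of_integrable (hC.fourier i j).1
  simpa [Function.comp_def] using h

lemma integral_ex_mul (hC : CanonicalFactorization P μ s d ξ f φ Φ ε) (n : ℤ) (i : Fin T)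
    (j : Fin q) : ∫ t, ex (-(t * n)) * Φ t i j ∂circ =
      if n ≤ 0 then φ (-n).toNat i j else 0 := by
  have hneg : ∫ t, ex (-(t * n)) * Φ t i j ∂circ = ∫ t, ex (t * n) * Φ (-t) i j ∂circ := by
    have h := measurePreserving_neg_circ.integral_comp
      (MeasurableEquiv.neg ℝ).measurableEmbedding fun t => ex (-(t * n)) * Φ t i j
    simpa using h.symm
  rw [hneg]
  split_ifs with hn
  · have h := (hC.fourier i j).2.1 (-n).toNat
    have : (((-n).toNat : ℕ) : ℝ) = -(n : ℝ) := by
      have : (((-n).toNat : ℕ) : ℤ) = -n := Int.toNat_of_nonneg (by omega)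
      exact_mod_cast this
    rw [this] at h
    simpa using h
  · have h := (hC.fourier i j).2.2 (n - 1).toNat
    have : (((n - 1).toNat : ℕ) : ℝ) = (n : ℝ) - 1 := by
      have : (((n - 1).toNat : ℕ) : ℤ) = n - 1 := Int.toNat_of_nonneg (by omega)
      exact_mod_cast this
    rw [this] at h
    simpa only [sub_add_cancel, smul_eq_mul] using h

lemma mul_conjTranspose (hC : CanonicalFactorization P μ s d ξ f φ Φ ε) :
    ∀ᵐ t ∂circ, Φ t * (Φ t)ᴴ = ((‖ratio (zstep μ) s d t‖ ^ 2 : ℝ) : ℂ) • f t := by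
  filter_upwards [hC.factorization] with t h
  rw [← h, ratio, norm_div, div_pow]

lemma matL2 (hC : CanonicalFactorization P μ s d ξ f φ Φ ε) (S : Setting μ s d f R) : MatL2 Φ := by
  intro i j
  have hmeas := (hC.integrable i j).1
  rw [memLp_two_iff_integrable_sq_norm hmeas]
  have hint : Integrable (fun t => ((‖ratio (zstep μ) s d t‖ ^ 2 : ℝ) : ℂ) * f t i i) circ := by
    have hu := memLp_ratio (zstep μ) s d S.season_pos ⊤
    have h1 : Integrable (fun t => conj (ratio (zstep μ) s d t) *
        (ratio (zstep μ) s d t * f t i i)) circ :=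
      ((S.integrable i i).mul_of_top_right hu).mul_of_top_right (MemLp.conj_fun hu)
    refine h1.congr (Eventually.of_forall fun t => ?_)
    simp only
    rw [← mul_assoc, mul_comm (conj _), Complex.mul_conj, Complex.normSq_eq_norm_sq]
  refine hint.norm.mono' (hmeas.norm.pow 2) ?_
  filter_upwards [hC.mul_conjTranspose] with t ht
  have h1 : ((‖ratio (zstep μ) s d t‖ ^ 2 : ℝ) : ℂ) * f t i i =
      ((∑ k, ‖Φ t i k‖ ^ 2 : ℝ) : ℂ) := by
    have h2 := congrFun (congrFun ht i) i
    rw [Matrix.smul_apply, smul_eq_mul] at h2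
    rw [← h2, Matrix.mul_apply]
    push_cast
    refine Finset.sum_congr rfl fun k _ => ?_
    rw [Matrix.conjTranspose_apply, RCLike.star_def, Complex.mul_conj, Complex.normSq_eq_norm_sq]
    push_cast
    rfl
  rw [h1, Complex.norm_real, Real.norm_of_nonneg (by positivity), Real.norm_of_nonneg (by positivity)]
  exact Finset.single_le_sum (f := fun k => ‖Φ t i k‖ ^ 2) (fun k _ => by positivity)
    (Finset.mem_univ j)

end CanonicalFactorization

/-- The function `Φᵀ B`. -/
def PhiB (Φ : ℝ → Matrix (Fin T) (Fin q) ℂ) (b : ℕ → Fin T → ℂ) (t : ℝ) : Fin q → ℂ :=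
  (Φ t)ᵀ *ᵥ trigSum b t

lemma memLp_PhiB (hΦ : MatL2 Φ) {b : ℕ → Fin T → ℂ} (hb : Summable fun k => eucl (b k)) :
    MemLp (fun t => WithLp.toLp 2 (PhiB Φ b t)) 2 circ := by
  refine memLp_toLp_iff.2 fun j => ?_
  change MemLp (fun t => ∑ p, Φ t p j * trigSum b t p) 2 circ
  refine memLp_finsetSum _ fun p _ => ?_
  have h := (hΦ p j).mul' (memLp_trigSum hb p ⊤) (r := 2)
  simpa only [mul_comm] using h

/-- The Fourier coefficients of `Φᵀ B` with nonnegative index are the vectors `(D A φ)_k`. -/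
lemma hasSum_DAphi (hC : CanonicalFactorization P μ s d ξ f φ Φ ε)
    (hb : Summable fun k => eucl (Dop μ s d a k)) (k : ℕ) :
    HasSum (fun m => (φ m)ᵀ *ᵥ Dop μ s d (fun l => a (l + k)) m)
      (fun j => ∫ t, ex (-(t * k)) * PhiB Φ (Dop μ s d a) t j ∂circ) := by
  set b := Dop μ s d a with hbdef
  rw [Pi.hasSum]
  intro j
  have hp : ∀ p, HasSum (fun m => φ m p j * b (k + m) p)
      (∫ t, ex (-(t * k)) * (Φ t p j * trigSum b t p) ∂circ) := by
    intro p
    have hterm : ∀ (l : ℕ) (t : ℝ), ex (-(t * k)) * (Φ t p j * (ex (t * l) * b l p)) =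
        ex (-(t * ((k - l : ℤ) : ℝ))) * Φ t p j * b l p := by
      intro l t
      have : ex (-(t * ((k - l : ℤ) : ℝ))) = ex (-(t * k)) * ex (t * l) := by
        rw [← ex_add]
        congr 1
        push_cast
        ring
      rw [this]
      ring
    have hint : ∀ l : ℕ, Integrable (fun t => ex (-(t * k)) * (Φ t p j * (ex (t * l) * b l p)))
        circ := by
      intro l
      simp_rw [hterm l]
      have := integrable_ex_mul' (hC.integrable p j) (-((k - l : ℤ) : ℝ))
      simp only [mul_neg] at this
      exact this.mul_const _
    have h := hasSum_integral_of_summable_integral_norm hint (by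
      refine (hb.mul_left (∫ t, ‖Φ t p j‖ ∂circ)).of_nonneg_of_le
        (fun l => by positivity) fun l => ?_
      simp only [norm_mul, norm_ex, one_mul]
      rw [integral_mul_const]
      exact mul_le_mul_of_nonneg_left (norm_apply_le_eucl _ p) (by positivity))
    have hsum : ∀ t, ∑' l : ℕ, ex (-(t * k)) * (Φ t p j * (ex (t * l) * b l p)) =
        ex (-(t * k)) * (Φ t p j * trigSum b t p) := fun t =>
      ((((Pi.hasSum.1 (hasSum_trigSum hb t)) p).mul_left _).mul_left _).tsum_eq
    simp_rw [hsum, hterm, integral_mul_const, hC.integral_ex_mul] at h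
    rw [← (add_right_injective k).hasSum_iff] at h
    · have h3 : ∀ m : ℕ, (if (k : ℤ) - ((k + m : ℕ) : ℤ) ≤ 0 then
          φ (-((k : ℤ) - ((k + m : ℕ) : ℤ))).toNat p j else 0) * b (k + m) p =
          φ m p j * b (k + m) p := fun m => by
        rw [if_pos (by omega), show (-((k : ℤ) - ((k + m : ℕ) : ℤ))).toNat = m by omega]
      simp only [Function.comp_def, h3] at h
      exact h
    · intro l hl
      rw [if_neg, zero_mul]
      intro h1
      exact hl ⟨l - k, by simp only; omega⟩
  have h := hasSum_sum (s := Finset.univ) fun p _ => hp p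
  have hR : ∑ p, ∫ t, ex (-(t * k)) * (Φ t p j * trigSum b t p) ∂circ =
      ∫ t, ex (-(t * k)) * PhiB Φ b t j ∂circ := by
    rw [← integral_finsetSum]
    · refine integral_congr_ae (Eventually.of_forall fun t => ?_)
      simp only [PhiB, Matrix.mulVec, dotProduct, Matrix.transpose_apply, Finset.mul_sum]
    · intro p _
      have h1 : Integrable (fun t => Φ t p j * trigSum b t p) circ :=
        (hC.integrable p j).mul_of_top_left (memLp_trigSum hb p ⊤)
      have := integrable_ex_mul' h1 (-(k : ℝ))
      simpa only [mul_neg] using this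
  rw [hR] at h
  simp_rw [Dop_shift]
  exact h

/-- The analytic part of `Φᵀ B`. -/
def anaPart (hΦ : MatL2 Φ) (hb : Summable fun k => eucl (Dop μ s d a k)) : VecL2 q :=
  (closedSpan (vecEx q) (Set.Ici 0)).starProjection ((memLp_PhiB hΦ hb).toLp _)

lemma inner_vecEx_vecEx (j k : ℤ) (i l : Fin q) :
    inner ℂ (vecEx q j i) (vecEx q k l) = if j = k ∧ i = l then 1 else 0 := by
  obtain ⟨b, hb⟩ := exists_hilbertBasis_vecEx q
  rw [← hb, ← hb, (orthonormal_iff_ite.1 b.orthonormal)]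
  simp only [Prod.mk.injEq]

lemma eq_zero_of_inner_vecEx {y : VecL2 q} (h : ∀ k p, inner ℂ (vecEx q k p) y = 0) : y = 0 :=
  eq_zero_of_inner_col (matL2_one q) (N := fun _ => 1) (by simp) h

section AnaPart

variable (hΦ : MatL2 Φ) (hb : Summable fun k => eucl (Dop μ s d a k))

lemma inner_vecEx_anaPart {k : ℤ} (hk : 0 ≤ k) (j : Fin q) :
    inner ℂ (vecEx q k j) (anaPart hΦ hb) =
      inner ℂ (vecEx q k j) ((memLp_PhiB hΦ hb).toLp _) := by
  rw [anaPart]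
  generalize (memLp_PhiB hΦ hb).toLp _ = z
  have h := (Submodule.mem_orthogonal _ _).1 (Submodule.sub_starProjection_mem_orthogonal
    (K := closedSpan (vecEx q) (Set.Ici 0)) z) (vecEx q k j) (mem_closedSpan (Set.mem_Ici.2 hk) j)
  rw [inner_sub_right, sub_eq_zero] at h
  exact h.symm

lemma inner_vecEx_anaPart_of_neg {k : ℤ} (hk : k < 0) (j : Fin q) :
    inner ℂ (vecEx q k j) (anaPart hΦ hb) = 0 := by
  refine inner_eq_zero_of_mem_closedSpan (fun l hl i => ?_)
    (Submodule.starProjection_apply_mem _ _)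
  rw [inner_vecEx_vecEx, if_neg]
  rintro ⟨h, -⟩
  exact absurd hl (by rw [Set.mem_Ici]; omega)

lemma sub_anaPart_mem :
    (memLp_PhiB hΦ hb).toLp _ - anaPart hΦ hb ∈ closedSpan (vecEx q) (Set.Iio 0) :=
  sub_starProjection_mem_past inner_vecEx_vecEx
    (fun z h1 h2 => eq_zero_of_inner_vecEx fun k p => by
      rcases lt_or_ge k 0 with hk | hk
      · exact h1 k hk p
      · exact h2 k hk p) fun k hk p => by
    rw [inner_sub_right, inner_vecEx_anaPart hΦ hb hk, sub_self]

lemma inner_vecEx_anaPart_eq (hC : CanonicalFactorization P μ s d ξ f φ Φ ε) (k : ℕ) (j : Fin q) :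
    inner ℂ (vecEx q k j) (anaPart hΦ hb) = DAphi μ s d a φ k j := by
  rw [inner_vecEx_anaPart hΦ hb (by positivity), inner_vecEx, DAphi, (hasSum_DAphi hC hb k).tsum_eq]
  refine integral_congr_ae ?_
  filter_upwards [(memLp_PhiB hΦ hb).coeFn_toLp] with t ht
  rw [ht]
  simp

lemma isFourierSum_anaPart (hC : CanonicalFactorization P μ s d ξ f φ Φ ε) :
    IsFourierSum (fun t => (anaPart hΦ hb t).ofLp) (DAphi μ s d a φ) := by
  have hint : Integrable (fun t => (anaPart hΦ hb t).ofLp) circ :=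
    Integrable.of_eval fun j => ((anaPart hΦ hb).memLp_apply j).integrable (by norm_num)
  refine ⟨hint, fun k => ?_, fun k => ?_⟩
  · ext j
    have h2 : Integrable (fun t => ex (-(t * (k : ℝ))) • (anaPart hΦ hb t).ofLp) circ := by
      have := integrable_ex_mul hint (-(k : ℝ))
      simpa using this
    rw [eval_integral fun i => h2.eval i, ← inner_vecEx_anaPart_eq hΦ hb hC, inner_vecEx]
    simp
  · ext j
    rw [eval_integral fun i => (integrable_ex_mul hint _).eval i, Pi.zero_apply,
      ← inner_vecEx_anaPart_of_neg hΦ hb (k := -((k : ℤ) + 1)) (by omega) j, inner_vecEx]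
    refine integral_congr_ae (Eventually.of_forall fun t => ?_)
    simp only [Pi.smul_apply, smul_eq_mul]
    congr 2
    push_cast
    ring

lemma integrable_anaPart : Integrable (fun t => eucl (anaPart hΦ hb t).ofLp ^ 2) circ :=
  (Lp.memLp (anaPart hΦ hb)).integrable_norm_pow (by norm_num)

lemma integral_anaPart : ∫ t, eucl (anaPart hΦ hb t).ofLp ^ 2 ∂circ = ‖anaPart hΦ hb‖ ^ 2 := by
  rw [norm_Lp_sq]
  rfl

lemma hasSum_anaPart (hC : CanonicalFactorization P μ s d ξ f φ Φ ε) :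
    HasSum (fun k => eucl (DAphi μ s d a φ k) ^ 2) (‖anaPart hΦ hb‖ ^ 2) := by
  obtain ⟨b, hbas⟩ := exists_hilbertBasis_vecEx q
  have h := b.hasSum_inner_mul_inner (anaPart hΦ hb) (anaPart hΦ hb)
  have h1 : ∀ i, inner ℂ (anaPart hΦ hb) (b i) * inner ℂ (b i) (anaPart hΦ hb) =
      ((‖inner ℂ (b i) (anaPart hΦ hb)‖ ^ 2 : ℝ) : ℂ) := fun i => by
    rw [← inner_conj_symm, mul_comm, Complex.mul_conj, Complex.normSq_eq_norm_sq]
  simp_rw [h1] at h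
  rw [inner_self_eq_norm_sq_to_K] at h
  have h2 : HasSum (fun i => ‖inner ℂ (b i) (anaPart hΦ hb)‖ ^ 2) (‖anaPart hΦ hb‖ ^ 2) := by
    rw [← Complex.hasSum_ofReal]
    push_cast at h ⊢
    exact h
  have hinj : Function.Injective fun x : ℕ × Fin q => ((x.1 : ℤ), x.2) := by
    rintro ⟨k, i⟩ ⟨l, j⟩ h
    simp only [Prod.mk.injEq, Nat.cast_inj] at h
    exact Prod.ext h.1 h.2
  rw [← hinj.hasSum_iff] at h2
  · refine h2.prod_fiberwise fun k => ?_
    rw [eucl_sq]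
    have h3 : ∀ j, ‖DAphi μ s d a φ k j‖ ^ 2 = ‖inner ℂ (b ((k : ℤ), j)) (anaPart hΦ hb)‖ ^ 2 :=
      fun j => by rw [hbas, inner_vecEx_anaPart_eq hΦ hb hC]
    simp_rw [h3]
    exact hasSum_fintype _
  · rintro ⟨k, j⟩ hk
    have hk' : k < 0 := by
      by_contra h
      exact hk ⟨(k.toNat, j), by simp [Int.toNat_of_nonneg (not_lt.1 h)]⟩
    rw [hbas, inner_vecEx_anaPart_of_neg hΦ hb hk']
    simp

end AnaPart

end Factor

/-! ### The canonical factorization: the innovations -/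

/-- The subspace generated by random variables up to almost sure equality is the closed span of their
classes in `L²(P)`. -/
lemma pastSpace_eq_closedSpan {T : ℕ} {Ω : Type*} [MeasurableSpace Ω] {P : Measure Ω}
    {X : ℤ → Fin T → Ω → ℂ} (h : ∀ k p, MemLp (X k p) 2 P) (m : ℤ) :
    pastSpace P X m = closedSpan (fun k p => (h k p).toLp (X k p)) (Set.Iic m) := by
  rw [pastSpace, closedSpan]
  congr 2
  ext x
  constructor
  · rintro ⟨k, hk, p, hx⟩
    exact ⟨k, hk, p, Lp.ext (hx.trans (h k p).coeFn_toLp.symm)⟩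
  · rintro ⟨k, hk, p, rfl⟩
    exact ⟨k, hk, p, (h k p).coeFn_toLp⟩

/-- If `E` is orthonormal and generates the same pasts as `X`, then `E` has no more components
than `X`: the components of `E` at time `0` are orthogonal to the past, so that they lie in the span
of the innovations of the components of `X`. -/
lemma card_le_of_closedSpan_eq {H : Type*} [NormedAddCommGroup H] [InnerProductSpace ℂ H]
    [CompleteSpace H] {q T : ℕ} {E : ℤ → Fin q → H} {X : ℤ → Fin T → H}
    (hE : ∀ u v k j, inner ℂ (E u k) (E v j) = if u = v ∧ k = j then 1 else 0)
    (h : ∀ m, closedSpan X (Set.Iic m) = closedSpan E (Set.Iic m)) : q ≤ T := by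
  set V := closedSpan X (Set.Iic (-1))
  set W := Submodule.span ℂ (Set.range fun p => Vᗮ.starProjection (X 0 p))
  have : FiniteDimensional ℂ W := FiniteDimensional.span_of_finite ℂ (Set.finite_range _)
  have h1 : closedSpan X (Set.Iic 0) ≤ W.comap (Vᗮ.starProjection : H →ₗ[ℂ] H) := by
    refine closedSpan_le ?_ fun k hk p => ?_
    · exact W.closed_of_finiteDimensional.preimage (Vᗮ.starProjection).continuous
    · rcases eq_or_lt_of_le (Set.mem_Iic.1 hk) with rfl | hlt
      · exact Submodule.subset_span ⟨p, rfl⟩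
      · have h2 : X k p ∈ V := mem_closedSpan (Set.mem_Iic.2 (by omega)) p
        have h3 : Vᗮ.starProjection (X k p) = 0 := by
          rw [Submodule.starProjection_apply_eq_zero_iff]
          exact Submodule.le_orthogonal_orthogonal V h2
        change Vᗮ.starProjection (X k p) ∈ W
        rw [h3]
        exact W.zero_mem
  have h2 : ∀ j, E 0 j ∈ W := by
    intro j
    have h3 : E 0 j ∈ closedSpan X (Set.Iic 0) := by
      rw [h]
      exact mem_closedSpan (Set.mem_Iic.2 le_rfl) j
    have h4 : E 0 j ∈ Vᗮ := by
      rw [Submodule.mem_orthogonal]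
      intro v hv
      rw [show V = _ from h (-1)] at hv
      refine inner_eq_zero_of_mem_closedSpan' (fun k hk i => ?_) hv
      rw [hE, if_neg]
      rintro ⟨rfl, -⟩
      exact absurd (Set.mem_Iic.1 hk) (by norm_num)
    have h5 := h1 h3
    rw [← Submodule.starProjection_eq_self_iff.2 h4]
    exact h5
  have hli : LinearIndependent ℂ (E 0) := by
    refine Orthonormal.linearIndependent (orthonormal_iff_ite.2 fun i j => ?_)
    rw [hE]
    simp
  have h6 := Submodule.finrank_mono (Submodule.span_le.2 (Set.range_subset_iff.2 h2) :
    Submodule.span ℂ (Set.range (E 0)) ≤ W)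
  rw [finrank_span_eq_card hli, Fintype.card_fin] at h6
  refine h6.trans ((finrank_range_le_card _).trans ?_)
  rw [Fintype.card_fin]

section Factor

variable {r T q : ℕ} {μ s d : Fin r → ℕ} {f R : ℝ → Matrix (Fin T) (Fin T) ℂ}
  {Ω : Type*} [MeasurableSpace Ω] {P : Measure Ω} {ξ : ℤ → Fin T → Ω → ℂ}
  {a : ℕ → Fin T → ℂ}

namespace CanonicalFactorization

/-- The innovations as elements of `L²(P)`. -/
def epsLp {φ : ℕ → Matrix (Fin T) (Fin q) ℂ} {Φ : ℝ → Matrix (Fin T) (Fin q) ℂ}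
    {ε : ℤ → Fin q → Ω → ℂ} (hC : CanonicalFactorization P μ s d ξ f φ Φ ε) (m : ℤ) (j : Fin q) :
    Lp ℂ 2 P := (hC.memLp m j).toLp _

section General

variable {φ : ℕ → Matrix (Fin T) (Fin q) ℂ} {Φ : ℝ → Matrix (Fin T) (Fin q) ℂ}
  {ε : ℤ → Fin q → Ω → ℂ}

lemma inner_epsLp (hC : CanonicalFactorization P μ s d ξ f φ Φ ε) (u v : ℤ) (k j : Fin q) :
    inner ℂ (hC.epsLp u k) (hC.epsLp v j) = if u = v ∧ k = j then 1 else 0 := by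
  rw [epsLp, epsLp, inner_toLp_eq, hC.orthonormal]
  simp only [eq_comm]

/-- The number of innovations is the dimension of the process: the spectral density would be
degenerate if it were smaller. -/
lemma card_eq (hC : CanonicalFactorization P μ s d ξ f φ Φ ε) (S : Setting μ s d f R)
    (hξ : StationaryGM P s d ξ) : q = T := by
  refine le_antisymm ?_ ?_
  · refine card_le_of_closedSpan_eq (E := hC.epsLp) (X := incLp hξ (admissible_zstep S))
      hC.inner_epsLp fun m => ?_
    have h := hC.innovation m
    rw [pastSpace_eq_closedSpan (hξ.memLp _ (admissible_zstep S)),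
      pastSpace_eq_closedSpan hC.memLp] at h
    exact h
  · obtain ⟨t, h1, h2, h3⟩ :=
      (hC.mul_conjTranspose.and (S.minimality.1.and S.ae_ratio_ne_zero)).exists
    have h4 : IsUnit (Φ t * (Φ t)ᴴ) := by
      rw [h1, Matrix.isUnit_iff_isUnit_det, Matrix.det_smul]
      refine (IsUnit.mk0 _ (pow_ne_zero _ ?_)).mul h2
      have := norm_pos_iff.2 h3
      exact_mod_cast (by positivity : ‖ratio (zstep μ) s d t‖ ^ 2 ≠ 0)
    have h5 := Matrix.rank_of_isUnit _ h4
    rw [Fintype.card_fin] at h5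
    rw [← h5]
    exact (Matrix.rank_mul_le_left _ _).trans ((Matrix.rank_le_width _).trans le_rfl)

end General

variable {φ : ℕ → Matrix (Fin T) (Fin T) ℂ} {Φ : ℝ → Matrix (Fin T) (Fin T) ℂ}
  {ε : ℤ → Fin T → Ω → ℂ}

lemma ae_isUnit (hC : CanonicalFactorization P μ s d ξ f φ Φ ε) (S : Setting μ s d f R) :
    ∀ᵐ t ∂circ, IsUnit (Φ t).det := by
  filter_upwards [hC.mul_conjTranspose, S.minimality.1, S.ae_ratio_ne_zero] with t h1 h2 h3
  have h4 : IsUnit (Φ t * (Φ t)ᴴ).det := by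
    rw [h1, Matrix.det_smul]
    refine (IsUnit.mk0 _ (pow_ne_zero _ ?_)).mul h2
    have := norm_pos_iff.2 h3
    exact_mod_cast (by positivity : ‖ratio (zstep μ) s d t‖ ^ 2 ≠ 0)
  rw [Matrix.det_mul] at h4
  exact isUnit_of_mul_isUnit_left h4

end CanonicalFactorization

/-- The unitary matrix function whose columns are the images of the innovations. -/
def innMat (μ s d : Fin r → ℕ) (R Φ : ℝ → Matrix (Fin T) (Fin T) ℂ) (t : ℝ) :
    Matrix (Fin T) (Fin T) ℂ :=
  genMat μ s d R t * ((Φ t)⁻¹)ᵀ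

namespace CanonicalFactorization

variable {φ : ℕ → Matrix (Fin T) (Fin T) ℂ} {Φ : ℝ → Matrix (Fin T) (Fin T) ℂ}
  {ε : ℤ → Fin T → Ω → ℂ}

lemma innMat_mul (hC : CanonicalFactorization P μ s d ξ f φ Φ ε) (S : Setting μ s d f R) :
    ∀ᵐ t ∂circ, innMat μ s d R Φ t * (Φ t)ᵀ = genMat μ s d R t := by
  filter_upwards [hC.ae_isUnit S] with t h
  rw [innMat, Matrix.mul_assoc, ← Matrix.transpose_mul, Matrix.mul_nonsing_inv _ h,
    Matrix.transpose_one, Matrix.mul_one]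

lemma conjTranspose_genMat_mul_innMat (hC : CanonicalFactorization P μ s d ξ f φ Φ ε)
    (S : Setting μ s d f R) :
    ∀ᵐ t ∂circ, (genMat μ s d R t)ᴴ * innMat μ s d R Φ t = (Φ t)ᴴᵀ := by
  filter_upwards [hC.ae_isUnit S, hC.mul_conjTranspose, S.spec.mul] with t h1 h2 h3
  rw [innMat, ← Matrix.mul_assoc, genMat_conjTranspose_mul μ s d h3, ← Matrix.transpose_smul, ← h2,
    ← Matrix.transpose_mul, ← Matrix.mul_assoc, Matrix.nonsing_inv_mul _ h1, Matrix.one_mul]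

lemma conjTranspose_innMat_mul (hC : CanonicalFactorization P μ s d ξ f φ Φ ε)
    (S : Setting μ s d f R) : ∀ᵐ t ∂circ, (innMat μ s d R Φ t)ᴴ * innMat μ s d R Φ t = 1 := by
  filter_upwards [hC.ae_isUnit S, hC.conjTranspose_genMat_mul_innMat S] with t h1 h2
  have h3 : (innMat μ s d R Φ t)ᴴ = ((Φ t)⁻¹)ᵀᴴ * (genMat μ s d R t)ᴴ := by
    rw [innMat, Matrix.conjTranspose_mul]
  rw [h3, Matrix.mul_assoc, h2]
  have h4 : ((Φ t)⁻¹)ᵀᴴ * (Φ t)ᴴᵀ = ((Φ t)ᴴ * (Φ t)⁻¹ᴴ)ᵀ := by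
    rw [Matrix.transpose_mul]
    rfl
  rw [h4, ← Matrix.conjTranspose_mul, Matrix.nonsing_inv_mul _ h1, Matrix.conjTranspose_one,
    Matrix.transpose_one]

lemma norm_innMat_mulVec (hC : CanonicalFactorization P μ s d ξ f φ Φ ε) (S : Setting μ s d f R) :
    ∀ᵐ t ∂circ, ∀ v, ‖(WithLp.toLp 2 (innMat μ s d R Φ t *ᵥ v) : EuclideanSpace ℂ (Fin T))‖ =
      ‖(WithLp.toLp 2 v : EuclideanSpace ℂ (Fin T))‖ := by
  filter_upwards [hC.conjTranspose_innMat_mul S] with t h v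
  have h1 : ∀ w : Fin T → ℂ,
      ((‖(WithLp.toLp 2 w : EuclideanSpace ℂ (Fin T))‖ ^ 2 : ℝ) : ℂ) = star w ⬝ᵥ w := by
    intro w
    rw [EuclideanSpace.norm_sq_eq]
    simp only [dotProduct, Pi.star_apply, RCLike.star_def]
    push_cast
    refine Finset.sum_congr rfl fun i _ => ?_
    rw [mul_comm, Complex.mul_conj, Complex.normSq_eq_norm_sq]
    push_cast
    rfl
  have h2 : star (innMat μ s d R Φ t *ᵥ v) ⬝ᵥ (innMat μ s d R Φ t *ᵥ v) = star v ⬝ᵥ v := by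
    rw [Matrix.star_mulVec, Matrix.dotProduct_mulVec, Matrix.vecMul_vecMul, h, Matrix.vecMul_one]
  rw [← h1, ← h1] at h2
  have h3 : ‖(WithLp.toLp 2 (innMat μ s d R Φ t *ᵥ v) : EuclideanSpace ℂ (Fin T))‖ ^ 2 =
      ‖(WithLp.toLp 2 v : EuclideanSpace ℂ (Fin T))‖ ^ 2 := by exact_mod_cast h2
  exact (pow_left_inj₀ (norm_nonneg _) (norm_nonneg _) two_ne_zero).1 h3

lemma aestronglyMeasurable_inv (hC : CanonicalFactorization P μ s d ξ f φ Φ ε) (i j : Fin T) :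
    AEStronglyMeasurable (fun t => (Φ t)⁻¹ i j) circ :=
  GM.aestronglyMeasurable_inv (fun i j => (hC.integrable i j).1) i j

lemma aestronglyMeasurable_innMat (hC : CanonicalFactorization P μ s d ξ f φ Φ ε)
    (S : Setting μ s d f R) (i j : Fin T) :
    AEStronglyMeasurable (fun t => innMat μ s d R Φ t i j) circ := by
  change AEStronglyMeasurable (fun t => ∑ k, genMat μ s d R t i k * (Φ t)⁻¹ j k) circ
  exact Finset.aestronglyMeasurable_fun_sum _ fun k _ =>
    (S.matL2_genMat i k).1.mul (hC.aestronglyMeasurable_inv j k)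

lemma matL2_innMat (hC : CanonicalFactorization P μ s d ξ f φ Φ ε) (S : Setting μ s d f R) :
    MatL2 (innMat μ s d R Φ) := fun i j => by
  refine MemLp.of_bound (hC.aestronglyMeasurable_innMat S i j) 1 ?_
  filter_upwards [hC.norm_innMat_mulVec S] with t h
  have h1 := h (Pi.single j 1)
  have h2 : ‖(WithLp.toLp 2 (Pi.single j 1) : EuclideanSpace ℂ (Fin T))‖ = 1 := by
    simp
  rw [h2, Matrix.mulVec_single_one] at h1
  rw [← h1]
  exact PiLp.norm_apply_le (WithLp.toLp 2 ((innMat μ s d R Φ t).col j)) i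

/-- The images of the innovations in `VecL2 T`. -/
def E (hC : CanonicalFactorization P μ s d ξ f φ Φ ε) (S : Setting μ s d f R) (k : ℤ)
    (j : Fin T) : VecL2 T := col (hC.matL2_innMat S) k j

lemma inner_E_E (hC : CanonicalFactorization P μ s d ξ f φ Φ ε) (S : Setting μ s d f R) (j k : ℤ)
    (p i : Fin T) : inner ℂ (hC.E S j p) (hC.E S k i) = inner ℂ (vecEx T j p) (vecEx T k i) := by
  rw [E, E, vecEx, vecEx, inner_col_col, inner_col_col]
  refine integral_congr_ae ?_
  filter_upwards [hC.conjTranspose_innMat_mul S] with t h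
  rw [h]
  simp

lemma inner_J_E (hC : CanonicalFactorization P μ s d ξ f φ Φ ε) (S : Setting μ s d f R) (k m : ℤ)
    (p j : Fin T) : inner ℂ (S.J k p) (hC.E S m j) =
      if m ≤ k then conj (φ (k - m).toNat p j) else 0 := by
  rw [Setting.J, E, inner_col_col]
  have h : ∫ t, ex (t * ((m : ℝ) - k)) * ((genMat μ s d R t)ᴴ * innMat μ s d R Φ t) p j ∂circ =
      ∫ t, conj (ex (-(t * ((m - k : ℤ) : ℝ))) * Φ t p j) ∂circ := by
    refine integral_congr_ae ?_
    filter_upwards [hC.conjTranspose_genMat_mul_innMat S] with t h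
    rw [h, map_mul, conj_ex, neg_neg]
    push_cast
    rfl
  rw [h, integral_conj, hC.integral_ex_mul]
  by_cases hmk : m ≤ k
  · rw [if_pos hmk, if_pos (by omega), neg_sub]
  · rw [if_neg hmk, if_neg (by omega), map_zero]

lemma inner_incLp_epsLp (hC : CanonicalFactorization P μ s d ξ f φ Φ ε)
    (hξ : StationaryGM P s d ξ) (hν : AdmissibleStep (zstep μ)) (k m : ℤ) (p j : Fin T) :
    inner ℂ (incLp hξ hν k p) (hC.epsLp m j) =
      if m ≤ k then conj (φ (k - m).toNat p j) else 0 := by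
  have hlim : Tendsto (fun N => ∑ l ∈ Finset.range N, ∑ i, φ l p i • hC.epsLp (k - l) i) atTop
      (𝓝 (incLp hξ hν k p)) := by
    rw [Lp.tendsto_Lp_iff_tendsto_eLpNorm']
    refine (hC.movingAverage k p).congr fun N => ?_
    rw [← eLpNorm_neg]
    refine eLpNorm_congr_ae ?_
    have h1 : ∀ l : ℕ, ∀ i, (hC.epsLp (k - l) i : Ω → ℂ) =ᵐ[P] ε (k - l) i := fun l i =>
      (hC.memLp _ _).coeFn_toLp
    have h2 : ∀ l : ℕ, ∀ i, ((φ l p i • hC.epsLp (k - l) i : Lp ℂ 2 P) : Ω → ℂ) =ᵐ[P]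
        φ l p i • (hC.epsLp (k - l) i : Ω → ℂ) := fun l i => Lp.coeFn_smul _ _
    filter_upwards [coeFn_incLp hξ hν k p, ae_all_iff.2 fun l => ae_all_iff.2 (h1 l),
      ae_all_iff.2 fun l => ae_all_iff.2 (h2 l),
      Lp.coeFn_finsetSum (Finset.range N) (fun l : ℕ => ∑ i, φ l p i • hC.epsLp (k - l) i),
      ae_all_iff.2 fun l : ℕ => Lp.coeFn_finsetSum Finset.univ
        (fun i => φ l p i • hC.epsLp (k - l) i)] with ω h3 h4 h5 h6 h7
    simp only [Pi.neg_apply, Pi.sub_apply, h3, h6, neg_sub, Finset.sum_apply, h7, h5, Pi.smul_apply,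
      h4, smul_eq_mul]
  have h1 := ((innerSL ℂ (hC.epsLp m j)).continuous.tendsto _).comp hlim
  have h2 : ∀ N, ∑ l ∈ Finset.range N, ∑ i, φ l p i * inner ℂ (hC.epsLp m j) (hC.epsLp (k - l) i) =
      ∑ l ∈ Finset.range N, if m = k - l then φ l p j else 0 := by
    intro N
    refine Finset.sum_congr rfl fun l _ => ?_
    simp only [hC.inner_epsLp]
    by_cases h : m = k - l <;> simp [h]
  have h3 : inner ℂ (hC.epsLp m j) (incLp hξ hν k p) =
      if m ≤ k then φ (k - m).toNat p j else 0 := by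
    refine tendsto_nhds_unique h1 ?_
    simp only [Function.comp_def, innerSL_apply_apply, inner_sum, inner_smul_right]
    simp_rw [h2]
    refine tendsto_const_nhds.congr' ?_
    filter_upwards [eventually_gt_atTop (k - m).toNat] with N hN
    split_ifs with hmk
    · rw [Finset.sum_eq_single_of_mem (k - m).toNat (Finset.mem_range.2 hN)]
      · rw [if_pos (by omega)]
      · intro l _ hl
        rw [if_neg (by omega)]
    · exact (Finset.sum_eq_zero fun l _ => by rw [if_neg (by omega)]).symm
  rw [← inner_conj_symm, h3]
  split_ifs
  · rfl
  · exact map_zero _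

/-- The isometry with the space of the increments takes the columns of `innMat` to the
innovations. -/
lemma map_E (hC : CanonicalFactorization P μ s d ξ f φ Φ ε) (S : Setting μ s d f R)
    (hξ : StationaryGM P s d ξ) {U : VecL2 T →ₗᵢ[ℂ] Lp ℂ 2 P}
    (hU : ∀ k p, U (S.J k p) = incLp hξ (admissible_zstep S) k p) (m : ℤ) (j : Fin T) :
    U (hC.E S m j) = hC.epsLp m j := by
  refine (eq_map_of_inner_eq (v := fun i : ℤ × Fin T => S.J i.1 i.2)
    (fun y h => S.eq_zero_of_inner_J fun k p => h (k, p)) U (fun i => ?_) ?_).symm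
  · rw [hU, hC.inner_incLp_epsLp, hC.inner_J_E]
  · have h1 : inner ℂ (hC.epsLp m j) (hC.epsLp m j) = inner ℂ (hC.E S m j) (hC.E S m j) := by
      rw [hC.inner_E_E, inner_vecEx_vecEx, hC.inner_epsLp]
    rw [inner_self_eq_norm_sq_to_K, inner_self_eq_norm_sq_to_K] at h1
    have h2 : ‖hC.epsLp m j‖ ^ 2 = ‖hC.E S m j‖ ^ 2 := by exact_mod_cast h1
    exact (pow_left_inj₀ (norm_nonneg _) (norm_nonneg _) two_ne_zero).1 h2

lemma E_mem_closedSpan (hC : CanonicalFactorization P μ s d ξ f φ Φ ε) (S : Setting μ s d f R)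
    (hξ : StationaryGM P s d ξ) {U : VecL2 T →ₗᵢ[ℂ] Lp ℂ 2 P}
    (hU : ∀ k p, U (S.J k p) = incLp hξ (admissible_zstep S) k p) (m : ℤ) (j : Fin T) :
    hC.E S m j ∈ closedSpan S.J (Set.Iic m) := by
  have h1 : hC.epsLp m j ∈ pastSpace P (vecInc (zstep μ) s d ξ) m := by
    rw [hC.innovation, pastSpace_eq_closedSpan hC.memLp]
    exact mem_closedSpan (K := hC.epsLp) (Set.mem_Iic.2 le_rfl) j
  obtain ⟨v, hv, hvU⟩ := (S.mem_pastSpace_iff hξ hU m _).1 h1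
  rw [← hC.map_E S hξ hU] at hvU
  rwa [← U.injective hvU]

end CanonicalFactorization

end Factor

/-! ### The canonical factorization: the estimate -/

namespace CanonicalFactorization

variable {r T : ℕ} {μ s d : Fin r → ℕ} {f R : ℝ → Matrix (Fin T) (Fin T) ℂ}
  {Ω : Type*} [MeasurableSpace Ω] {P : Measure Ω} {ξ : ℤ → Fin T → Ω → ℂ}
  {a : ℕ → Fin T → ℂ} {φ : ℕ → Matrix (Fin T) (Fin T) ℂ} {Φ : ℝ → Matrix (Fin T) (Fin T) ℂ}
  {ε : ℤ → Fin T → Ω → ℂ}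

/-- Multiplication by `innMat` is an isometry, which takes the exponentials to the images of the
innovations. -/
lemma exists_isometry_innMat (hC : CanonicalFactorization P μ s d ξ f φ Φ ε)
    (S : Setting μ s d f R) : ∃ V : VecL2 T →ₗᵢ[ℂ] VecL2 T,
      (∀ k j, V (vecEx T k j) = hC.E S k j) ∧
      ∀ y : VecL2 T, V y =ᵐ[circ] fun t => WithLp.toLp 2 (innMat μ s d R Φ t *ᵥ (y t).ofLp) := by
  have htot : ∀ y : VecL2 T, (∀ i : ℤ × Fin T, inner ℂ (vecEx T i.1 i.2) y = 0) → y = 0 :=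
    fun y h => eq_zero_of_inner_vecEx fun k p => h (k, p)
  obtain ⟨V, hV⟩ := exists_isometry (v := fun i : ℤ × Fin T => vecEx T i.1 i.2)
    (w := fun i => hC.E S i.1 i.2) (fun i j => hC.inner_E_E S _ _ _ _) htot
  refine ⟨V, fun k j => hV (k, j), fun y => ?_⟩
  have hmeas : AEStronglyMeasurable (fun t => (WithLp.toLp 2 (innMat μ s d R Φ t *ᵥ (y t).ofLp) :
      EuclideanSpace ℂ (Fin T))) circ := by
    refine (PiLp.continuous_toLp 2 _).comp_aestronglyMeasurable
      (aestronglyMeasurable_pi_iff.2 fun i => ?_)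
    change AEStronglyMeasurable (fun t => ∑ j, innMat μ s d R Φ t i j * y t j) circ
    exact Finset.aestronglyMeasurable_fun_sum _ fun j _ =>
      (hC.aestronglyMeasurable_innMat S i j).mul (y.memLp_apply j).1
  have hnorm : ∀ᵐ t ∂circ, ‖(WithLp.toLp 2 (innMat μ s d R Φ t *ᵥ (y t).ofLp) :
      EuclideanSpace ℂ (Fin T))‖ = ‖y t‖ := by
    filter_upwards [hC.norm_innMat_mulVec S] with t h
    exact h _
  have hmem : MemLp (fun t => (WithLp.toLp 2 (innMat μ s d R Φ t *ᵥ (y t).ofLp) :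
      EuclideanSpace ℂ (Fin T))) 2 circ :=
    (Lp.memLp y).congr_norm hmeas (by filter_upwards [hnorm] with t h using h.symm)
  have h1 : hmem.toLp _ = V y := by
    refine eq_map_of_inner_eq (v := fun i : ℤ × Fin T => vecEx T i.1 i.2) htot V (fun i => ?_) ?_
    · simp only [hV]
      rw [E, inner_col, inner_vecEx]
      refine integral_congr_ae ?_
      filter_upwards [hmem.coeFn_toLp, hC.conjTranspose_innMat_mul S] with t h2 h3
      rw [adj, h2]
      simp only [Matrix.mulVec_mulVec, h3, Matrix.one_mulVec]
    · have h2 : ‖hmem.toLp _‖ ^ 2 = ‖y‖ ^ 2 := by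
        rw [norm_toLp_sq, norm_Lp_sq]
        refine integral_congr_ae ?_
        filter_upwards [hnorm] with t h
        rw [h]
      exact (pow_left_inj₀ (norm_nonneg _) (norm_nonneg _) two_ne_zero).1 h2
  rw [← h1]
  exact hmem.coeFn_toLp

/-- The function `(χ_μ / β) (B - Ψᵀ ρ)` is the image of the part of `Φᵀ B` with negative frequencies,
so it lies in the past; `(χ_μ / β) Ψᵀ ρ` is the image of the analytic part, so it is orthogonal to the
past. -/
theorem toH_hSimple (hC : CanonicalFactorization P μ s d ξ f φ Φ ε) (S : Setting μ s d f R)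
    (hξ : StationaryGM P s d ξ) {U : VecL2 T →ₗᵢ[ℂ] Lp ℂ 2 P}
    (hU : ∀ k p, U (S.J k p) = incLp hξ (admissible_zstep S) k p)
    (hb : Summable fun k => eucl (Dop μ s d a k)) {Ψ : ℝ → Matrix (Fin T) (Fin T) ℂ}
    (hΨ : ∀ᵐ t ∂circ, Ψ t * Φ t = 1) :
    ∃ hh : MemL2 f (hSimple μ s d a Ψ fun t => (anaPart (hC.matL2 S) hb t).ofLp),
      S.spec.toH hh = S.spec.toH (S.memL2_Bchi hb) - S.resid hb ∧
      ‖S.resid hb‖ = ‖anaPart (hC.matL2 S) hb‖ := by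
  obtain ⟨V, hVE, hV⟩ := hC.exists_isometry_innMat S
  set ρ := anaPart (hC.matL2 S) hb with hρ
  set g : VecL2 T := (memLp_PhiB (hC.matL2 S) hb).toLp _ with hg
  have hB : S.spec.toH (S.memL2_Bchi hb) = V g := by
    refine Lp.ext ?_
    filter_upwards [S.spec.coeFn_toH (S.memL2_Bchi hb), hV g,
      (memLp_PhiB (hC.matL2 S) hb).coeFn_toLp, hC.innMat_mul S] with t h1 h2 h3 h4
    rw [h1, h2, hg, h3]
    simp only [PhiB]
    rw [Matrix.mulVec_mulVec, h4]
    exact Setting.lift_ratio_smul _ t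
  have hlift : lift R (hSimple μ s d a Ψ fun t => (ρ t).ofLp) =ᵐ[circ] V (g - ρ) := by
    rw [map_sub, ← hB]
    filter_upwards [Lp.coeFn_sub (S.spec.toH (S.memL2_Bchi hb)) (V ρ),
      S.spec.coeFn_toH (S.memL2_Bchi hb), hV ρ, hΨ] with t h1 h2 h3 h4
    have h5 : genMat μ s d R t *ᵥ ((Ψ t)ᵀ *ᵥ (ρ t).ofLp) = innMat μ s d R Φ t *ᵥ (ρ t).ofLp := by
      rw [innMat, Matrix.inv_eq_left_inv h4, Matrix.mulVec_mulVec]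
    rw [h1, Pi.sub_apply, h2, h3, ← h5]
    have h6 := Setting.lift_ratio_smul (μ := μ) (s := s) (d := d) (R := R)
      (fun t => Bfun μ s d a t - (Ψ t)ᵀ *ᵥ (ρ t).ofLp) t
    have h7 := Setting.lift_ratio_smul (μ := μ) (s := s) (d := d) (R := R) (Bfun μ s d a) t
    rw [Matrix.mulVec_sub, WithLp.toLp_sub, ← h7] at h6
    exact h6
  have hmeas : AEStronglyMeasurable (hSimple μ s d a Ψ fun t => (ρ t).ofLp) circ := by
    have h1 : AEStronglyMeasurable (fun t => ((Φ t)⁻¹)ᵀ *ᵥ (ρ t).ofLp) circ := by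
      refine aestronglyMeasurable_pi_iff.2 fun i => ?_
      change AEStronglyMeasurable (fun t => ∑ j, (Φ t)⁻¹ j i * ρ t j) circ
      exact Finset.aestronglyMeasurable_fun_sum _ fun j _ =>
        (hC.aestronglyMeasurable_inv j i).mul (ρ.memLp_apply j).1
    have h2 : AEStronglyMeasurable (fun t => ratio (zstep μ) s d t •
        (trigSum (Dop μ s d a) t - ((Φ t)⁻¹)ᵀ *ᵥ (ρ t).ofLp)) circ :=
      (measurable_ratio (zstep μ) s d).aestronglyMeasurable.smul
        ((continuous_trigSum hb).aestronglyMeasurable.sub h1)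
    refine h2.congr ?_
    filter_upwards [hΨ] with t h
    rw [Matrix.inv_eq_left_inv h]
    rfl
  have hh : MemL2 f (hSimple μ s d a Ψ fun t => (ρ t).ofLp) :=
    S.spec.memL2_of_memLp hmeas ((Lp.memLp _).ae_eq hlift.symm)
  have htoH : S.spec.toH hh = V (g - ρ) := Lp.ext ((S.spec.coeFn_toH hh).trans hlift)
  have hpast : S.spec.toH hh ∈ closedSpan S.J (Set.Iio 0) := by
    rw [htoH]
    have hle : closedSpan (vecEx T) (Set.Iio 0) ≤
        (closedSpan S.J (Set.Iio 0)).comap V.toLinearMap := by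
      refine closedSpan_le ?_ fun k hk j => ?_
      · exact (Submodule.isClosed_topologicalClosure _).preimage V.continuous
      · change V (vecEx T k j) ∈ closedSpan S.J (Set.Iio 0)
        rw [hVE]
        have hmono : closedSpan S.J (Set.Iic k) ≤ closedSpan S.J (Set.Iio 0) :=
          closedSpan_le (Submodule.isClosed_topologicalClosure _) fun m hm p =>
            mem_closedSpan (Set.mem_Iio.2 (lt_of_le_of_lt hm hk)) p
        exact hmono (hC.E_mem_closedSpan S hξ hU k j)
    exact hle (sub_anaPart_mem (hC.matL2 S) hb)
  have hdiff : S.spec.toH (S.memL2_Bchi hb) - S.spec.toH hh = V ρ := by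
    rw [htoH, hB, map_sub, sub_sub_cancel]
  have horth : ∀ k : ℤ, k < 0 → ∀ p, inner ℂ (S.J k p) (V ρ) = 0 := by
    intro k hk p
    have h1 : U (S.J k p) ∈ closedSpan hC.epsLp (Set.Iic k) := by
      have h2 := hC.innovation k
      rw [pastSpace_eq_closedSpan hC.memLp] at h2
      change _ ∈ closedSpan (fun k p => (hC.memLp k p).toLp (ε k p)) (Set.Iic k)
      rw [← h2, S.mem_pastSpace_iff hξ hU]
      exact ⟨_, mem_closedSpan (Set.mem_Iic.2 le_rfl) p, rfl⟩
    rw [← U.inner_map_map]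
    refine inner_eq_zero_of_mem_closedSpan' (fun m hm j => ?_) h1
    rw [← hC.map_E S hξ hU, U.inner_map_map, ← hVE, V.inner_map_map]
    exact inner_vecEx_anaPart_of_neg (hC.matL2 S) hb (lt_of_le_of_lt hm hk) j
  have hr := S.eq_sub_resid hb hpast fun k hk p => by rw [hdiff, horth k hk p]
  refine ⟨hh, hr, ?_⟩
  rw [hr, sub_sub_cancel] at hdiff
  rw [hdiff, V.norm_map]

end CanonicalFactorization

end

end GM

theorem mainTheorem1 {Ω : Type*} [MeasurableSpace Ω] (P : Measure Ω) [IsProbabilityMeasure P]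
    {r T : ℕ} (μ s d : Fin r → ℕ)
    (hμ : ∀ i, 0 < μ i) (hs : ∀ i, 0 < s i) (hd : ∀ i, 0 < d i)
    (ξ : ℤ → Fin T → Ω → ℂ) (f : ℝ → Matrix (Fin T) (Fin T) ℂ)
    (hξ : GM.StationaryGM P s d ξ)
    (hmean : ∀ ν : Fin r → ℤ, GM.AdmissibleStep ν → ∀ m p, ∫ ω, GM.vecInc ν s d ξ m p ω ∂P = 0)
    (hf : GM.SpectralDensity P s d ξ f)
    (hmin : GM.Minimality μ s d f)
    (a : ℕ → Fin T → ℂ)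
    (ha : GM.CoefCondition a)
    (hDa : GM.DConverges μ s d a)
    (haD : GM.CoefCondition (GM.Dop μ s d a)) :
    -- the spectral process exists
    (∃ Z, GM.SpectralRep P s d ξ f Z) ∧
    -- the functional is well defined
    (∃ A, GM.IsFunctional P μ s d a ξ A) ∧
    (∀ A, GM.IsSeriesSum P a ξ A → GM.IsFunctional P μ s d a ξ A) ∧
    (∀ A A', GM.IsFunctional P μ s d a ξ A → GM.IsFunctional P μ s d a ξ A' → A =ᵐ[P] A') ∧
    -- the vector `c = F⁻¹ D a` exists and is unique
    ∃ c : ℕ → Fin T → ℂ, GM.FRel μ s d f c (GM.Dop μ s d a) ∧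
      (∀ c', GM.FRel μ s d f c' (GM.Dop μ s d a) → c' = c) ∧
      -- if the matrix determines a bounded operator on `ℓ²`, then solutions in `ℓ²` are this vector
      ((∃ K : ℝ, ∀ x : ℕ →₀ (Fin T → ℂ),
          GM.Fform μ s d f x ≤ K * x.sum fun _ y => GM.eucl y ^ 2) →
        ∀ c' : ℕ → Fin T → ℂ, (Summable fun k => GM.eucl (c' k) ^ 2) →
          (∀ j, HasSum (fun k => GM.Fcoef μ s d f j k *ᵥ c' k) (GM.Dop μ s d a j)) → c' = c) ∧
      ∃ C : ℝ → Fin T → ℂ, GM.IsFourierSum C c ∧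
        -- the spectral characteristic, the estimate and its error
        GM.IsPastProjection (GM.zstep μ) s d f (GM.Bchi μ s d a) (GM.hChar μ s d f a C) ∧
        (∀ Z A, GM.SpectralRep P s d ξ f Z → GM.IsFunctional P μ s d a ξ A →
          ∃ Ahat : Ω → ℂ,
            GM.IsSpectralIntegral P f Z (GM.hChar μ s d f a C)
              (fun ω => Ahat ω + GM.initial μ s d a ξ ω) ∧
            GM.IsOptimalEstimate P μ s d a ξ A Ahat ∧
            (∀ X, GM.IsOptimalEstimate P μ s d a ξ A X → X =ᵐ[P] Ahat) ∧
            MemLp (fun ω => A ω - Ahat ω) 2 P ∧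
            HasSum (fun k => GM.Dop μ s d a k ⬝ᵥ star (c k))
              ((∫ ω, ‖A ω - Ahat ω‖ ^ 2 ∂P : ℝ) : ℂ) ∧
            Integrable (fun t => ((GM.weight μ s d t : ℝ) : ℂ) *
              (C t ⬝ᵥ ((f t)⁻¹ *ᵥ star (C t)))) GM.circ ∧
            ((∫ ω, ‖A ω - Ahat ω‖ ^ 2 ∂P : ℝ) : ℂ) =
              ∫ t, ((GM.weight μ s d t : ℝ) : ℂ) * (C t ⬝ᵥ ((f t)⁻¹ *ᵥ star (C t))) ∂GM.circ) ∧
        -- the case of a canonical factorization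
        (∀ (q : ℕ) (φ : ℕ → Matrix (Fin T) (Fin q) ℂ) (Φ : ℝ → Matrix (Fin T) (Fin q) ℂ)
            (ε : ℤ → Fin q → Ω → ℂ), GM.CanonicalFactorization P μ s d ξ f φ Φ ε →
          (∀ k, Summable fun m => (φ m)ᵀ *ᵥ GM.Dop μ s d (fun l => a (l + k)) m) ∧
          (∃ Ψ : ℝ → Matrix (Fin q) (Fin T) ℂ, ∀ᵐ t ∂GM.circ, Ψ t * Φ t = 1) ∧
          ∃ ρ : ℝ → Fin q → ℂ, GM.IsFourierSum ρ (GM.DAphi μ s d a φ) ∧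
            ∀ Ψ : ℝ → Matrix (Fin q) (Fin T) ℂ, (∀ᵐ t ∂GM.circ, Ψ t * Φ t = 1) →
              GM.IsPastProjection (GM.zstep μ) s d f (GM.Bchi μ s d a)
                (GM.hSimple μ s d a Ψ ρ) ∧
              ∀ Z A Ahat, GM.SpectralRep P s d ξ f Z → GM.IsFunctional P μ s d a ξ A →
                GM.IsOptimalEstimate P μ s d a ξ A Ahat →
                GM.IsSpectralIntegral P f Z (GM.hSimple μ s d a Ψ ρ)
                  (fun ω => Ahat ω + GM.initial μ s d a ξ ω) ∧
                Integrable (fun t => GM.eucl (ρ t) ^ 2) GM.circ ∧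
                ∫ ω, ‖A ω - Ahat ω‖ ^ 2 ∂P = ∫ t, GM.eucl (ρ t) ^ 2 ∂GM.circ ∧
                HasSum (fun k => GM.eucl (GM.DAphi μ s d a φ k) ^ 2)
                  (∫ ω, ‖A ω - Ahat ω‖ ^ 2 ∂P)) := by
  obtain ⟨R, hR⟩ := GM.exists_specFactor (fun i j => (hf.integrable i j).1) hf.posSemidef
  have S : GM.Setting μ s d f R := ⟨hR, hμ, hs, hf.integrable, hmin⟩
  obtain ⟨U, hUgen⟩ := GM.exists_spectral_isometry S hξ hf
  have hU : ∀ k p, U (S.J k p) = GM.incLp hξ (GM.admissible_zstep S) k p := fun k p => by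
    rw [← hUgen, S.toH_gen]
  have hb := haD.1
  refine ⟨S.exists_spectralRep hξ hf, S.exists_isFunctional hξ hU hDa hb,
    fun A hA => GM.Setting.isFunctional_of_isSeriesSum hDa hA, fun A A' hA hA' => ?_,
    _, S.FRel_resid hb, fun c' h => S.eq_of_FRel (S.FRel_resid hb) h, ?_,
    _, S.adj_genMat_isFourierSum (S.resid_mem hb),
    S.isPastProjection_of_toH hb (S.memL2_hChar hb) (S.toH_hChar hb), ?_, ?_⟩
  · filter_upwards [S.isFunctional_add_initial hξ hU hb hA,
      S.isFunctional_add_initial hξ hU hb hA'] with ω h1 h2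
    rw [← h2] at h1
    exact add_right_cancel h1
  · rintro ⟨B, hB⟩ c' hc' hsum
    exact S.eq_of_FRel (S.FRel_resid hb) (GM.FRel_of_bounded S.inner_K_K hB hc' hsum)
  · intro Z A hZ hA
    have hopt := (S.isOptimalEstimate_iff hξ hU hb hA).2 (EventuallyEq.refl _ _)
    refine ⟨_, S.isSpectralIntegral_of_toH hξ hU hb hA hopt hZ (S.memL2_hChar hb)
      (S.toH_hChar hb), hopt, fun X hX => (S.isOptimalEstimate_iff hξ hU hb hA).1 hX,
      S.memLp_error hξ hU hb hA hopt, ?_, S.integrable_weight hb, ?_⟩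
    · rw [S.integral_error hξ hU hb hA hopt]
      exact S.hasSum_resid hb
    · rw [S.integral_error hξ hU hb hA hopt, S.integral_weight hb]
  · intro q φ Φ ε hC
    -- from here on `φ` and `Φ` are square
    obtain rfl := hC.card_eq S hξ
    refine ⟨fun k => (GM.hasSum_DAphi hC hb k).summable, ⟨fun t => (Φ t)⁻¹, ?_⟩, _,
      GM.isFourierSum_anaPart (hC.matL2 S) hb hC, fun Ψ hΨ => ?_⟩
    · filter_upwards [hC.ae_isUnit S] with t h
      exact Matrix.nonsing_inv_mul _ h
    · obtain ⟨hh, hr, hn⟩ := hC.toH_hSimple S hξ hU hb hΨ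
      refine ⟨S.isPastProjection_of_toH hb hh hr, fun Z A Ahat hZ hA hopt => ⟨
        S.isSpectralIntegral_of_toH hξ hU hb hA hopt hZ hh hr,
        GM.integrable_anaPart (hC.matL2 S) hb, ?_, ?_⟩⟩
      · rw [S.integral_error hξ hU hb hA hopt, GM.integral_anaPart, hn]
      · rw [S.integral_error hξ hU hb hA hopt, hn]
        exact GM.hasSum_anaPart (hC.matL2 S) hb hC
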